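/- Let $\beta>1$, let $T_\beta:[0,1]\to[0,1]$, $T_\beta x=\beta x-\lfloor\beta x\rfloor$, and for $h:[0,1]\to\mathbb R$ put $S_nh(x)=\sum_{j=0}^{n-1}h(T_\beta^jx)$. For $n\ge 1$ let $\Sigma_\beta^n$ be the set of words $w=(w_1,\dots,w_n)$ of non-negative integers whose cylinder $I_n(w)=\{x\in[0,1): \lfloor\beta T_\beta^{j-1}x\rfloor=w_j \text{ for } 1\le j\le n\}$ is non-empty. For continuous $h$ on $[0,1]$ let $$P(h)=\lim_{n\to\infty}\frac1n\log\sum_{w\in\Sigma_\beta^n}\ \sup_{y\in I_n(w)}e^{S_nh(y)}$$ be the topological pressure of $h$ for the $\beta$-transformation (the limit exists). Let $f,g$ be positive continuous functions on $[0,1]$ with $f(x)\ge g(y)$ for all $x,y\in[0,1]$, and let $x_0,y_0\in[0,1]$. Let $E(T_\beta,f,g)$ be the set of all $(x,y)\in[0,1]^2$ such that, for infinitely many $n\in\mathbb N$, both $$|T_\beta^nx-x_0|<e^{-S_nf(x)}\quad\text{and}\quad |T_\beta^ny-y_0|<e^{-S_ng(y)}.$$ Then $$\dim_H E(T_\beta,f,g)=\min\{s_1,s_2\},$$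 where $$s_1=\inf\{s\ge0: P(f-s(\log\beta+f))+P(-g)\le0\},\qquad s_2=\inf\{s\ge0: P(-s(\log\beta+g))+\log\beta\le0\}.$$ -/

import Mathlib

open Filter Topology

/-- The `β`-transformation `x ↦ βx - ⌊βx⌋ = βx mod 1`. -/
noncomputable def betaT (β x : ℝ) : ℝ := Int.fract (β * x)

/-- The `k`-th digit (counted from `k = 0`) of the `β`-expansion of `x`: `⌊β T_β^k x⌋`. -/
noncomputable def betaDigit (β x : ℝ) (k : ℕ) : ℕ := ⌊β * (betaT β)^[k] x⌋₊

/-- The cylinder of a word `w` of length `n`: the `x ∈ [0,1)` whose first `n` digits are `w`. -/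
def betaCylinder (β : ℝ) {n : ℕ} (w : Fin n → ℕ) : Set ℝ :=
  {x | x ∈ Set.Ico (0 : ℝ) 1 ∧ ∀ j : Fin n, betaDigit β x j = w j}

/-- A word of length `n` is admissible if it is the beginning of the digit sequence of some
`x ∈ [0,1)`. -/
def betaAdmissible (β : ℝ) (n : ℕ) : Set (Fin n → ℕ) :=
  {w | (betaCylinder β w).Nonempty}

theorem betaT_iterate_mem_Ico (β : ℝ) {x : ℝ} (hx : x ∈ Set.Ico (0 : ℝ) 1) (k : ℕ) :
    (betaT β)^[k] x ∈ Set.Ico (0 : ℝ) 1 := by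
  cases k with
  | zero => simpa using hx
  | succ k =>
    rw [Function.iterate_succ_apply']
    exact ⟨Int.fract_nonneg _, Int.fract_lt_one _⟩

theorem betaAdmissible_finite (β : ℝ) (n : ℕ) : (betaAdmissible β n).Finite := by
  refine (Set.Finite.pi' (fun _ : Fin n => Set.finite_Iic ⌊|β|⌋₊)).subset ?_
  rintro w ⟨x, hx, hw⟩ j
  rw [Set.mem_Iic, ← hw j]
  have h := betaT_iterate_mem_Ico β hx j
  refine Nat.floor_mono ((le_abs_self _).trans ?_)
  rw [abs_mul, abs_of_nonneg h.1]
  exact mul_le_of_le_one_right (abs_nonneg β) h.2.le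

/-- The set `Σ_β^n` of admissible words of length `n`. -/
noncomputable def betaWords (β : ℝ) (n : ℕ) : Finset (Fin n → ℕ) :=
  (betaAdmissible_finite β n).toFinset

/-- The partition sum
`∑_{w ∈ Σ_β^n} sup_{y ∈ I_n(w)} exp (S_n h(y))`, where `S_n h` is the ergodic sum of `h`. -/
noncomputable def betaPartitionSum (β : ℝ) (h : ℝ → ℝ) (n : ℕ) : ℝ :=
  ∑ w ∈ betaWords β n,
    sSup ((fun y => Real.exp (birkhoffSum (betaT β) h n y)) '' betaCylinder β w)

/-- The topological pressure
`P(h) = lim_n (1/n) log ∑_{w ∈ Σ_β^n} sup_{y ∈ I_n(w)} exp (S_n h(y))` of `h` for the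
`β`-transformation. -/
noncomputable def betaPressure (β : ℝ) (h : ℝ → ℝ) : ℝ :=
  limUnder atTop (fun n : ℕ => Real.log (betaPartitionSum β h n) / n)

/-- The set of pairs `(x, y) ∈ [0,1]²` such that, for infinitely many `n`, both
`|T_β^n x - x₀| < exp (-S_n f(x))` and `|T_β^n y - y₀| < exp (-S_n g(y))`. -/
def shrinkingTargetSet (β : ℝ) (f g : ℝ → ℝ) (x₀ y₀ : ℝ) : Set (ℝ × ℝ) :=
  {p | p.1 ∈ Set.Icc (0 : ℝ) 1 ∧ p.2 ∈ Set.Icc (0 : ℝ) 1 ∧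
    ∃ᶠ n : ℕ in atTop,
      |(betaT β)^[n] p.1 - x₀| < Real.exp (-birkhoffSum (betaT β) f n p.1) ∧
      |(betaT β)^[n] p.2 - y₀| < Real.exp (-birkhoffSum (betaT β) g n p.2)}

theorem birkhoffSum_betaT_bounds (β : ℝ) {h : ℝ → ℝ} {C : ℝ}
    (hC : ∀ x ∈ Set.Icc (0 : ℝ) 1, |h x| ≤ C) {x : ℝ} (hx : x ∈ Set.Ico (0 : ℝ) 1) (n : ℕ) :
    |birkhoffSum (betaT β) h n x| ≤ n * C := by
  unfold birkhoffSum
  refine (Finset.abs_sum_le_sum_abs _ _).trans ?_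
  refine (Finset.sum_le_card_nsmul _ _ C fun k _ => hC _ ?_).trans ?_
  · exact Set.Ico_subset_Icc_self (betaT_iterate_mem_Ico β hx k)
  · simp

theorem betaCylinder_exp_bddAbove (β : ℝ) {h : ℝ → ℝ} {C : ℝ}
    (hC : ∀ x ∈ Set.Icc (0 : ℝ) 1, |h x| ≤ C) {n : ℕ} (w : Fin n → ℕ) :
    BddAbove ((fun y => Real.exp (birkhoffSum (betaT β) h n y)) '' betaCylinder β w) := by
  refine ⟨Real.exp (n * C), ?_⟩
  rintro _ ⟨y, hy, rfl⟩
  exact Real.exp_le_exp.2 (abs_le.1 (birkhoffSum_betaT_bounds β hC hy.1 n)).2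

theorem betaCylinder_sSup_nonneg (β : ℝ) (h : ℝ → ℝ) {n : ℕ} (w : Fin n → ℕ) :
    0 ≤ sSup ((fun y => Real.exp (birkhoffSum (betaT β) h n y)) '' betaCylinder β w) := by
  refine Real.sSup_nonneg ?_
  rintro _ ⟨y, _, rfl⟩
  positivity

theorem betaPartitionSum_lower (β : ℝ) {h : ℝ → ℝ} {C : ℝ}
    (hC : ∀ x ∈ Set.Icc (0 : ℝ) 1, |h x| ≤ C) (n : ℕ) :
    Real.exp (-(n * C)) ≤ betaPartitionSum β h n := by
  have h0 : (0 : ℝ) ∈ Set.Ico (0 : ℝ) 1 := by simp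
  have hcyl : (0 : ℝ) ∈ betaCylinder β (fun j : Fin n => betaDigit β 0 j) := ⟨h0, fun _ => rfl⟩
  have hmem : (fun j : Fin n => betaDigit β 0 j) ∈ betaWords β n := by
    rw [betaWords, Set.Finite.mem_toFinset]
    exact ⟨0, hcyl⟩
  refine le_trans ?_ (Finset.single_le_sum
    (fun w _ => betaCylinder_sSup_nonneg β h w) hmem)
  refine le_trans ?_ (le_csSup (betaCylinder_exp_bddAbove β hC _) ⟨0, hcyl, rfl⟩)
  exact Real.exp_le_exp.2 (abs_le.1 (birkhoffSum_betaT_bounds β hC h0 n)).1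

theorem betaPartitionSum_add_le (β : ℝ) {h : ℝ → ℝ} {C : ℝ}
    (hC : ∀ x ∈ Set.Icc (0 : ℝ) 1, |h x| ≤ C) (m n : ℕ) :
    betaPartitionSum β h (m + n) ≤ betaPartitionSum β h m * betaPartitionSum β h n := by
  classical
  let F : ∀ {k : ℕ}, (Fin k → ℕ) → ℝ := fun {k} w =>
    sSup ((fun y => Real.exp (birkhoffSum (betaT β) h k y)) '' betaCylinder β w)
  let φ : (Fin (m + n) → ℕ) → (Fin m → ℕ) × (Fin n → ℕ) :=
    fun w => (fun j => w (Fin.castAdd n j), fun j => w (Fin.natAdd m j))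
  have hφ : Function.Injective φ := by
    intro w w' hww
    have h1 := congrArg Prod.fst hww
    have h2 := congrArg Prod.snd hww
    funext j
    refine Fin.addCases (fun i => ?_) (fun i => ?_) j
    · exact congrFun h1 i
    · exact congrFun h2 i
  have hsplit : ∀ w : Fin (m + n) → ℕ, ∀ y ∈ betaCylinder β w,
      y ∈ betaCylinder β (φ w).1 ∧ (betaT β)^[m] y ∈ betaCylinder β (φ w).2 := by
    intro w y hy
    refine ⟨⟨hy.1, fun j => ?_⟩, ⟨betaT_iterate_mem_Ico β hy.1 m, fun j => ?_⟩⟩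
    · exact hy.2 (Fin.castAdd n j)
    · have := hy.2 (Fin.natAdd m j)
      refine Eq.trans ?_ this
      simp only [betaDigit, Fin.val_natAdd]
      rw [← Function.iterate_add_apply, add_comm]
  have hmem : ∀ w ∈ betaWords β (m + n), φ w ∈ betaWords β m ×ˢ betaWords β n := by
    intro w hw
    rw [betaWords, Set.Finite.mem_toFinset] at hw
    obtain ⟨y, hy⟩ := hw
    rw [Finset.mem_product]
    simp only [betaWords, Set.Finite.mem_toFinset]
    exact ⟨⟨y, (hsplit w y hy).1⟩, ⟨_, (hsplit w y hy).2⟩⟩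
  have hle : ∀ w ∈ betaWords β (m + n), F w ≤ F (φ w).1 * F (φ w).2 := by
    intro w hw
    rw [betaWords, Set.Finite.mem_toFinset] at hw
    refine csSup_le (hw.image _) ?_
    rintro _ ⟨y, hy, rfl⟩
    have hs := hsplit w y hy
    simp only [birkhoffSum_add, Real.exp_add]
    refine mul_le_mul ?_ ?_ (Real.exp_nonneg _) (betaCylinder_sSup_nonneg β h _)
    · exact le_csSup (betaCylinder_exp_bddAbove β hC _) ⟨y, hs.1, rfl⟩
    · exact le_csSup (betaCylinder_exp_bddAbove β hC _) ⟨_, hs.2, rfl⟩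
  calc betaPartitionSum β h (m + n)
      ≤ ∑ w ∈ betaWords β (m + n), F (φ w).1 * F (φ w).2 := Finset.sum_le_sum hle
    _ = ∑ q ∈ (betaWords β (m + n)).image φ, F q.1 * F q.2 :=
        (Finset.sum_image (f := fun q : (Fin m → ℕ) × (Fin n → ℕ) => F q.1 * F q.2)
          (fun a _ b _ hab => hφ hab)).symm
    _ ≤ ∑ q ∈ betaWords β m ×ˢ betaWords β n, F q.1 * F q.2 := by
        refine Finset.sum_le_sum_of_subset_of_nonneg (Finset.image_subset_iff.2 hmem) ?_
        intro q _ _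
        exact mul_nonneg (betaCylinder_sSup_nonneg β h _) (betaCylinder_sSup_nonneg β h _)
    _ = betaPartitionSum β h m * betaPartitionSum β h n := by
        rw [Finset.sum_product, betaPartitionSum, betaPartitionSum, Finset.sum_mul_sum]

/-- For a continuous potential the limit in the definition of the pressure exists, so that
`betaPressure` is its value. -/
theorem tendsto_betaPressure (β : ℝ) {h : ℝ → ℝ} (hh : ContinuousOn h (Set.Icc 0 1)) :
    Tendsto (fun n : ℕ => Real.log (betaPartitionSum β h n) / n) atTop
      (𝓝 (betaPressure β h)) := by
  obtain ⟨C, hC⟩ := isCompact_Icc.exists_bound_of_continuousOn hh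
  simp only [Real.norm_eq_abs] at hC
  have hpos : ∀ n, 0 < betaPartitionSum β h n := fun n =>
    (Real.exp_pos _).trans_le (betaPartitionSum_lower β hC n)
  have hsub : Subadditive fun n : ℕ => Real.log (betaPartitionSum β h n) := by
    intro m n
    change Real.log _ ≤ Real.log _ + Real.log _
    rw [← Real.log_mul (hpos m).ne' (hpos n).ne']
    exact Real.log_le_log (hpos _) (betaPartitionSum_add_le β hC m n)
  have hC0 : 0 ≤ C := (abs_nonneg _).trans (hC 0 (by simp))
  refine tendsto_nhds_limUnder ⟨_, hsub.tendsto_lim ⟨-C, ?_⟩⟩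
  rintro _ ⟨n, rfl⟩
  rcases Nat.eq_zero_or_pos n with rfl | hn
  · simpa using hC0
  · have hn' : (0 : ℝ) < n := by exact_mod_cast hn
    have := (Real.le_log_iff_exp_le (hpos n)).2 (betaPartitionSum_lower β hC n)
    change -C ≤ Real.log _ / _
    rw [le_div_iff₀ hn']
    linarith

/-! ### Arithmetic of the β-transformation on cylinders; left endpoints. -/

section

variable {β : ℝ}

/-! Upper bound. If the `n`-th condition holds and `c`, `c'` are the left endpoints of the order-`n`
cylinders of `x`, `y`, then `(x, y)` lies in a rectangle with sides about `β⁻ⁿ exp (-S_n f(c))` and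
`β⁻ⁿ exp (-S_n g(c'))`; since `f ≥ g`, the first side is the shorter. Covering each rectangle by one
square of the longer side gives a sum of `s`-th powers of exponential rate `log β + P(-s(log β +
g))` (`dimH_enlargedTargetSet_le_of_snd`); cutting it into about `exp (S_n f(c) - S_n g(c'))`
squares of the shorter side gives the rate `P(f - s(log β + f)) + P(-g)`
(`dimH_enlargedTargetSet_le_of_fst`). Both rates are strictly decreasing in `s`.

Lower bound. The β-shift need not be Markov, so everything is built from full cylinders, which
concatenate freely (`IsFullBranch.comp`). They carry the whole pressure, because lowering the last
non-zero digit makes a word full and moves its orbit little (`exists_isFullBranch_near`). By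
pigeonhole there are families `A`, `A'` of full cylinders of a large order `m` on which `S_m f ≈ mτ`
and `S_m g ≈ mσ`, with cardinalities prescribed by `P(q₁ f)` and `P(q₂ g)`
(`eventually_exists_fullPoints_level`). A phase (`exists_phase`) consists of `k` blocks from `A` and
then a single long word near `x₀` in the first coordinate, and of `k` blocks from `A'`, a shorter
word near `y₀` and then arbitrary full blocks in the second. The product of the uniform measures on
such sequences is critical at two scales only: where the `y₀`-word ends and where the `x₀`-word
ends. They require `log (|A||A'|) / m` to exceed `s(log β + σ)` and `s(log β + τ) - (τ - σ)`
respectively. The second is the larger when `s ≥ 1` and the first when `s ≤ 1`; the weights `(q₁,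
q₂) = (1 - s, -1)` and `(0, -s)` turn these into `s < s₁` and `s < s₂`. The mass distribution
principle (`le_dimH_of_pairCount`) concludes. -/

theorem betaT_mem_Ico (β x : ℝ) : betaT β x ∈ Set.Ico (0 : ℝ) 1 :=
  ⟨Int.fract_nonneg _, Int.fract_lt_one _⟩

theorem betaT_iterate_mem_Icc (β : ℝ) {x : ℝ} (hx : x ∈ Set.Icc (0 : ℝ) 1) (k : ℕ) :
    (betaT β)^[k] x ∈ Set.Icc (0 : ℝ) 1 := by
  cases k with
  | zero => simpa using hx
  | succ k =>
    rw [Function.iterate_succ_apply']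
    exact Set.Ico_subset_Icc_self (betaT_mem_Ico β _)

theorem betaT_natCast_add_div (hβ : 1 < β) (d : ℕ) {z : ℝ} (hz : z ∈ Set.Ico (0 : ℝ) 1) :
    betaT β ((d + z) / β) = z := by
  have h : β * ((d + z) / β) = d + z := by field_simp
  rw [betaT, h, Int.fract_natCast_add, Int.fract_eq_self.2 hz]

theorem betaT_iterate_succ_eq (hβ : 1 < β) {x : ℝ} (hx : x ∈ Set.Ico (0 : ℝ) 1) (k : ℕ) :
    (betaT β)^[k + 1] x = β * (betaT β)^[k] x - betaDigit β x k := by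
  have h0 : 0 ≤ β * (betaT β)^[k] x :=
    mul_nonneg (by linarith) (betaT_iterate_mem_Ico β hx k).1
  rw [Function.iterate_succ_apply', betaT, Int.fract, betaDigit]
  congr 1
  rw [← Int.natCast_floor_eq_floor h0]
  simp

theorem betaT_iterate_sub_of_betaDigit_eq (hβ : 1 < β) {x y : ℝ} (hx : x ∈ Set.Ico (0 : ℝ) 1)
    (hy : y ∈ Set.Ico (0 : ℝ) 1) {n : ℕ} (h : ∀ j < n, betaDigit β x j = betaDigit β y j)
    {i : ℕ} (hi : i ≤ n) :
    (betaT β)^[i] x - (betaT β)^[i] y =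
      ((betaT β)^[n] x - (betaT β)^[n] y) / β ^ (n - i) := by
  induction n with
  | zero => simp [Nat.le_zero.1 hi]
  | succ n ih =>
    rcases Nat.of_le_succ hi with h' | h'
    · rw [ih (fun j hj => h j (by omega)) h', betaT_iterate_succ_eq hβ hx,
        betaT_iterate_succ_eq hβ hy, h n (by omega), Nat.succ_sub h', pow_succ]
      have : β ≠ 0 := by linarith
      field_simp
      ring
    · simp [h']

theorem betaT_iterate_le (hβ : 1 < β) {x : ℝ} (hx : x ∈ Set.Ico (0 : ℝ) 1) {n i : ℕ}
    (hi : i ≤ n) : (betaT β)^[n] x / β ^ (n - i) ≤ (betaT β)^[i] x := by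
  have hb : 0 < β := by linarith
  induction n with
  | zero => simp [Nat.le_zero.1 hi]
  | succ n ih =>
    rcases Nat.of_le_succ hi with h' | h'
    · refine le_trans ?_ (ih h')
      rw [betaT_iterate_succ_eq hβ hx, Nat.succ_sub h', pow_succ, div_le_div_iff₀ (by positivity)
        (by positivity)]
      have : (0 : ℝ) ≤ betaDigit β x n * β ^ (n - i) := by positivity
      nlinarith
    · simp [h']

/-- The left endpoint of the cylinder of order `n` that contains `x`. -/
noncomputable def cylinderLeft (β : ℝ) (n : ℕ) (x : ℝ) : ℝ := x - (betaT β)^[n] x / β ^ n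

/-- Subtracting the tail `T^n x / βⁿ` keeps the first `n` digits and replaces all later ones by
zero; the orbit stays in `[0,1)` by `betaT_iterate_le`, so no digit changes on the way. -/
theorem betaT_iterate_cylinderLeft (hβ : 1 < β) {x : ℝ} (hx : x ∈ Set.Ico (0 : ℝ) 1) {n i : ℕ}
    (hi : i ≤ n) :
    (betaT β)^[i] (cylinderLeft β n x) = (betaT β)^[i] x - (betaT β)^[n] x / β ^ (n - i) := by
  have hb : 0 < β := by linarith
  induction i with
  | zero => simp [cylinderLeft]
  | succ i ih =>
    have hz : (betaT β)^[i + 1] x - (betaT β)^[n] x / β ^ (n - (i + 1)) ∈ Set.Ico (0 : ℝ) 1 := by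
      refine ⟨sub_nonneg.2 (betaT_iterate_le hβ hx hi), ?_⟩
      have h1 := (betaT_iterate_mem_Ico β hx (i + 1)).2
      have h2 := (betaT_iterate_mem_Ico β hx n).1
      have : 0 ≤ (betaT β)^[n] x / β ^ (n - (i + 1)) := by positivity
      linarith
    rw [Function.iterate_succ_apply', ih (by omega)]
    convert betaT_natCast_add_div hβ (betaDigit β x i) hz using 2
    rw [betaT_iterate_succ_eq hβ hx, show n - i = (n - (i + 1)) + 1 by omega, pow_succ]
    field_simp
    ring

theorem cylinderLeft_mem_Ico (hβ : 1 < β) {x : ℝ} (hx : x ∈ Set.Ico (0 : ℝ) 1) (n : ℕ) :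
    cylinderLeft β n x ∈ Set.Ico (0 : ℝ) 1 := by
  have hb : 0 < β := by linarith
  have h1 := betaT_iterate_le hβ hx (Nat.zero_le n)
  have h2 := (betaT_iterate_mem_Ico β hx n).1
  have : 0 ≤ (betaT β)^[n] x / β ^ n := by positivity
  simp only [Nat.sub_zero, Function.iterate_zero, id_eq] at h1
  exact ⟨by unfold cylinderLeft; linarith, by unfold cylinderLeft; linarith [hx.2]⟩

theorem betaT_iterate_cylinderLeft_self (hβ : 1 < β) {x : ℝ} (hx : x ∈ Set.Ico (0 : ℝ) 1)
    (n : ℕ) : (betaT β)^[n] (cylinderLeft β n x) = 0 := by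
  simp [betaT_iterate_cylinderLeft hβ hx le_rfl]

theorem betaDigit_cylinderLeft (hβ : 1 < β) {x : ℝ} (hx : x ∈ Set.Ico (0 : ℝ) 1) {n i : ℕ}
    (hi : i < n) : betaDigit β (cylinderLeft β n x) i = betaDigit β x i := by
  have hb : 0 < β := by linarith
  have h1 := betaT_iterate_succ_eq hβ (cylinderLeft_mem_Ico hβ hx n) i
  have h2 := betaT_iterate_succ_eq hβ hx i
  rw [betaT_iterate_cylinderLeft hβ hx hi.le, betaT_iterate_cylinderLeft hβ hx
    (Nat.succ_le_of_lt hi), h2, show n - i = (n - (i + 1)) + 1 by omega, pow_succ] at h1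
  have : (betaDigit β (cylinderLeft β n x) i : ℝ) = betaDigit β x i := by
    have h3 : β * ((betaT β)^[n] x / (β ^ (n - (i + 1)) * β)) =
      (betaT β)^[n] x / β ^ (n - (i + 1)) := by field_simp
    rw [mul_sub, h3] at h1
    linarith
  exact_mod_cast this

/-- The left endpoints of the cylinders of order `n`. -/
def leftPointSet (β : ℝ) (n : ℕ) : Set ℝ := {x | x ∈ Set.Ico (0 : ℝ) 1 ∧ (betaT β)^[n] x = 0}

theorem injOn_betaDigit_leftPointSet (hβ : 1 < β) (n : ℕ) :
    Set.InjOn (fun x => fun j : Fin n => betaDigit β x j) (leftPointSet β n) := by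
  intro x hx y hy hxy
  have := betaT_iterate_sub_of_betaDigit_eq hβ hx.1 hy.1
    (fun j hj => congrFun hxy ⟨j, hj⟩) (Nat.zero_le n)
  rw [hx.2, hy.2] at this
  simp only [Function.iterate_zero, id_eq, sub_self, zero_div] at this
  linarith

theorem leftPointSet_finite (hβ : 1 < β) (n : ℕ) : (leftPointSet β n).Finite := by
  refine Set.Finite.of_finite_image ((betaAdmissible_finite β n).subset ?_)
    (injOn_betaDigit_leftPointSet hβ n)
  rintro _ ⟨x, hx, rfl⟩
  exact ⟨x, hx.1, fun _ => rfl⟩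

/-! ### Full cylinders. -/

/-- A full cylinder of order `n` with left endpoint `c`: the map `T_β^n` sends
`[c, c + β⁻ⁿ)` onto `[0, 1)`, affinely at every step. -/
def IsFullBranch (β : ℝ) (n : ℕ) (c : ℝ) : Prop :=
  0 ≤ c ∧ c + (β ^ n)⁻¹ ≤ 1 ∧ (betaT β)^[n] c = 0 ∧
    ∀ j ≤ n, ∀ x ∈ Set.Ico (0 : ℝ) 1,
      (betaT β)^[j] (c + x / β ^ n) = (betaT β)^[j] c + x / β ^ (n - j)

namespace IsFullBranch

theorem point_mem (hβ : 1 < β) {n : ℕ} {c : ℝ} (h : IsFullBranch β n c) {x : ℝ}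
    (hx : x ∈ Set.Ico (0 : ℝ) 1) : c + x / β ^ n ∈ Set.Ico (0 : ℝ) 1 := by
  have hb : 0 < (β ^ n)⁻¹ := by have : 0 < β := by linarith
                                positivity
  have h0 := h.1
  have h1 := h.2.1
  rw [div_eq_mul_inv]
  constructor
  · have := mul_nonneg hx.1 hb.le
    linarith
  · have := mul_lt_mul_of_pos_right hx.2 hb
    linarith

theorem mem_Ico (hβ : 1 < β) {n : ℕ} {c : ℝ} (h : IsFullBranch β n c) :
    c ∈ Set.Ico (0 : ℝ) 1 := by
  simpa using h.point_mem hβ (x := 0) (by simp)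

theorem mem_leftPointSet (hβ : 1 < β) {n : ℕ} {c : ℝ} (h : IsFullBranch β n c) :
    c ∈ leftPointSet β n := ⟨h.mem_Ico hβ, h.2.2.1⟩

theorem iterate_point {n : ℕ} {c : ℝ} (h : IsFullBranch β n c) {x : ℝ}
    (hx : x ∈ Set.Ico (0 : ℝ) 1) : (betaT β)^[n] (c + x / β ^ n) = x := by
  rw [h.2.2.2 n le_rfl x hx, h.2.2.1]
  simp

theorem zero_order (β : ℝ) : IsFullBranch β 0 0 := by
  refine ⟨le_rfl, by simp, by simp, fun j hj x _ => ?_⟩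
  simp [Nat.le_zero.1 hj]

/-- Prepending a digit `d` needs only that the translate by `d` of the cylinder at `c` end no later
than `β`. -/
theorem cons (hβ : 1 < β) {n : ℕ} {c : ℝ} (h : IsFullBranch β n c) (d : ℕ)
    (hd : d + c + (β ^ n)⁻¹ ≤ β) : IsFullBranch β (n + 1) ((d + c) / β) := by
  have hb : 0 < β := by linarith
  have hc := h.mem_Ico hβ
  have key : betaT β ((d + c) / β) = c := betaT_natCast_add_div hβ d hc
  refine ⟨div_nonneg (add_nonneg (by positivity) h.1) hb.le, ?_, ?_, ?_⟩
  · rw [pow_succ, mul_inv, ← div_eq_mul_inv, ← add_div, div_le_one hb]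
    exact hd
  · rw [Function.iterate_succ_apply, key, h.2.2.1]
  · intro j hj x hx
    have e : (d + c) / β + x / β ^ (n + 1) = (d + (c + x / β ^ n)) / β := by
      rw [pow_succ]; field_simp; ring
    cases j with
    | zero => simp
    | succ j =>
      rw [Function.iterate_succ_apply, Function.iterate_succ_apply, key, e,
        betaT_natCast_add_div hβ d (h.point_mem hβ hx), h.2.2.2 j (by omega) x hx,
        Nat.add_sub_add_right]

/-- Free concatenation, the substitute for a Markov structure in the construction of Cantor sets. -/
theorem comp (hβ : 1 < β) {n n' : ℕ} {c c' : ℝ} (h : IsFullBranch β n c)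
    (h' : IsFullBranch β n' c') : IsFullBranch β (n + n') (c + c' / β ^ n) := by
  have hb : 0 < β := by linarith
  have hc' := h'.mem_Ico hβ
  refine ⟨(h.point_mem hβ hc').1, ?_, ?_, ?_⟩
  · have h1 : (c' + (β ^ n')⁻¹) / β ^ n ≤ 1 / β ^ n := by
      gcongr
      exact h'.2.1
    have h2 := h.2.1
    rw [one_div] at h1
    have e : c + c' / β ^ n + (β ^ (n + n'))⁻¹ = c + (c' + (β ^ n')⁻¹) / β ^ n := by
      rw [pow_add]; field_simp; ring
    linarith
  · rw [add_comm n n', Function.iterate_add_apply, h.iterate_point hc', h'.2.2.1]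
  · intro j hj x hx
    have e : c + c' / β ^ n + x / β ^ (n + n') = c + (c' + x / β ^ n') / β ^ n := by
      rw [pow_add]; field_simp; ring
    rw [e]
    rcases le_total j n with hjn | hjn
    · rw [h.2.2.2 j hjn _ (h'.point_mem hβ hx), h.2.2.2 j hjn _ hc',
        show n + n' - j = (n - j) + n' by omega, pow_add]
      field_simp
      ring
    · obtain ⟨i, rfl⟩ := Nat.exists_eq_add_of_le hjn
      rw [add_comm n i, Function.iterate_add_apply, Function.iterate_add_apply,
        h.iterate_point (h'.point_mem hβ hx), h.iterate_point hc', h'.2.2.2 i (by omega) x hx,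
        show n + n' - (i + n) = n' - i by omega]

theorem zero (hβ : 1 < β) (n : ℕ) : IsFullBranch β n 0 := by
  induction n with
  | zero => exact zero_order β
  | succ n ih =>
    have := ih.cons hβ 0 (by
      have : (β ^ n)⁻¹ ≤ 1 := inv_le_one_of_one_le₀ (one_le_pow₀ hβ.le)
      simp
      linarith)
    simpa using this

/-- On a full cylinder `T^n` is affine with its only zero at the left endpoint, so no other cylinder
of the same order starts inside. All later counting of cylinders rests on this separation. -/
theorem add_inv_le_of_lt (hβ : 1 < β) {n : ℕ} {c c' : ℝ} (h : IsFullBranch β n c)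
    (h' : (betaT β)^[n] c' = 0) (hlt : c < c') : c + (β ^ n)⁻¹ ≤ c' := by
  have hb : 0 < β ^ n := by have : 0 < β := by linarith
                            positivity
  by_contra! hcon
  have h1 := h.iterate_point (x := (c' - c) * β ^ n) ⟨mul_nonneg (by linarith) hb.le, by
    rw [← lt_div_iff₀ hb, one_div]; linarith⟩
  rw [mul_div_cancel_right₀ _ hb.ne', add_sub_cancel, h'] at h1
  have : 0 < (c' - c) * β ^ n := mul_pos (by linarith) hb
  linarith

end IsFullBranch

/-- Every interval of length at least `(n + 1) β⁻ⁿ` contains a full cylinder of order `n`. -/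
theorem exists_isFullBranch_subset (hβ : 1 < β) (n : ℕ) {a b : ℝ} (ha : 0 ≤ a) (hb : b ≤ 1)
    (hab : (n + 1) / β ^ n ≤ b - a) :
    ∃ c, IsFullBranch β n c ∧ a ≤ c ∧ c + (β ^ n)⁻¹ ≤ b := by
  have hb0 : 0 < β := by linarith
  induction n generalizing a b with
  | zero =>
    norm_num at hab
    exact ⟨0, IsFullBranch.zero_order β, by linarith, by norm_num; linarith⟩
  | succ n ih =>
    have hpn : 0 < β ^ n := by positivity
    have hpn1 : 0 < (β ^ (n + 1))⁻¹ := by positivity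
    have hlen : ((n : ℝ) + 1) / β ^ (n + 1) + (β ^ (n + 1))⁻¹ ≤ b - a := by
      refine le_trans (le_of_eq ?_) hab
      push_cast
      field_simp
    have hlt : a < b := by
      have : 0 ≤ ((n : ℝ) + 1) / β ^ (n + 1) := by positivity
      linarith
    have hle1 : ((n : ℝ) + 1) / β ^ n = β * (((n : ℝ) + 1) / β ^ (n + 1)) := by
      rw [pow_succ]; field_simp
    have hinv : (β ^ (n + 1))⁻¹ * β = (β ^ n)⁻¹ := by
      rw [pow_succ]; field_simp
    -- reduction to an interval inside one cylinder of order one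
    have inner : ∀ (d : ℕ) (a' b' : ℝ), (d : ℝ) ≤ β * a' → β * b' ≤ d + 1 → β * b' ≤ β → a ≤ a' →
        b' ≤ b → ((n : ℝ) + 1) / β ^ (n + 1) ≤ b' - a' →
        ∃ c, IsFullBranch β (n + 1) c ∧ a ≤ c ∧ c + (β ^ (n + 1))⁻¹ ≤ b := by
      intro d a' b' h1 h2 h3 h4 h5 h6
      obtain ⟨c, hc, hc1, hc2⟩ := ih (a := β * a' - d) (b := β * b' - d) (by linarith)
        (by linarith) (by rw [hle1]; nlinarith)
      refine ⟨(d + c) / β, hc.cons hβ d (by linarith), ?_, ?_⟩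
      · rw [le_div_iff₀ hb0]
        nlinarith
      · rw [← le_sub_iff_add_le, div_le_iff₀ hb0, sub_mul, hinv]
        nlinarith
    set d := ⌊β * a⌋₊ with hd
    have hd1 : (d : ℝ) ≤ β * a := Nat.floor_le (by positivity)
    have hd2 : β * a < d + 1 := Nat.lt_floor_add_one _
    by_cases hcase : β * b ≤ d + 1
    · exact inner d a b hd1 hcase (by nlinarith) le_rfl le_rfl (by linarith)
    push Not at hcase
    have hdb : ((d : ℝ) + 1) / β < b := by
      rw [div_lt_iff₀ hb0]; linarith
    -- If at least `β^{-(n+1)}` of the interval lies to the right of the digit boundary `(d+1)/β`,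
    -- the word `(d+1)0…0` fits there. Otherwise cutting at the boundary loses less than
    -- `β^{-(n+1)}`, which is the slack between the numerators `n + 2` and `n + 1`.
    by_cases hR : ((d : ℝ) + 1) / β + (β ^ (n + 1))⁻¹ ≤ b
    · refine ⟨_, (IsFullBranch.zero hβ n).cons hβ (d + 1) ?_, ?_, ?_⟩
      · have := mul_le_mul_of_nonneg_right hR hb0.le
        rw [add_mul, hinv, div_mul_cancel₀ _ hb0.ne'] at this
        push_cast
        nlinarith
      · rw [le_div_iff₀ hb0]; push_cast; linarith
      · push_cast
        simpa using hR
    · push Not at hR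
      have hβd : β * (((d : ℝ) + 1) / β) = d + 1 := by field_simp
      refine inner d a ((d + 1) / β) hd1 hβd.le (by nlinarith) le_rfl hdb.le (by linarith)

/-- Lowering the last non-zero digit of an admissible word makes it full. -/
theorem exists_isFullBranch_near (hβ : 1 < β) {n : ℕ} {x : ℝ} (hx : x ∈ leftPointSet β n)
    (hx0 : x ≠ 0) :
    ∃ l, 1 ≤ l ∧ l ≤ n ∧ IsFullBranch β n (x - (β ^ l)⁻¹) ∧
      ∑ j ∈ Finset.range n, |(betaT β)^[j] x - (betaT β)^[j] (x - (β ^ l)⁻¹)| ≤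
        (1 - (β ^ l)⁻¹) / (β - 1) := by
  have hb : 0 < β := by linarith
  have hb1 : 0 < β - 1 := by linarith
  induction n generalizing x with
  | zero => exact absurd hx.2 hx0
  | succ n ih =>
    have hTx : betaT β x ∈ leftPointSet β n :=
      ⟨betaT_mem_Ico β x, by rw [← Function.iterate_succ_apply]; exact hx.2⟩
    set d := betaDigit β x 0 with hd
    have hxd : betaT β x = β * x - d := betaT_iterate_succ_eq hβ hx.1 0
    have hxe : x = (d + betaT β x) / β := by rw [hxd]; field_simp; ring
    have hx1 : β * x < β := by nlinarith [hx.1.2]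
    -- The bound is `β⁻¹ + ⋯ + β⁻ˡ`: the two orbits are `β^{-(l-j)}` apart at times `j < l` and
    -- coincide afterwards. If `T x = 0`, the first digit is the last non-zero one and `l = 1`.
    by_cases h0 : betaT β x = 0
    · have hdpos : 1 ≤ d := by
        rw [Nat.one_le_iff_ne_zero]
        intro hd0
        rw [h0, hd0] at hxe
        simp at hxe
        exact hx0 hxe
      have hcast : ((d - 1 : ℕ) : ℝ) = d - 1 := by push_cast [hdpos]; ring
      have hc : x - (β ^ 1)⁻¹ = ((d - 1 : ℕ) + 0) / β := by
        rw [hcast, hxe, h0]; field_simp; ring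
      have hTc : betaT β (x - (β ^ 1)⁻¹) = 0 := by
        rw [hc]; exact betaT_natCast_add_div hβ _ (by simp)
      refine ⟨1, le_rfl, by omega, ?_, ?_⟩
      · rw [hc]
        refine (IsFullBranch.zero hβ n).cons hβ _ ?_
        have : (β ^ n)⁻¹ ≤ 1 := inv_le_one_of_one_le₀ (one_le_pow₀ hβ.le)
        rw [hcast]
        linarith
      · rw [Finset.sum_range_succ']
        simp only [Function.iterate_succ_apply, hTc, h0, sub_self, abs_zero,
          Finset.sum_const_zero, zero_add, Function.iterate_zero, id_eq]
        rw [sub_sub_cancel, abs_of_pos (by positivity)]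
        apply le_of_eq
        field_simp
    · obtain ⟨l, hl1, hl2, hbr, hsum⟩ := ih hTx h0
      have hc : x - (β ^ (l + 1))⁻¹ = (d + (betaT β x - (β ^ l)⁻¹)) / β := by
        rw [hxd, pow_succ]; field_simp; ring
      have hTc : betaT β (x - (β ^ (l + 1))⁻¹) = betaT β x - (β ^ l)⁻¹ := by
        rw [hc]; exact betaT_natCast_add_div hβ _ (hbr.mem_Ico hβ)
      refine ⟨l + 1, by omega, by omega, ?_, ?_⟩
      · rw [hc]
        refine hbr.cons hβ _ ?_
        -- As `l ≤ n`, the lowered cylinder ends no later than `T x`, and `d + T x = βx < β`.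
        have : (β ^ n)⁻¹ ≤ (β ^ l)⁻¹ := by gcongr; exact hβ.le
        linarith
      · rw [Finset.sum_range_succ']
        simp only [Function.iterate_succ_apply, hTc, Function.iterate_zero, id_eq]
        rw [sub_sub_cancel, abs_of_pos (by positivity)]
        refine (add_le_add_left hsum _).trans (le_of_eq ?_)
        rw [pow_succ]
        field_simp
        ring

/-! ### Distortion of Birkhoff sums of continuous functions. -/

/-- A continuous function on `[0,1]` is Lipschitz up to an arbitrarily small error. -/
theorem exists_abs_sub_le_add_mul {h : ℝ → ℝ} (hh : ContinuousOn h (Set.Icc 0 1)) {ε : ℝ}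
    (hε : 0 < ε) : ∃ C, 0 ≤ C ∧ ∀ x ∈ Set.Icc (0 : ℝ) 1, ∀ y ∈ Set.Icc (0 : ℝ) 1,
      |h x - h y| ≤ ε + C * |x - y| := by
  obtain ⟨B, hB⟩ := isCompact_Icc.exists_bound_of_continuousOn hh
  simp only [Real.norm_eq_abs] at hB
  have hB0 : 0 ≤ B := (abs_nonneg _).trans (hB 0 (by simp))
  obtain ⟨δ, hδ, H⟩ := Metric.uniformContinuousOn_iff.1
    (isCompact_Icc.uniformContinuousOn_of_continuous hh) ε hε
  refine ⟨2 * B / δ, by positivity, fun x hx y hy => ?_⟩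
  by_cases hxy : |x - y| < δ
  · have := H x hx y hy (by simpa [Real.dist_eq] using hxy)
    rw [Real.dist_eq] at this
    have : 0 ≤ 2 * B / δ * |x - y| := by positivity
    linarith
  · push Not at hxy
    have h1 : 2 * B ≤ 2 * B / δ * |x - y| := by
      rw [div_mul_eq_mul_div, le_div_iff₀ hδ]
      gcongr
    have h2 := abs_sub (h x) (h y)
    linarith [hB x hx, hB y hy]

/-- This replaces bounded distortion for potentials that are merely continuous: the Lipschitz part
is controlled by the summed orbit distances, and the rest costs only `nε`, an arbitrarily small
exponential rate. -/
theorem abs_birkhoffSum_sub_le {h : ℝ → ℝ} {ε C D : ℝ} (hC0 : 0 ≤ C)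
    (hC : ∀ x ∈ Set.Icc (0 : ℝ) 1, ∀ y ∈ Set.Icc (0 : ℝ) 1, |h x - h y| ≤ ε + C * |x - y|)
    {x y : ℝ} (hx : x ∈ Set.Icc (0 : ℝ) 1) (hy : y ∈ Set.Icc (0 : ℝ) 1) (n : ℕ)
    (hD : ∑ j ∈ Finset.range n, |(betaT β)^[j] x - (betaT β)^[j] y| ≤ D) :
    |birkhoffSum (betaT β) h n x - birkhoffSum (betaT β) h n y| ≤ n * ε + C * D := by
  unfold birkhoffSum
  rw [← Finset.sum_sub_distrib]
  refine (Finset.abs_sum_le_sum_abs _ _).trans ?_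
  calc _ ≤ ∑ j ∈ Finset.range n, (ε + C * |(betaT β)^[j] x - (betaT β)^[j] y|) :=
        Finset.sum_le_sum fun j _ =>
          hC _ (betaT_iterate_mem_Icc β hx j) _ (betaT_iterate_mem_Icc β hy j)
    _ = n * ε + C * ∑ j ∈ Finset.range n, |(betaT β)^[j] x - (betaT β)^[j] y| := by
        rw [Finset.sum_add_distrib, Finset.mul_sum]; simp
    _ ≤ _ := by gcongr

theorem sum_inv_pow_sub_le (hβ : 1 < β) (n : ℕ) :
    ∑ j ∈ Finset.range n, (β ^ (n - j))⁻¹ ≤ 1 / (β - 1) := by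
  have hb : 0 < β := by linarith
  have hb1 : 0 < β - 1 := by linarith
  suffices h : ∑ j ∈ Finset.range n, (β ^ (n - j))⁻¹ = (1 - (β ^ n)⁻¹) / (β - 1) by
    rw [h]
    gcongr
    have : 0 < (β ^ n)⁻¹ := by positivity
    linarith
  induction n with
  | zero => simp
  | succ n ih =>
    rw [Finset.sum_range_succ']
    simp only [Nat.add_sub_add_right, ih, Nat.sub_zero]
    rw [pow_succ]
    field_simp
    ring

theorem abs_birkhoffSum_sub_cylinderLeft_le (hβ : 1 < β) {h : ℝ → ℝ} {ε C : ℝ} (hC0 : 0 ≤ C)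
    (hC : ∀ x ∈ Set.Icc (0 : ℝ) 1, ∀ y ∈ Set.Icc (0 : ℝ) 1, |h x - h y| ≤ ε + C * |x - y|)
    {x : ℝ} (hx : x ∈ Set.Ico (0 : ℝ) 1) (n : ℕ) :
    |birkhoffSum (betaT β) h n x - birkhoffSum (betaT β) h n (cylinderLeft β n x)| ≤
      n * ε + C * (1 / (β - 1)) := by
  have hb : 0 < β := by linarith
  refine abs_birkhoffSum_sub_le hC0 hC (Set.Ico_subset_Icc_self hx)
    (Set.Ico_subset_Icc_self (cylinderLeft_mem_Ico hβ hx n)) n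
    (le_trans (Finset.sum_le_sum fun j hj => ?_) (sum_inv_pow_sub_le hβ n))
  have h1 := betaT_iterate_mem_Ico β hx n
  rw [betaT_iterate_cylinderLeft hβ hx (Finset.mem_range.1 hj).le, sub_sub_cancel,
    abs_of_nonneg (div_nonneg h1.1 (by positivity)), div_eq_mul_inv]
  exact mul_le_of_le_one_left (by positivity) h1.2.le

theorem IsFullBranch.cylinderLeft_point {n : ℕ} {c : ℝ} (h : IsFullBranch β n c)
    {x : ℝ} (hx : x ∈ Set.Ico (0 : ℝ) 1) : cylinderLeft β n (c + x / β ^ n) = c := by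
  rw [cylinderLeft, h.iterate_point hx]
  ring

/-! ### Partition sums and pressure in terms of left endpoints and full cylinders. -/

/-- A finite set of reals in an interval of length `r` whose points are `ρ`-separated has at
most `r / ρ + 1` points. -/
theorem card_le_of_separated (S : Finset ℝ) {a r ρ : ℝ} (hρ : 0 < ρ) (hr : 0 ≤ r)
    (hS : ∀ x ∈ S, x ∈ Set.Icc a (a + r)) (hsep : ∀ x ∈ S, ∀ y ∈ S, x < y → x + ρ ≤ y) :
    (S.card : ℝ) ≤ r / ρ + 1 := by
  have h : S.card ≤ (Finset.range (⌊r / ρ⌋₊ + 1)).card := by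
    refine Finset.card_le_card_of_injOn (fun x => ⌊(x - a) / ρ⌋₊) ?_ ?_
    · intro x hx
      simp only [Finset.coe_range, Set.mem_Iio, Nat.lt_succ_iff]
      have := (hS x hx).2
      gcongr
      linarith
    · have key : ∀ x ∈ S, ∀ y ∈ S, x < y → ⌊(x - a) / ρ⌋₊ ≠ ⌊(y - a) / ρ⌋₊ := by
        intro x hx y hy hxy
        have h0 : 0 ≤ (x - a) / ρ := div_nonneg (by linarith [(hS x hx).1]) hρ.le
        have h1 : (x - a) / ρ + 1 ≤ (y - a) / ρ := by
          rw [div_add_one hρ.ne']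
          gcongr
          linarith [hsep x hx y hy hxy]
        have h2 := Nat.floor_mono h1
        rw [Nat.floor_add_one h0] at h2
        omega
      intro x hx y hy hxy
      by_contra hne
      rcases lt_or_gt_of_ne hne with hlt | hlt
      · exact key x hx y hy hlt hxy
      · exact key y hy x hx hlt hxy.symm
  rw [Finset.card_range] at h
  have h1 : (S.card : ℝ) ≤ ⌊r / ρ⌋₊ + 1 := by exact_mod_cast h
  have := Nat.floor_le (div_nonneg hr hρ.le)
  linarith

/-- The left endpoints of the cylinders of order `n`, as a finite set. -/
noncomputable def leftPoints (hβ : 1 < β) (n : ℕ) : Finset ℝ := (leftPointSet_finite hβ n).toFinset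

open Classical in
/-- The left endpoints of the full cylinders of order `n`. -/
noncomputable def fullPoints (hβ : 1 < β) (n : ℕ) : Finset ℝ :=
  (leftPoints hβ n).filter (IsFullBranch β n)

theorem mem_leftPoints (hβ : 1 < β) {n : ℕ} {x : ℝ} : x ∈ leftPoints hβ n ↔ x ∈ leftPointSet β n :=
  Set.Finite.mem_toFinset _

theorem mem_fullPoints (hβ : 1 < β) {n : ℕ} {x : ℝ} :
    x ∈ fullPoints hβ n ↔ IsFullBranch β n x := by
  classical
  rw [fullPoints, Finset.mem_filter, mem_leftPoints]
  exact ⟨fun h => h.2, fun h => ⟨h.mem_leftPointSet hβ, h⟩⟩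

theorem sum_le_sum_of_maps_to_injOn {ι κ : Type*} {s : Finset ι} {t : Finset κ} {f : ι → ℝ}
    {g : κ → ℝ} (i : ι → κ) (hi : ∀ a ∈ s, i a ∈ t) (hinj : Set.InjOn i s)
    (hfg : ∀ a ∈ s, f a ≤ g (i a)) (hg : ∀ b ∈ t, 0 ≤ g b) : ∑ a ∈ s, f a ≤ ∑ b ∈ t, g b := by
  classical
  calc ∑ a ∈ s, f a ≤ ∑ a ∈ s, g (i a) := Finset.sum_le_sum hfg
    _ = ∑ b ∈ s.image i, g b := (Finset.sum_image hinj).symm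
    _ ≤ _ := Finset.sum_le_sum_of_subset_of_nonneg (Finset.image_subset_iff.2 hi)
      fun b hb _ => hg b hb

theorem sum_leftPoints_le_betaPartitionSum (hβ : 1 < β) {h : ℝ → ℝ} {C : ℝ}
    (hC : ∀ x ∈ Set.Icc (0 : ℝ) 1, |h x| ≤ C) (n : ℕ) :
    ∑ x ∈ leftPoints hβ n, Real.exp (birkhoffSum (betaT β) h n x) ≤ betaPartitionSum β h n := by
  refine sum_le_sum_of_maps_to_injOn (fun x => fun j : Fin n => betaDigit β x j) ?_ ?_ ?_
    (fun w _ => betaCylinder_sSup_nonneg β h w)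
  · intro x hx
    rw [mem_leftPoints] at hx
    rw [betaWords, Set.Finite.mem_toFinset]
    exact ⟨x, hx.1, fun _ => rfl⟩
  · refine (injOn_betaDigit_leftPointSet hβ n).mono fun x hx => ?_
    exact (mem_leftPoints hβ).1 hx
  · intro x hx
    rw [mem_leftPoints] at hx
    exact le_csSup (betaCylinder_exp_bddAbove β hC _) ⟨x, ⟨hx.1, fun _ => rfl⟩, rfl⟩

theorem betaPartitionSum_le_sum_leftPoints (hβ : 1 < β) {h : ℝ → ℝ} {ε C : ℝ} (hC0 : 0 ≤ C)
    (hC : ∀ x ∈ Set.Icc (0 : ℝ) 1, ∀ y ∈ Set.Icc (0 : ℝ) 1, |h x - h y| ≤ ε + C * |x - y|)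
    (n : ℕ) :
    betaPartitionSum β h n ≤ Real.exp (n * ε + C * (1 / (β - 1))) *
      ∑ x ∈ leftPoints hβ n, Real.exp (birkhoffSum (betaT β) h n x) := by
  have hne : ∀ w ∈ betaWords β n, ∃ x, x ∈ betaCylinder β w := by
    intro w hw
    rw [betaWords, Set.Finite.mem_toFinset] at hw
    exact hw
  choose! p hp using hne
  rw [Finset.mul_sum]
  refine sum_le_sum_of_maps_to_injOn (fun w => cylinderLeft β n (p w)) ?_ ?_ ?_
    (fun b _ => by positivity)
  · intro w hw
    rw [mem_leftPoints]
    exact ⟨cylinderLeft_mem_Ico hβ (hp w hw).1 n, betaT_iterate_cylinderLeft_self hβ (hp w hw).1 n⟩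
  · intro w hw w' hw' e
    funext j
    have h1 := betaDigit_cylinderLeft hβ (hp w hw).1 j.2
    have h2 := betaDigit_cylinderLeft hβ (hp w' hw').1 j.2
    rw [← (hp w hw).2 j, ← (hp w' hw').2 j, ← h1, ← h2]
    exact congrArg (fun z => betaDigit β z j) e
  · intro w hw
    refine csSup_le ⟨_, ⟨p w, hp w hw, rfl⟩⟩ ?_
    rintro _ ⟨y, hy, rfl⟩
    -- All points of one cylinder share the left endpoint, so the supremum is comparable with the
    -- value there.
    have e : cylinderLeft β n (p w) = cylinderLeft β n y := by
      have := betaT_iterate_sub_of_betaDigit_eq hβ (hp w hw).1 hy.1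
        (fun j hj => ((hp w hw).2 ⟨j, hj⟩).trans (hy.2 ⟨j, hj⟩).symm) (Nat.zero_le n)
      simp only [Function.iterate_zero, id_eq, Nat.sub_zero, sub_div] at this
      unfold cylinderLeft
      linarith
    rw [e, ← Real.exp_add, Real.exp_le_exp]
    have := (abs_le.1 (abs_birkhoffSum_sub_cylinderLeft_le hβ hC0 hC hy.1 n)).2
    linarith

/-- Making a word full is at most `(n+1)`-to-one: `x` is recovered from the full left endpoint and
the position `l ≤ n` of the lowered digit, with `l = 0` reserved for `x = 0`. -/
theorem sum_leftPoints_le_sum_fullPoints (hβ : 1 < β) {h : ℝ → ℝ} {ε C : ℝ} (hε : 0 ≤ ε)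
    (hC0 : 0 ≤ C)
    (hC : ∀ x ∈ Set.Icc (0 : ℝ) 1, ∀ y ∈ Set.Icc (0 : ℝ) 1, |h x - h y| ≤ ε + C * |x - y|)
    (n : ℕ) :
    ∑ x ∈ leftPoints hβ n, Real.exp (birkhoffSum (betaT β) h n x) ≤
      Real.exp (n * ε + C * (1 / (β - 1))) * ((n + 1) *
      ∑ x ∈ fullPoints hβ n, Real.exp (birkhoffSum (betaT β) h n x)) := by
  have hb : 0 < β := by linarith
  have hb1 : 0 < β - 1 := by linarith
  have key : ∀ x ∈ leftPoints hβ n, ∃ l : ℕ, l ≤ n ∧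
      IsFullBranch β n (x - if l = 0 then 0 else (β ^ l)⁻¹) ∧
      |birkhoffSum (betaT β) h n x -
        birkhoffSum (betaT β) h n (x - if l = 0 then 0 else (β ^ l)⁻¹)| ≤
        n * ε + C * (1 / (β - 1)) := by
    intro x hx
    rw [mem_leftPoints] at hx
    by_cases hx0 : x = 0
    · refine ⟨0, Nat.zero_le n, ?_, ?_⟩
      · simp only [if_true, sub_zero, hx0]
        exact IsFullBranch.zero hβ n
      · simp only [if_true, sub_zero, sub_self, abs_zero]
        positivity
    · obtain ⟨l, hl1, hl2, hbr, hs⟩ := exists_isFullBranch_near hβ hx hx0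
      refine ⟨l, hl2, ?_⟩
      rw [if_neg (by omega)]
      refine ⟨hbr, abs_birkhoffSum_sub_le hC0 hC (Set.Ico_subset_Icc_self hx.1)
        (Set.Ico_subset_Icc_self (hbr.mem_Ico hβ)) n (hs.trans ?_)⟩
      gcongr
      have : 0 < (β ^ l)⁻¹ := by positivity
      linarith
  choose! l hl1 hl2 hl3 using key
  have e : Real.exp (n * ε + C * (1 / (β - 1))) * ((n + 1) *
      ∑ x ∈ fullPoints hβ n, Real.exp (birkhoffSum (betaT β) h n x)) =
      ∑ p ∈ Finset.range (n + 1) ×ˢ fullPoints hβ n,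
        Real.exp (n * ε + C * (1 / (β - 1))) * Real.exp (birkhoffSum (betaT β) h n p.2) := by
    rw [Finset.sum_product]
    simp only [← Finset.mul_sum, Finset.sum_const, Finset.card_range, nsmul_eq_mul]
    push_cast
    ring
  rw [e]
  refine sum_le_sum_of_maps_to_injOn
    (fun x => (l x, x - if l x = 0 then 0 else (β ^ l x)⁻¹)) ?_ ?_ ?_ (fun b _ => by positivity)
  · intro x hx
    rw [Finset.mem_product]
    exact ⟨Finset.mem_range.2 (Nat.lt_succ_of_le (hl1 x hx)), (mem_fullPoints hβ).2 (hl2 x hx)⟩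
  · intro x _ y _ hxy
    simp only [Prod.mk.injEq] at hxy
    rw [hxy.1] at hxy
    linarith [hxy.2]
  · intro x hx
    rw [← Real.exp_add, Real.exp_le_exp]
    have := (abs_le.1 (hl3 x hx)).2
    linarith

theorem eventually_add_log_le (C : ℝ) {κ : ℝ} (hκ : 0 < κ) :
    ∀ᶠ n : ℕ in atTop, C + Real.log (n + 1) ≤ n * κ := by
  have h1 : Tendsto (fun n : ℕ => (n : ℝ) * (κ / 2)) atTop atTop :=
    tendsto_natCast_atTop_atTop.atTop_mul_const (by positivity)
  filter_upwards [h1.eventually_ge_atTop (C + κ / 2 - 1 - Real.log (κ / 2))] with n hn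
  have h2 : (0 : ℝ) < n + 1 := by positivity
  have h3 := Real.log_le_sub_one_of_pos (show 0 < κ / 2 * ((n : ℝ) + 1) by positivity)
  rw [Real.log_mul (by positivity) h2.ne'] at h3
  linarith

theorem betaPartitionSum_pos (β : ℝ) {h : ℝ → ℝ} (hh : ContinuousOn h (Set.Icc 0 1)) (n : ℕ) :
    0 < betaPartitionSum β h n := by
  obtain ⟨C, hC⟩ := isCompact_Icc.exists_bound_of_continuousOn hh
  exact (Real.exp_pos _).trans_le (betaPartitionSum_lower β hC n)

theorem eventually_betaPartitionSum_le (β : ℝ) {h : ℝ → ℝ} (hh : ContinuousOn h (Set.Icc 0 1))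
    {p : ℝ} (hp : betaPressure β h < p) :
    ∀ᶠ n : ℕ in atTop, betaPartitionSum β h n ≤ Real.exp (n * p) := by
  filter_upwards [(tendsto_betaPressure β hh).eventually_lt_const hp, eventually_gt_atTop 0]
    with n hn hn0
  rw [← Real.log_le_iff_le_exp (betaPartitionSum_pos β hh n)]
  rw [div_lt_iff₀ (by exact_mod_cast hn0)] at hn
  linarith

theorem eventually_le_betaPartitionSum (β : ℝ) {h : ℝ → ℝ} (hh : ContinuousOn h (Set.Icc 0 1))
    {p : ℝ} (hp : p < betaPressure β h) :
    ∀ᶠ n : ℕ in atTop, Real.exp (n * p) ≤ betaPartitionSum β h n := by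
  filter_upwards [(tendsto_betaPressure β hh).eventually_const_lt hp, eventually_gt_atTop 0]
    with n hn hn0
  rw [← Real.le_log_iff_exp_le (betaPartitionSum_pos β hh n)]
  rw [lt_div_iff₀ (by exact_mod_cast hn0)] at hn
  linarith

theorem eventually_le_sum_fullPoints (hβ : 1 < β) {h : ℝ → ℝ} (hh : ContinuousOn h (Set.Icc 0 1))
    {p : ℝ} (hp : p < betaPressure β h) :
    ∀ᶠ n : ℕ in atTop, Real.exp (n * p) ≤
      ∑ x ∈ fullPoints hβ n, Real.exp (birkhoffSum (betaT β) h n x) := by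
  -- Four losses of rate `δ`: the limit defining the pressure, the passage to left endpoints, the
  -- passage to full cylinders, and the factor `n + 1` together with the constants.
  set δ := (betaPressure β h - p) / 4 with hδ
  have hδ0 : 0 < δ := by rw [hδ]; linarith
  obtain ⟨C, hC0, hC⟩ := exists_abs_sub_le_add_mul hh hδ0
  filter_upwards [eventually_le_betaPartitionSum β hh
      (show betaPressure β h - δ < betaPressure β h by linarith),
    eventually_add_log_le (2 * (C * (1 / (β - 1)))) hδ0] with n h1 h2
  have h3 := h1.trans (betaPartitionSum_le_sum_leftPoints hβ hC0 hC n)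
  have h4 := h3.trans (mul_le_mul_of_nonneg_left
    (sum_leftPoints_le_sum_fullPoints hβ hδ0.le hC0 hC n) (Real.exp_pos _).le)
  set W := ∑ x ∈ fullPoints hβ n, Real.exp (birkhoffSum (betaT β) h n x) with hW
  have hW0 : 0 ≤ W := Finset.sum_nonneg fun _ _ => (Real.exp_pos _).le
  have hn1 : (0 : ℝ) < n + 1 := by positivity
  have h5 : Real.exp (n * δ + C * (1 / (β - 1))) * (Real.exp (n * δ + C * (1 / (β - 1))) *
      (((n : ℝ) + 1) * W)) ≤ Real.exp (n * (3 * δ)) * W := by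
    have : Real.exp (n * δ + C * (1 / (β - 1))) * (Real.exp (n * δ + C * (1 / (β - 1))) *
      (((n : ℝ) + 1) * W)) = Real.exp (2 * (n * δ) + (2 * (C * (1 / (β - 1))) +
        Real.log (n + 1))) * W := by
      rw [two_mul, two_mul, Real.exp_add, Real.exp_add, Real.exp_add, Real.exp_add (_ + _),
        Real.exp_add, Real.exp_log hn1]
      ring
    rw [this]
    gcongr
    linarith
  have h6 := h4.trans h5
  rw [← div_le_iff₀' (Real.exp_pos _), ← Real.exp_sub] at h6
  refine le_trans (le_of_eq (congrArg Real.exp ?_)) h6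
  rw [hδ]
  ring

/-- Serves twice: to show that the pressures strictly decrease in `s`, and to pull the constant `-s
log β` out of a potential. -/
theorem betaPressure_add_le (β : ℝ) {h₁ h₂ : ℝ → ℝ} (hh₁ : ContinuousOn h₁ (Set.Icc 0 1))
    (hh₂ : ContinuousOn h₂ (Set.Icc 0 1)) {κ : ℝ} (h : ∀ x ∈ Set.Icc (0 : ℝ) 1, h₁ x + κ ≤ h₂ x) :
    betaPressure β h₁ + κ ≤ betaPressure β h₂ := by
  obtain ⟨C, hC⟩ := isCompact_Icc.exists_bound_of_continuousOn hh₂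
  refine le_of_tendsto_of_tendsto ((tendsto_betaPressure β hh₁).add_const κ)
    (tendsto_betaPressure β hh₂) ?_
  filter_upwards [eventually_gt_atTop 0] with n hn
  have hn' : (0 : ℝ) < n := by exact_mod_cast hn
  rw [div_add' _ _ _ hn'.ne']
  gcongr
  rw [Real.le_log_iff_exp_le (betaPartitionSum_pos β hh₂ n), Real.exp_add,
    Real.exp_log (betaPartitionSum_pos β hh₁ n), betaPartitionSum, betaPartitionSum,
    Finset.sum_mul]
  refine Finset.sum_le_sum fun w hw => ?_
  rw [betaWords, Set.Finite.mem_toFinset] at hw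
  rw [← le_div_iff₀ (Real.exp_pos _)]
  refine csSup_le (hw.image _) ?_
  rintro _ ⟨y, hy, rfl⟩
  rw [le_div_iff₀ (Real.exp_pos _), ← Real.exp_add]
  refine le_trans (Real.exp_le_exp.2 ?_) (le_csSup (betaCylinder_exp_bddAbove β hC _) ⟨y, hy, rfl⟩)
  have e : (κ * n : ℝ) = ∑ _j ∈ Finset.range n, κ := by simp [mul_comm]
  rw [e, birkhoffSum, birkhoffSum, ← Finset.sum_add_distrib]
  exact Finset.sum_le_sum fun j _ =>
    h _ (Set.Ico_subset_Icc_self (betaT_iterate_mem_Ico β hy.1 j))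

theorem card_fullPoints_le (hβ : 1 < β) (n : ℕ) : ((fullPoints hβ n).card : ℝ) ≤ β ^ n := by
  have hb : 0 < β := by linarith
  have h1 : (β ^ n)⁻¹ ≤ 1 := inv_le_one_of_one_le₀ (one_le_pow₀ hβ.le)
  have := card_le_of_separated (fullPoints hβ n) (a := 0) (r := 1 - (β ^ n)⁻¹)
    (ρ := (β ^ n)⁻¹) (by positivity) (by linarith) (fun x hx => by
      rw [mem_fullPoints] at hx
      exact ⟨hx.1, by linarith [hx.2.1]⟩) (fun x hx y hy hxy => by
      rw [mem_fullPoints] at hx hy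
      exact hx.add_inv_le_of_lt hβ hy.2.2.1 hxy)
  refine this.trans (le_of_eq ?_)
  field_simp
  ring

/-- Cylinders of order `n` have length at most `β⁻ⁿ`, so the points `k / βⁿ` of `[0,1)` lie in
distinct ones. -/
theorem le_card_leftPoints (hβ : 1 < β) (n : ℕ) : β ^ n ≤ ((leftPoints hβ n).card : ℝ) := by
  have hb : 0 < β := by linarith
  have hpn : 0 < β ^ n := by positivity
  refine (Nat.le_ceil (β ^ n)).trans ?_
  norm_cast
  rw [← Finset.card_range ⌈β ^ n⌉₊]
  have hmem : ∀ k ∈ Finset.range ⌈β ^ n⌉₊, (k : ℝ) / β ^ n ∈ Set.Ico (0 : ℝ) 1 := by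
    intro k hk
    rw [Finset.mem_range, Nat.lt_ceil] at hk
    exact ⟨by positivity, by rwa [div_lt_one hpn]⟩
  refine Finset.card_le_card_of_injOn (fun k => cylinderLeft β n (k / β ^ n)) ?_ ?_
  · intro k hk
    rw [Finset.mem_coe, mem_leftPoints]
    exact ⟨cylinderLeft_mem_Ico hβ (hmem k hk) n,
      betaT_iterate_cylinderLeft_self hβ (hmem k hk) n⟩
  · intro k hk k' hk' e
    have e' : (k : ℝ) - (betaT β)^[n] (k / β ^ n) = k' - (betaT β)^[n] (k' / β ^ n) := by
      have := congrArg (fun z => z * β ^ n) e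
      simp only [cylinderLeft] at this
      field_simp at this
      exact this
    have h1 := betaT_iterate_mem_Ico β (hmem k hk) n
    have h2 := betaT_iterate_mem_Ico β (hmem k' hk') n
    have h3 : (k : ℝ) < k' + 1 := by linarith [h1.2, h2.1]
    have h4 : (k' : ℝ) < k + 1 := by linarith [h2.2, h1.1]
    have h3' : k < k' + 1 := by exact_mod_cast h3
    have h4' : k' < k + 1 := by exact_mod_cast h4
    omega

/-- The upper estimate counts full cylinders only: they are disjoint of length exactly `β⁻ⁿ`, and
they already carry the pressure. -/
theorem betaPressure_zero (hβ : 1 < β) : betaPressure β (fun _ => 0) = Real.log β := by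
  have hb : 0 < β := by linarith
  have hc : ContinuousOn (fun _ : ℝ => (0 : ℝ)) (Set.Icc 0 1) := continuousOn_const
  have hexp : ∀ n : ℕ, β ^ n = Real.exp (n * Real.log β) := fun n => by
    rw [mul_comm, Real.exp_mul, Real.exp_log hb, Real.rpow_natCast]
  apply le_antisymm
  · by_contra! hlt
    have h := eventually_le_sum_fullPoints hβ hc
      (show (betaPressure β (fun _ => 0) + Real.log β) / 2 < _ by linarith)
    obtain ⟨n, hn, hn0⟩ := (h.and (eventually_gt_atTop 0)).exists
    have hn' : (0 : ℝ) < n := by exact_mod_cast hn0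
    simp only [birkhoffSum, Finset.sum_const_zero, Real.exp_zero, Finset.sum_const, nsmul_eq_mul,
      mul_one] at hn
    have h2 := hn.trans (card_fullPoints_le hβ n)
    rw [hexp, Real.exp_le_exp] at h2
    nlinarith
  · refine ge_of_tendsto (tendsto_betaPressure β hc) ?_
    filter_upwards [eventually_gt_atTop 0] with n hn0
    have hn' : (0 : ℝ) < n := by exact_mod_cast hn0
    rw [le_div_iff₀ hn', Real.le_log_iff_exp_le (betaPartitionSum_pos β hc n), mul_comm, ← hexp]
    refine (le_card_leftPoints hβ n).trans ?_
    have := sum_leftPoints_le_betaPartitionSum hβ (h := fun _ => 0) (C := 0) (by simp) n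
    simpa [birkhoffSum] using this

/-! ### Families of full cylinders with almost constant Birkhoff sums. -/

theorem birkhoffSum_const_mul (T : ℝ → ℝ) (F : ℝ → ℝ) (q : ℝ) (n : ℕ) (x : ℝ) :
    birkhoffSum T (fun y => q * F y) n x = q * birkhoffSum T F n x := by
  simp [birkhoffSum, Finset.mul_sum]

/-- For large `m` there is a family of full cylinders of order `m` on which `S_m F / m` is
almost constant and whose cardinality is prescribed by the pressure of `q F`. -/
theorem eventually_exists_fullPoints_level (hβ : 1 < β) {F : ℝ → ℝ}
    (hF : ContinuousOn F (Set.Icc 0 1)) (q : ℝ) {ε : ℝ} (hε : 0 < ε) :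
    ∀ᶠ m : ℕ in atTop, ∃ (τ : ℝ) (A : Finset ℝ),
      (∀ c ∈ A, IsFullBranch β m c) ∧
      (∃ c ∈ A, birkhoffSum (betaT β) F m c = m * τ) ∧
      (∀ c ∈ A, ∀ x ∈ Set.Ico (0 : ℝ) 1, birkhoffSum (betaT β) F m (c + x / β ^ m) ≤ m * (τ + ε)) ∧
      Real.exp (m * (betaPressure β (fun x => q * F x) - q * τ - ε)) ≤ A.card := by
  obtain ⟨B, hB⟩ := isCompact_Icc.exists_bound_of_continuousOn hF
  simp only [Real.norm_eq_abs] at hB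
  obtain ⟨C, hC0, hC⟩ := exists_abs_sub_le_add_mul hF (half_pos hε)
  have hqF : ContinuousOn (fun x => q * F x) (Set.Icc 0 1) := continuousOn_const.mul hF
  set P := betaPressure β (fun x => q * F x) with hP
  -- Width of the bins for `S_m F / m`: within one bin `q S_m F` varies by at most `mε/4`. The
  -- number of bins does not depend on `m`.
  set δ := ε / (4 * (|q| + 1)) with hδ
  have hq1 : 0 < |q| + 1 := by positivity
  have hδ0 : 0 < δ := by positivity
  have hqδ : |q| * δ ≤ ε / 4 := by
    have : (|q| + 1) * δ = ε / 4 := by rw [hδ]; field_simp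
    nlinarith
  set K : ℤ := ⌈B / δ⌉ with hK
  set J : Finset ℤ := Finset.Icc (-K) K with hJ
  have hB0 : 0 ≤ B := (abs_nonneg _).trans (hB 0 (by simp))
  have hK0 : 0 ≤ K := Int.ceil_nonneg (by positivity)
  have hJne : J.Nonempty := ⟨0, Finset.mem_Icc.2 ⟨by omega, hK0⟩⟩
  have hJc : (0 : ℝ) < J.card := by exact_mod_cast hJne.card_pos
  filter_upwards [eventually_le_sum_fullPoints hβ hqF (show P - ε / 4 < P by linarith),
    eventually_gt_atTop 0, eventually_add_log_le (Real.log J.card) (show 0 < ε / 4 by linarith),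
    eventually_add_log_le (C * (1 / (β - 1))) (half_pos hε)] with m h1 hm0 h2 h3
  have hm : (0 : ℝ) < m := by exact_mod_cast hm0
  have hlog : 0 ≤ Real.log ((m : ℝ) + 1) := Real.log_nonneg (by linarith)
  set S := birkhoffSum (betaT β) F m with hS
  set φ : ℝ → ℤ := fun c => ⌊S c / (m * δ)⌋ with hφ
  have hφmem : ∀ c ∈ fullPoints hβ m, φ c ∈ J := by
    intro c hc
    have hb := abs_le.1 (birkhoffSum_betaT_bounds β hB (((mem_fullPoints hβ).1 hc).mem_Ico hβ) m)
    have hKB : B / δ ≤ K := Int.le_ceil _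
    have e : B / δ = m * B / (m * δ) := by field_simp
    rw [hJ, Finset.mem_Icc]
    constructor
    · rw [hφ, Int.le_floor]
      push_cast
      refine (neg_le_neg hKB).trans ?_
      rw [e, ← neg_div]
      gcongr
      exact hb.1
    · have : S c / (m * δ) ≤ K := by
        refine le_trans ?_ hKB
        rw [e]
        gcongr
        exact hb.2
      have h := (Int.floor_le (S c / (m * δ))).trans this
      exact_mod_cast h
  obtain ⟨y, -, hy⟩ := Finset.exists_le_sum_fiber_of_maps_to_of_nsmul_le_sum
    (w := fun c => Real.exp (birkhoffSum (betaT β) (fun x => q * F x) m c))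
    (b := Real.exp (m * (P - ε / 2))) hφmem hJne (by
      refine le_trans ?_ h1
      rw [nsmul_eq_mul, ← Real.exp_log hJc, ← Real.exp_add, Real.exp_le_exp]
      linarith)
  set A := (fullPoints hβ m).filter (fun c => φ c = y) with hA
  have hAne : A.Nonempty := by
    by_contra hcon
    rw [Finset.not_nonempty_iff_eq_empty] at hcon
    rw [hcon, Finset.sum_empty] at hy
    exact absurd hy (not_le.2 (Real.exp_pos _))
  -- With `τ` taken at a maximiser of the bin, `S_m F ≤ mτ` holds at every left endpoint of `A`, and
  -- only the distortion is left to pay.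
  obtain ⟨c₀, hc₀, hmax⟩ := A.exists_max_image S hAne
  have hAfull : ∀ c ∈ A, IsFullBranch β m c := fun c hc =>
    (mem_fullPoints hβ).1 (Finset.mem_filter.1 hc).1
  have hτ : S c₀ = m * (S c₀ / m) := by field_simp
  refine ⟨S c₀ / m, A, hAfull, ⟨c₀, hc₀, hτ⟩, ?_, ?_⟩
  · intro c hc x hx
    have h4 := (abs_le.1 (abs_birkhoffSum_sub_cylinderLeft_le hβ hC0 hC
      ((hAfull c hc).point_mem hβ hx) m)).2
    rw [(hAfull c hc).cylinderLeft_point hx] at h4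
    have h5 := hmax c hc
    rw [mul_add, ← hτ]
    linarith
  · have hle : ∀ c ∈ A, Real.exp (birkhoffSum (betaT β) (fun x => q * F x) m c) ≤
        Real.exp (m * (q * (S c₀ / m) + ε / 4)) := by
      intro c hc
      rw [Real.exp_le_exp, birkhoffSum_const_mul]
      have h4 := Int.abs_sub_lt_one_of_floor_eq_floor
        ((Finset.mem_filter.1 hc).2.trans (Finset.mem_filter.1 hc₀).2.symm)
      rw [← sub_div, abs_div, abs_of_pos (mul_pos hm hδ0), div_lt_one (mul_pos hm hδ0)] at h4
      have h6 : q * (S c - S c₀) ≤ |q| * |S c - S c₀| := by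
        rw [← abs_mul]; exact le_abs_self _
      have h7 : |q| * |S c - S c₀| ≤ |q| * (m * δ) := by gcongr
      have h8 : m * (q * (S c₀ / m) + ε / 4) = q * S c₀ + m * (ε / 4) := by field_simp
      have h9 : m * (|q| * δ) ≤ m * (ε / 4) := by gcongr
      rw [h8]
      change q * S c ≤ _
      nlinarith
    have h4 := hy.trans (Finset.sum_le_card_nsmul A _ _ hle)
    rw [nsmul_eq_mul, ← div_le_iff₀ (Real.exp_pos _), ← Real.exp_sub] at h4
    refine le_trans (Real.exp_le_exp.2 ?_) h4
    nlinarith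

/-! ### Upper bound: coverings of the limsup set. -/

open MeasureTheory in
/-- The Hausdorff dimension of a limsup set of finite families of balls is at most `s` if the
sums of the `s`-th powers of the diameters decay geometrically. -/
theorem dimH_le_of_frequently_mem_closedBall {X : Type*} [MetricSpace X] {E : Set X}
    {κ : ℕ → Type*} [∀ n, Fintype (κ n)] (z : ∀ n, κ n → X) (r : ∀ n, κ n → ℝ)
    (hr : ∀ n i, 0 ≤ r n i) {s C θ : ℝ} (hs : 0 < s) (hC : 0 ≤ C) (hθ0 : 0 ≤ θ) (hθ1 : θ < 1)
    (hsum : ∀ᶠ n in atTop, ∑ i, (2 * r n i) ^ s ≤ C * θ ^ n)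
    (hE : ∀ x ∈ E, ∃ᶠ n in atTop, ∃ i, x ∈ Metric.closedBall (z n i) (r n i)) :
    dimH E ≤ ENNReal.ofReal s := by
  borelize X
  set d : NNReal := ⟨s, hs.le⟩ with hd
  have hds : (d : ℝ) = s := rfl
  rw [show ENNReal.ofReal s = (d : ENNReal) from by
    rw [← hds, ENNReal.ofReal_coe_nnreal]]
  refine dimH_le_of_hausdorffMeasure_ne_top ?_
  rw [hds]
  obtain ⟨N₀, hN₀⟩ := eventually_atTop.1 hsum
  set a : ℕ → ENNReal := fun n => ENNReal.ofReal (C * θ ^ n) with ha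
  have hatot : ∑' n, a n ≠ ⊤ := by
    have hsm : Summable fun n : ℕ => C * θ ^ n :=
      (summable_geometric_of_lt_one hθ0 hθ1).mul_left C
    rw [← ENNReal.ofReal_tsum_of_nonneg (fun n => by positivity) hsm]
    exact ENNReal.ofReal_ne_top
  have hdiam : ∀ n i, Metric.ediam (Metric.closedBall (z n i) (r n i)) ≤
      ENNReal.ofReal (2 * r n i) := by
    intro n i
    rw [← Metric.closedEBall_ofReal (hr n i), ENNReal.ofReal_mul zero_le_two, ENNReal.ofReal_ofNat]
    exact Metric.ediam_closedEBall_le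
  -- The cover at stage `N` uses all balls of index at least `N`. Their sum is bounded by the whole
  -- convergent series, and no diameter exceeds `(C θ^N)^{1/s}`.
  set t : ℕ → (Σ n, κ n) → Set X := fun N p =>
    if N ≤ p.1 then Metric.closedBall (z p.1 p.2) (r p.1 p.2) else ∅ with ht
  have hmain := Measure.hausdorffMeasure_le_liminf_tsum (β := ℕ) (l := atTop)
    (ι := fun _ => Σ n, κ n) s E (fun N => ENNReal.ofReal ((C * θ ^ N) ^ s⁻¹)) ?_ t ?_ ?_
  · refine ne_top_of_le_ne_top hatot (hmain.trans ?_)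
    refine liminf_le_of_frequently_le' (Eventually.frequently ?_)
    filter_upwards [eventually_ge_atTop N₀] with N hN
    rw [ENNReal.tsum_sigma']
    refine ENNReal.tsum_le_tsum fun n => ?_
    rw [tsum_fintype]
    by_cases hNn : N ≤ n
    · simp only [ht, hNn, if_true]
      calc ∑ i, Metric.ediam (Metric.closedBall (z n i) (r n i)) ^ s
          ≤ ∑ i, ENNReal.ofReal ((2 * r n i) ^ s) := by
            refine Finset.sum_le_sum fun i _ => ?_
            rw [← ENNReal.ofReal_rpow_of_nonneg (by linarith [hr n i]) hs.le]
            exact ENNReal.rpow_le_rpow (hdiam n i) hs.le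
        _ = ENNReal.ofReal (∑ i, (2 * r n i) ^ s) :=
            (ENNReal.ofReal_sum_of_nonneg fun i _ =>
              Real.rpow_nonneg (by linarith [hr n i]) s).symm
        _ ≤ a n := ENNReal.ofReal_le_ofReal (hN₀ n (hN.trans hNn))
    · simp [ht, hNn, hs]
  · have h1 : Tendsto (fun N : ℕ => C * θ ^ N) atTop (𝓝 0) := by
      simpa using (tendsto_pow_atTop_nhds_zero_of_lt_one hθ0 hθ1).const_mul C
    have h2 := (Real.continuousAt_rpow_const 0 s⁻¹ (Or.inr (by positivity))).tendsto.comp h1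
    rw [Real.zero_rpow (by positivity)] at h2
    simpa using ENNReal.tendsto_ofReal h2
  · filter_upwards [eventually_ge_atTop N₀] with N hN p
    by_cases hNn : N ≤ p.1
    · simp only [ht, hNn, if_true]
      refine (hdiam _ _).trans (ENNReal.ofReal_le_ofReal ?_)
      have h0 : 0 ≤ 2 * r p.1 p.2 := by linarith [hr p.1 p.2]
      have h1 : (2 * r p.1 p.2) ^ s ≤ C * θ ^ N := by
        refine (Finset.single_le_sum (f := fun i => (2 * r p.1 i) ^ s)
          (fun i _ => Real.rpow_nonneg (by linarith [hr p.1 i]) s)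
          (Finset.mem_univ p.2)).trans ((hN₀ p.1 (hN.trans hNn)).trans ?_)
        exact mul_le_mul_of_nonneg_left (pow_le_pow_of_le_one hθ0 hθ1.le hNn) hC
      calc 2 * r p.1 p.2 = ((2 * r p.1 p.2) ^ s) ^ s⁻¹ := by
            rw [← Real.rpow_mul h0, mul_inv_cancel₀ hs.ne', Real.rpow_one]
        _ ≤ _ := Real.rpow_le_rpow (Real.rpow_nonneg h0 s) h1 (by positivity)
    · simp [ht, hNn]
  · refine Eventually.of_forall fun N x hx => ?_
    obtain ⟨n, hn, i, hi⟩ := frequently_atTop.1 (hE x hx) N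
    rw [Set.mem_iUnion]
    exact ⟨⟨n, i⟩, by simpa [ht, hn] using hi⟩

/-- The shrinking target set inside `[0,1)²`, with targets enlarged by the factor `K`. -/
def enlargedTargetSet (β : ℝ) (f g : ℝ → ℝ) (x₀ y₀ K : ℝ) : Set (ℝ × ℝ) :=
  {p | p.1 ∈ Set.Ico (0 : ℝ) 1 ∧ p.2 ∈ Set.Ico (0 : ℝ) 1 ∧
    ∃ᶠ n : ℕ in atTop,
      |(betaT β)^[n] p.1 - x₀| < K * Real.exp (-birkhoffSum (betaT β) f n p.1) ∧
      |(betaT β)^[n] p.2 - y₀| < K * Real.exp (-birkhoffSum (betaT β) g n p.2)}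

/-- `T^n` is affine of slope `βⁿ` on the cylinder, so the target pulls back to a ball about
`cylinderLeft β n x + x₀ / βⁿ`. The centre may lie outside the cylinder, which is harmless for a
covering. -/
theorem abs_sub_cylinderLeft_lt (hβ : 1 < β) {h : ℝ → ℝ} {ε C K x₀ : ℝ} (hK : 0 < K) (hC0 : 0 ≤ C)
    (hC : ∀ x ∈ Set.Icc (0 : ℝ) 1, ∀ y ∈ Set.Icc (0 : ℝ) 1, |h x - h y| ≤ ε + C * |x - y|)
    {x : ℝ} (hx : x ∈ Set.Ico (0 : ℝ) 1) {n : ℕ}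
    (hn : |(betaT β)^[n] x - x₀| < K * Real.exp (-birkhoffSum (betaT β) h n x)) :
    |x - (cylinderLeft β n x + x₀ / β ^ n)| ≤ K * Real.exp (C * (1 / (β - 1)) + n * ε -
      (n * Real.log β + birkhoffSum (betaT β) h n (cylinderLeft β n x))) := by
  have hb : 0 < β := by linarith
  have hexp : (β ^ n)⁻¹ = Real.exp (-(n * Real.log β)) := by
    rw [Real.exp_neg, mul_comm, Real.exp_mul, Real.exp_log hb, Real.rpow_natCast]
  have e : x - (cylinderLeft β n x + x₀ / β ^ n) = ((betaT β)^[n] x - x₀) * (β ^ n)⁻¹ := by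
    rw [cylinderLeft]; ring
  rw [e, abs_mul, abs_of_pos (show 0 < (β ^ n)⁻¹ by positivity)]
  refine (mul_le_mul_of_nonneg_right hn.le (by positivity)).trans ?_
  rw [hexp, mul_assoc, ← Real.exp_add]
  gcongr
  have := (abs_le.1 (abs_birkhoffSum_sub_cylinderLeft_le hβ hC0 hC hx n)).1
  linarith

theorem exists_common_abs_sub_le {f g : ℝ → ℝ} (hf : ContinuousOn f (Set.Icc 0 1))
    (hg : ContinuousOn g (Set.Icc 0 1)) {ε : ℝ} (hε : 0 < ε) : ∃ C, 0 ≤ C ∧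
    (∀ x ∈ Set.Icc (0 : ℝ) 1, ∀ y ∈ Set.Icc (0 : ℝ) 1, |f x - f y| ≤ ε + C * |x - y|) ∧
    (∀ x ∈ Set.Icc (0 : ℝ) 1, ∀ y ∈ Set.Icc (0 : ℝ) 1, |g x - g y| ≤ ε + C * |x - y|) := by
  obtain ⟨C, hC0, hC⟩ := exists_abs_sub_le_add_mul hf hε
  obtain ⟨D, hD0, hD⟩ := exists_abs_sub_le_add_mul hg hε
  refine ⟨max C D, hC0.trans (le_max_left _ _), fun x hx y hy => (hC x hx y hy).trans ?_,
    fun x hx y hy => (hD x hx y hy).trans ?_⟩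
  · gcongr; exact le_max_left _ _
  · gcongr; exact le_max_right _ _

/-- Error budget for the coverings: `sε` for the distortion raised to the power `s`, and `ε` for
each of the two partition sums. -/
theorem exists_pos_mul_add_neg {c x : ℝ} (hc : 0 < c) (hx : x < 0) :
    ∃ ε > 0, c * ε + 2 * ε + x < 0 := by
  refine ⟨-x / (2 * (c + 2)), div_pos (by linarith) (by linarith), ?_⟩
  have : c * (-x / (2 * (c + 2))) + 2 * (-x / (2 * (c + 2))) = -x / 2 := by
    field_simp
    ring
  linarith

theorem sum_coe_prod_mul (S : Finset ℝ) (F G : ℝ → ℝ) :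
    ∑ p : S × S, F p.1 * G p.2 = (∑ x ∈ S, F x) * ∑ y ∈ S, G y := by
  rw [Fintype.sum_prod_type, ← Finset.sum_coe_sort S F, ← Finset.sum_coe_sort S G,
    Finset.sum_mul_sum]

theorem birkhoffSum_le_birkhoffSum {f g : ℝ → ℝ}
    (hfg : ∀ x ∈ Set.Icc (0 : ℝ) 1, ∀ y ∈ Set.Icc (0 : ℝ) 1, g y ≤ f x) {x y : ℝ}
    (hx : x ∈ Set.Icc (0 : ℝ) 1) (hy : y ∈ Set.Icc (0 : ℝ) 1) (n : ℕ) :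
    birkhoffSum (betaT β) g n y ≤ birkhoffSum (betaT β) f n x :=
  Finset.sum_le_sum fun j _ =>
    hfg _ (betaT_iterate_mem_Icc β hx j) _ (betaT_iterate_mem_Icc β hy j)

theorem birkhoffSum_neg_mul_add (T : ℝ → ℝ) (g : ℝ → ℝ) (s b : ℝ) (n : ℕ) (x : ℝ) :
    birkhoffSum T (fun y => -s * (b + g y)) n x = -s * (n * b + birkhoffSum T g n x) := by
  simp [birkhoffSum, ← Finset.mul_sum, Finset.sum_add_distrib]

theorem birkhoffSum_sub_mul_add (T : ℝ → ℝ) (g : ℝ → ℝ) (s b : ℝ) (n : ℕ) (x : ℝ) :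
    birkhoffSum T (fun y => g y - s * (b + g y)) n x =
      birkhoffSum T g n x - s * (n * b + birkhoffSum T g n x) := by
  simp [birkhoffSum, ← Finset.mul_sum, Finset.sum_add_distrib]

theorem sum_leftPoints_le_betaPartitionSum' (hβ : 1 < β) {h : ℝ → ℝ}
    (hh : ContinuousOn h (Set.Icc 0 1)) (n : ℕ) :
    ∑ x ∈ leftPoints hβ n, Real.exp (birkhoffSum (betaT β) h n x) ≤ betaPartitionSum β h n := by
  obtain ⟨C, hC⟩ := isCompact_Icc.exists_bound_of_continuousOn hh
  exact sum_leftPoints_le_betaPartitionSum hβ hC n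

/-- One square of the longer side, governed by `g`, for each pair of cylinders. The first coordinate
then contributes only the number of cylinders, of rate `log β`. -/
theorem dimH_enlargedTargetSet_le_of_snd (hβ : 1 < β) {f g : ℝ → ℝ}
    (hf : ContinuousOn f (Set.Icc 0 1)) (hg : ContinuousOn g (Set.Icc 0 1))
    (hfg : ∀ x ∈ Set.Icc (0 : ℝ) 1, ∀ y ∈ Set.Icc (0 : ℝ) 1, g y ≤ f x)
    (x₀ y₀ : ℝ) {K : ℝ} (hK : 0 < K) {s : ℝ} (hs : 0 < s)
    (hP : betaPressure β (fun x => -s * (Real.log β + g x)) + Real.log β < 0) :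
    dimH (enlargedTargetSet β f g x₀ y₀ K) ≤ ENNReal.ofReal s := by
  set P := betaPressure β (fun x => -s * (Real.log β + g x)) with hPdef
  obtain ⟨ε, hε, hεs⟩ := exists_pos_mul_add_neg hs hP
  obtain ⟨C, hC0, hCf, hCg⟩ := exists_common_abs_sub_le hf hg hε
  have hh : ContinuousOn (fun x => -s * (Real.log β + g x)) (Set.Icc 0 1) :=
    continuousOn_const.mul (continuousOn_const.add hg)
  set D := C * (1 / (β - 1)) with hD
  set ρ : (n : ℕ) → (leftPoints hβ n × leftPoints hβ n) → ℝ := fun n p =>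
    K * Real.exp (D + n * ε - (n * Real.log β + birkhoffSum (betaT β) g n p.2)) with hρ
  refine dimH_le_of_frequently_mem_closedBall (κ := fun n => leftPoints hβ n × leftPoints hβ n)
    (fun n p => ((p.1 : ℝ) + x₀ / β ^ n, (p.2 : ℝ) + y₀ / β ^ n)) ρ
    (fun n p => by positivity) (C := (2 * K * Real.exp D) ^ s)
    (θ := Real.exp (s * ε + 2 * ε + (P + Real.log β))) hs (by positivity) (Real.exp_pos _).le
    (by rw [← Real.exp_zero]; exact Real.exp_lt_exp.2 hεs) ?_ ?_
  · filter_upwards [eventually_betaPartitionSum_le β hh (show P < P + ε by linarith),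
      eventually_betaPartitionSum_le β (h := fun _ => 0) continuousOn_const
        (show betaPressure β (fun _ => 0) < Real.log β + ε by rw [betaPressure_zero hβ]; linarith)]
      with n h1 h2
    have h3 := (sum_leftPoints_le_betaPartitionSum' hβ hh n).trans h1
    have h4 := (sum_leftPoints_le_betaPartitionSum' hβ (h := fun _ => 0)
      continuousOn_const n).trans h2
    have hterm : ∀ p : leftPoints hβ n × leftPoints hβ n, (2 * ρ n p) ^ s =
        (2 * K * Real.exp D) ^ s * Real.exp (n * (s * ε)) *
          (Real.exp (birkhoffSum (betaT β) (fun _ => 0) n p.1) *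
          Real.exp (birkhoffSum (betaT β) (fun x => -s * (Real.log β + g x)) n p.2)) := by
      intro p
      have e1 : birkhoffSum (betaT β) (fun _ => (0 : ℝ)) n (p.1 : ℝ) = 0 := by simp [birkhoffSum]
      have : 2 * ρ n p = 2 * K * Real.exp D * Real.exp (n * ε -
          (n * Real.log β + birkhoffSum (betaT β) g n p.2)) := by
        simp only [hρ]; rw [mul_assoc (2 * K), ← Real.exp_add, add_sub_assoc]; ring
      rw [this, Real.mul_rpow (by positivity) (by positivity), ← Real.exp_mul,
        birkhoffSum_neg_mul_add, e1, Real.exp_zero, one_mul, mul_assoc (_ ^ s), ← Real.exp_add]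
      congr 2
      ring
    simp only [hterm]
    rw [← Finset.mul_sum, sum_coe_prod_mul _
        (fun x => Real.exp (birkhoffSum (betaT β) (fun _ => 0) n x))
        (fun x => Real.exp (birkhoffSum (betaT β) (fun x => -s * (Real.log β + g x)) n x)),
      mul_assoc]
    gcongr
    calc _ ≤ Real.exp (n * (s * ε)) * (Real.exp (n * (Real.log β + ε)) * Real.exp (n * (P + ε))) :=
          by gcongr
      _ = _ := by
          rw [← Real.exp_add, ← Real.exp_add, ← Real.exp_nat_mul]
          congr 1
          ring
  · rintro ⟨x, y⟩ ⟨hx, hy, hfr⟩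
    simp only at hx hy hfr
    refine hfr.mono fun n hn => ?_
    have hxl : cylinderLeft β n x ∈ leftPoints hβ n := (mem_leftPoints hβ).2
      ⟨cylinderLeft_mem_Ico hβ hx n, betaT_iterate_cylinderLeft_self hβ hx n⟩
    have hyl : cylinderLeft β n y ∈ leftPoints hβ n := (mem_leftPoints hβ).2
      ⟨cylinderLeft_mem_Ico hβ hy n, betaT_iterate_cylinderLeft_self hβ hy n⟩
    refine ⟨⟨⟨_, hxl⟩, ⟨_, hyl⟩⟩, ?_⟩
    rw [← closedBall_prod_same, Set.mem_prod, Metric.mem_closedBall, Metric.mem_closedBall,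
      Real.dist_eq, Real.dist_eq]
    refine ⟨(abs_sub_cylinderLeft_lt hβ hK hC0 hCf hx hn.1).trans ?_,
      abs_sub_cylinderLeft_lt hβ hK hC0 hCg hy hn.2⟩
    have := birkhoffSum_le_birkhoffSum (β := β) hfg
      (Set.Ico_subset_Icc_self (cylinderLeft_mem_Ico hβ hx n))
      (Set.Ico_subset_Icc_self (cylinderLeft_mem_Ico hβ hy n)) n
    simp only [hρ]
    gcongr

/-- A closed interval of radius `b` is covered by `⌈b / a⌉` closed intervals of radius `a`. -/
theorem exists_fin_abs_sub_le {a b y c : ℝ} (ha : 0 < a) (hy : |y - c| ≤ b) :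
    ∃ i : Fin (⌊b / a⌋₊ + 1), |y - (c - b + (2 * (i : ℕ) + 1) * a)| ≤ a := by
  have h := abs_le.1 hy
  have hb : 0 ≤ b := (abs_nonneg _).trans hy
  have h0 : 0 ≤ (y - (c - b)) / (2 * a) := div_nonneg (by linarith) (by linarith)
  refine ⟨⟨⌊(y - (c - b)) / (2 * a)⌋₊, Nat.lt_succ_of_le (Nat.floor_mono ?_)⟩, ?_⟩
  · rw [div_le_div_iff₀ (by linarith) ha]
    nlinarith
  · have h1 := Nat.floor_le h0
    have h2 := Nat.lt_floor_add_one ((y - (c - b)) / (2 * a))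
    rw [le_div_iff₀ (by linarith)] at h1
    rw [div_lt_iff₀ (by linarith)] at h2
    rw [abs_le]
    constructor <;> simp only <;> linarith

/-- Each rectangle is cut into squares of its shorter side, governed by `f`, stacked along the
second coordinate. -/
theorem dimH_enlargedTargetSet_le_of_fst (hβ : 1 < β) {f g : ℝ → ℝ}
    (hf : ContinuousOn f (Set.Icc 0 1)) (hg : ContinuousOn g (Set.Icc 0 1))
    (hfg : ∀ x ∈ Set.Icc (0 : ℝ) 1, ∀ y ∈ Set.Icc (0 : ℝ) 1, g y ≤ f x)
    (x₀ y₀ : ℝ) {K : ℝ} (hK : 0 < K) {s : ℝ} (hs : 0 < s)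
    (hP : betaPressure β (fun x => f x - s * (Real.log β + f x)) +
      betaPressure β (fun x => -g x) < 0) :
    dimH (enlargedTargetSet β f g x₀ y₀ K) ≤ ENNReal.ofReal s := by
  set P := betaPressure β (fun x => f x - s * (Real.log β + f x)) with hPdef
  set Q := betaPressure β (fun x => -g x) with hQdef
  obtain ⟨ε, hε, hεs⟩ := exists_pos_mul_add_neg hs hP
  obtain ⟨C, hC0, hCf, hCg⟩ := exists_common_abs_sub_le hf hg hε
  have hh : ContinuousOn (fun x => f x - s * (Real.log β + f x)) (Set.Icc 0 1) :=
    hf.sub (continuousOn_const.mul (continuousOn_const.add hf))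
  set D := C * (1 / (β - 1)) with hD
  set a : ℕ → ℝ → ℝ := fun n p =>
    K * Real.exp (D + n * ε - (n * Real.log β + birkhoffSum (betaT β) f n p)) with ha
  set b : ℕ → ℝ → ℝ := fun n p =>
    K * Real.exp (D + n * ε - (n * Real.log β + birkhoffSum (betaT β) g n p)) with hb
  have ha0 : ∀ n p, 0 < a n p := fun n p => by positivity
  refine dimH_le_of_frequently_mem_closedBall
    (κ := fun n => Σ p : leftPoints hβ n × leftPoints hβ n, Fin (⌊b n p.2 / a n p.1⌋₊ + 1))
    (fun n p => ((p.1.1 : ℝ) + x₀ / β ^ n,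
      (p.1.2 : ℝ) + y₀ / β ^ n - b n p.1.2 + (2 * (p.2 : ℕ) + 1) * a n p.1.1))
    (fun n p => a n p.1.1)
    (fun n p => (ha0 _ _).le) (C := 2 * (2 * K * Real.exp D) ^ s)
    (θ := Real.exp (s * ε + 2 * ε + (P + Q))) hs (by positivity) (Real.exp_pos _).le
    (by rw [← Real.exp_zero]; exact Real.exp_lt_exp.2 hεs) ?_ ?_
  · filter_upwards [eventually_betaPartitionSum_le β hh (show P < P + ε by linarith),
      eventually_betaPartitionSum_le β hg.neg (show Q < Q + ε by linarith)] with n h1 h2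
    have h3 := (sum_leftPoints_le_betaPartitionSum' hβ hh n).trans h1
    have h4 := (sum_leftPoints_le_betaPartitionSum' hβ hg.neg n).trans h2
    have hterm : ∀ p : leftPoints hβ n × leftPoints hβ n,
        ∑ _i : Fin (⌊b n p.2 / a n p.1⌋₊ + 1), (2 * a n p.1) ^ s ≤
        2 * (2 * K * Real.exp D) ^ s * Real.exp (n * (s * ε)) *
          (Real.exp (birkhoffSum (betaT β) (fun x => f x - s * (Real.log β + f x)) n p.1) *
          Real.exp (birkhoffSum (betaT β) (fun x => -g x) n p.2)) := by
      intro p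
      have hp1 := ((mem_leftPoints hβ).1 p.1.2).1
      have hp2 := ((mem_leftPoints hβ).1 p.2.2).1
      have hba : b n p.2 / a n p.1 = Real.exp (birkhoffSum (betaT β) f n p.1 -
          birkhoffSum (betaT β) g n p.2) := by
        rw [ha, hb, mul_div_mul_left _ _ hK.ne', ← Real.exp_sub]
        congr 1
        ring
      -- Here `f ≥ g` enters: the ratio of the sides is at least `1`, so rounding up at most doubles
      -- the number of squares.
      have hba1 : 1 ≤ b n p.2 / a n p.1 := by
        rw [hba, Real.one_le_exp_iff]
        linarith [birkhoffSum_le_birkhoffSum (β := β) hfg (Set.Ico_subset_Icc_self hp1)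
          (Set.Ico_subset_Icc_self hp2) n]
      have hN : ((⌊b n p.2 / a n p.1⌋₊ + 1 : ℕ) : ℝ) ≤ 2 * (b n p.2 / a n p.1) := by
        have := Nat.floor_le (zero_le_one.trans hba1)
        push_cast
        linarith
      have e2 : 2 * a n p.1 = 2 * K * Real.exp D * Real.exp (n * ε -
          (n * Real.log β + birkhoffSum (betaT β) f n p.1)) := by
        simp only [ha]; rw [mul_assoc (2 * K), ← Real.exp_add, add_sub_assoc]; ring
      rw [Finset.sum_const, Finset.card_univ, Fintype.card_fin, nsmul_eq_mul]
      refine (mul_le_mul_of_nonneg_right hN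
        (Real.rpow_nonneg (by linarith [ha0 n p.1]) s)).trans (le_of_eq ?_)
      have e3 : birkhoffSum (betaT β) (fun x => -g x) n (p.2 : ℝ) =
        -birkhoffSum (betaT β) g n p.2 := by simp [birkhoffSum]
      rw [hba, e2, Real.mul_rpow (by positivity) (by positivity), ← Real.exp_mul,
        birkhoffSum_sub_mul_add, e3, mul_assoc (2 * _) (Real.exp _), ← Real.exp_add,
        ← Real.exp_add, mul_mul_mul_comm, ← Real.exp_add]
      congr 2
      ring
    rw [← Finset.univ_sigma_univ, Finset.sum_sigma]
    refine (Finset.sum_le_sum fun p _ => hterm p).trans ?_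
    rw [← Finset.mul_sum, sum_coe_prod_mul _
        (fun x => Real.exp (birkhoffSum (betaT β) (fun x => f x - s * (Real.log β + f x)) n x))
        (fun x => Real.exp (birkhoffSum (betaT β) (fun x => -g x) n x)),
      mul_assoc]
    gcongr
    calc _ ≤ Real.exp (n * (s * ε)) * (Real.exp (n * (P + ε)) * Real.exp (n * (Q + ε))) := by
          gcongr
          exact h4
      _ = _ := by
          rw [← Real.exp_add, ← Real.exp_add, ← Real.exp_nat_mul]
          congr 1
          ring
  · rintro ⟨x, y⟩ ⟨hx, hy, hfr⟩
    simp only at hx hy hfr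
    refine hfr.mono fun n hn => ?_
    have hxl : cylinderLeft β n x ∈ leftPoints hβ n := (mem_leftPoints hβ).2
      ⟨cylinderLeft_mem_Ico hβ hx n, betaT_iterate_cylinderLeft_self hβ hx n⟩
    have hyl : cylinderLeft β n y ∈ leftPoints hβ n := (mem_leftPoints hβ).2
      ⟨cylinderLeft_mem_Ico hβ hy n, betaT_iterate_cylinderLeft_self hβ hy n⟩
    obtain ⟨i, hi⟩ := exists_fin_abs_sub_le (ha0 n (cylinderLeft β n x))
      (abs_sub_cylinderLeft_lt hβ hK hC0 hCg hy hn.2)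
    refine ⟨⟨⟨⟨_, hxl⟩, ⟨_, hyl⟩⟩, i⟩, ?_⟩
    rw [← closedBall_prod_same, Set.mem_prod, Metric.mem_closedBall, Metric.mem_closedBall,
      Real.dist_eq, Real.dist_eq]
    exact ⟨abs_sub_cylinderLeft_lt hβ hK hC0 hCf hx hn.1, hi⟩

/-- The point `1` shares its forward orbit with a point of `[0,1)`. -/
theorem exists_mem_Ico_birkhoffSum_le (hβ : 1 < β) {h : ℝ → ℝ} {M : ℝ}
    (hM : ∀ x ∈ Set.Icc (0 : ℝ) 1, |h x| ≤ M) {x : ℝ} (hx : x ∈ Set.Icc (0 : ℝ) 1) :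
    ∃ v : Bool, ∃ x' ∈ Set.Ico (0 : ℝ) 1, x = x' + (bif v then 1 - betaT β 1 / β else 0) ∧
      ∀ n, 1 ≤ n → (betaT β)^[n] x = (betaT β)^[n] x' ∧
        birkhoffSum (betaT β) h n x' ≤ 2 * M + birkhoffSum (betaT β) h n x := by
  have hb : 0 < β := by linarith
  have hM0 : 0 ≤ M := (abs_nonneg _).trans (hM 0 (by simp))
  rcases eq_or_ne x 1 with rfl | hx1
  · have h1 := betaT_mem_Ico β 1
    -- `1` and `T(1)/β` have the same image under `T`, so their Birkhoff sums differ in the first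
    -- term only, by at most `2M`.
    have hmem : betaT β 1 / β ∈ Set.Ico (0 : ℝ) 1 :=
      ⟨div_nonneg h1.1 hb.le, by rw [div_lt_one hb]; linarith [h1.2]⟩
    have hT : betaT β (betaT β 1 / β) = betaT β 1 := by
      have := betaT_natCast_add_div hβ 0 h1
      simpa using this
    refine ⟨true, _, hmem, by simp, fun n hn => ?_⟩
    obtain ⟨k, rfl⟩ := Nat.exists_eq_succ_of_ne_zero (show n ≠ 0 by omega)
    refine ⟨by rw [Function.iterate_succ_apply, Function.iterate_succ_apply, hT], ?_⟩
    rw [birkhoffSum_succ', birkhoffSum_succ', hT]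
    linarith [abs_le.1 (hM 1 (by simp)), abs_le.1 (hM _ (Set.Ico_subset_Icc_self hmem))]
  · exact ⟨false, x, ⟨hx.1, lt_of_le_of_ne hx.2 hx1⟩, by simp, fun n _ => ⟨rfl, by linarith⟩⟩

/-- A coordinate equal to `1` is translated to `T(1)/β`, so the set lies in four translates of the
target set in `[0,1)²` enlarged by `exp (2M)`. -/
theorem dimH_shrinkingTargetSet_le (hβ : 1 < β) {f g : ℝ → ℝ}
    (hf : ContinuousOn f (Set.Icc 0 1)) (hg : ContinuousOn g (Set.Icc 0 1)) (x₀ y₀ : ℝ)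
    {d : ENNReal} (hd : ∀ K, 0 < K → dimH (enlargedTargetSet β f g x₀ y₀ K) ≤ d) :
    dimH (shrinkingTargetSet β f g x₀ y₀) ≤ d := by
  obtain ⟨M₁, hM₁⟩ := isCompact_Icc.exists_bound_of_continuousOn hf
  obtain ⟨M₂, hM₂⟩ := isCompact_Icc.exists_bound_of_continuousOn hg
  set M := max M₁ M₂
  have hfM : ∀ x ∈ Set.Icc (0 : ℝ) 1, |f x| ≤ M := fun x hx => (hM₁ x hx).trans (le_max_left _ _)
  have hgM : ∀ x ∈ Set.Icc (0 : ℝ) 1, |g x| ≤ M := fun x hx => (hM₂ x hx).trans (le_max_right _ _)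
  set τ : Bool → ℝ := fun v => bif v then 1 - betaT β 1 / β else 0 with hτ
  set E := enlargedTargetSet β f g x₀ y₀ (Real.exp (2 * M)) with hE
  have hsub : shrinkingTargetSet β f g x₀ y₀ ⊆
      ⋃ v : Bool × Bool, (fun p : ℝ × ℝ => p + (τ v.1, τ v.2)) '' E := by
    rintro ⟨x, y⟩ ⟨hx, hy, hfr⟩
    simp only at hx hy hfr
    obtain ⟨v, x', hx', rfl, hv⟩ := exists_mem_Ico_birkhoffSum_le hβ hfM hx
    obtain ⟨w, y', hy', rfl, hw⟩ := exists_mem_Ico_birkhoffSum_le hβ hgM hy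
    rw [Set.mem_iUnion]
    refine ⟨(v, w), (x', y'), ⟨hx', hy', ?_⟩, rfl⟩
    refine (hfr.and_eventually (eventually_ge_atTop 1)).mono fun n hn => ?_
    obtain ⟨⟨h1, h2⟩, hn1⟩ := hn
    rw [(hv n hn1).1] at h1
    rw [(hw n hn1).1] at h2
    simp only [← Real.exp_add]
    refine ⟨h1.trans_le (Real.exp_le_exp.2 ?_), h2.trans_le (Real.exp_le_exp.2 ?_)⟩
    · linarith [(hv n hn1).2]
    · linarith [(hw n hn1).2]
  refine (dimH_mono hsub).trans ?_
  rw [dimH_iUnion]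
  refine iSup_le fun v => ?_
  rw [(isometry_add_right ((τ v.1, τ v.2) : ℝ × ℝ)).dimH_image]
  exact hd _ (Real.exp_pos _)

/-! ### Cantor sets coded by full cylinders, and their uniform measures. -/

/-- A sequence of non-empty finite families of full cylinders; the `j`-th family consists of
cylinders of order `order j` whose closures avoid `1`. -/
structure FullBranchSystem (β : ℝ) where
  order : ℕ → ℕ
  words : ℕ → Finset ℝ
  nonempty : ∀ j, (words j).Nonempty
  isFull : ∀ j, ∀ c ∈ words j, IsFullBranch β (order j) c
  lt_one : ∀ j, ∀ c ∈ words j, c + (β ^ order j)⁻¹ < 1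

/-- Every closed interval of length `R` contains at most `Q` points of `S`. -/
def CountLE (S : Finset ℝ) (R : ℝ) (Q : ℕ) : Prop :=
  ∀ a, (S.filter fun b => a ≤ b ∧ b ≤ a + R).card ≤ Q

namespace FullBranchSystem

variable (S : FullBranchSystem β)

def depth (j : ℕ) : ℕ := ∑ i ∈ Finset.range j, S.order i

theorem depth_succ (j : ℕ) : S.depth (j + 1) = S.depth j + S.order j :=
  Finset.sum_range_succ _ _

theorem order_pos (j : ℕ) : 0 < S.order j := by
  obtain ⟨c, hc⟩ := S.nonempty j
  have h1 := (S.isFull j c hc).1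
  have h2 := S.lt_one j c hc
  rw [Nat.pos_iff_ne_zero]
  intro h
  rw [h] at h2
  norm_num at h2
  linarith

theorem le_depth (j : ℕ) : j ≤ S.depth j := by
  induction j with
  | zero => exact Nat.zero_le _
  | succ j ih => rw [depth_succ]; have := S.order_pos j; omega

/-- The left endpoint of the nested cylinder of depth `S.depth j` chosen by `ω`. -/
noncomputable def leftEnd (ω : ∀ j, S.words j) (j : ℕ) : ℝ :=
  ∑ i ∈ Finset.range j, (ω i : ℝ) / β ^ S.depth i

theorem leftEnd_succ (ω : ∀ j, S.words j) (j : ℕ) :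
    S.leftEnd ω (j + 1) = S.leftEnd ω j + (ω j : ℝ) / β ^ S.depth j :=
  Finset.sum_range_succ _ _

theorem isFullBranch_leftEnd (hβ : 1 < β) (ω : ∀ j, S.words j) (j : ℕ) :
    IsFullBranch β (S.depth j) (S.leftEnd ω j) := by
  induction j with
  | zero => simpa [depth, leftEnd] using IsFullBranch.zero_order β
  | succ j ih =>
    rw [depth_succ, leftEnd_succ]
    exact ih.comp hβ (S.isFull j _ (ω j).2)

theorem eq_of_leftEnd_eq (hβ : 1 < β) {ω ω' : ∀ j, S.words j} {j : ℕ}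
    (h : S.leftEnd ω j = S.leftEnd ω' j) : ∀ i < j, ω i = ω' i := by
  induction j with
  | zero => intro i hi; omega
  | succ j ih =>
    have e : ω j = ω' j := by
      apply Subtype.ext
      rw [leftEnd_succ, leftEnd_succ] at h
      have := congrArg (betaT β)^[S.depth j] h
      rwa [(S.isFullBranch_leftEnd hβ ω j).iterate_point ((S.isFull j _ (ω j).2).mem_Ico hβ),
        (S.isFullBranch_leftEnd hβ ω' j).iterate_point ((S.isFull j _ (ω' j).2).mem_Ico hβ)] at this
    intro i hi
    rcases Nat.lt_succ_iff_lt_or_eq.1 hi with h' | rfl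
    · refine ih ?_ i h'
      rw [leftEnd_succ, leftEnd_succ, e] at h
      linarith
    · exact e

theorem leftEnd_mono (hβ : 1 < β) (ω : ∀ j, S.words j) : Monotone (S.leftEnd ω) := by
  have hb : 0 < β := by linarith
  refine monotone_nat_of_le_succ fun j => ?_
  rw [leftEnd_succ]
  have := (S.isFull j _ (ω j).2).1
  have : 0 ≤ (ω j : ℝ) / β ^ S.depth j := by positivity
  linarith

theorem rightEnd_anti (hβ : 1 < β) (ω : ∀ j, S.words j) :
    Antitone fun j => S.leftEnd ω j + (β ^ S.depth j)⁻¹ := by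
  have hb : 0 < β := by linarith
  refine antitone_nat_of_succ_le fun j => ?_
  rw [leftEnd_succ, depth_succ]
  have h := (S.isFull j _ (ω j).2).2.1
  have e : S.leftEnd ω j + (ω j : ℝ) / β ^ S.depth j + (β ^ (S.depth j + S.order j))⁻¹ =
      S.leftEnd ω j + ((ω j : ℝ) + (β ^ S.order j)⁻¹) * (β ^ S.depth j)⁻¹ := by
    rw [pow_add]; field_simp; ring
  rw [e]
  gcongr
  exact mul_le_of_le_one_left (by positivity) h

/-- The point coded by `ω`. -/
noncomputable def point (ω : ∀ j, S.words j) : ℝ := ⨆ j, S.leftEnd ω j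

theorem leftEnd_le_rightEnd (hβ : 1 < β) (ω : ∀ j, S.words j) (i j : ℕ) :
    S.leftEnd ω i ≤ S.leftEnd ω j + (β ^ S.depth j)⁻¹ := by
  have hb : 0 < β := by linarith
  refine (S.leftEnd_mono hβ ω (le_max_left i j)).trans
    (le_trans ?_ (S.rightEnd_anti hβ ω (le_max_right i j)))
  have : 0 < (β ^ S.depth (max i j))⁻¹ := by positivity
  simp only
  linarith

theorem leftEnd_le_point (hβ : 1 < β) (ω : ∀ j, S.words j) (j : ℕ) :
    S.leftEnd ω j ≤ S.point ω :=
  le_ciSup (f := fun j => S.leftEnd ω j)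
    ⟨_, Set.forall_mem_range.2 fun i => S.leftEnd_le_rightEnd hβ ω i 0⟩ j

theorem point_le_rightEnd (hβ : 1 < β) (ω : ∀ j, S.words j) (j : ℕ) :
    S.point ω ≤ S.leftEnd ω j + (β ^ S.depth j)⁻¹ :=
  ciSup_le fun i => S.leftEnd_le_rightEnd hβ ω i j

/-- The set of points coded by a system of full cylinders. -/
def limitSet : Set ℝ := Set.range S.point

/-- Nested closed cylinders only give a tail in `[0,1]`; `lt_one` at the next level keeps it
strictly below `1`, so `T_β` follows the coded orbit. -/
theorem exists_tail (hβ : 1 < β) (ω : ∀ j, S.words j) (j : ℕ) :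
    ∃ z ∈ Set.Ico (0 : ℝ) 1,
      S.point ω = S.leftEnd ω j + ((ω j : ℝ) + z / β ^ S.order j) / β ^ S.depth j := by
  have hb : 0 < β := by linarith
  have key : ∀ i, ∃ z, 0 ≤ z ∧ z ≤ 1 ∧ S.point ω = S.leftEnd ω i + z / β ^ S.depth i := by
    intro i
    have hp : 0 < β ^ S.depth i := by positivity
    refine ⟨(S.point ω - S.leftEnd ω i) * β ^ S.depth i,
      mul_nonneg (sub_nonneg.2 (S.leftEnd_le_point hβ ω i)) hp.le, ?_, by field_simp; ring⟩
    rw [← le_div_iff₀ hp, one_div]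
    linarith [S.point_le_rightEnd hβ ω i]
  obtain ⟨y, hy0, hy1, hy⟩ := key (j + 2)
  have hc := S.lt_one (j + 1) _ (ω (j + 1)).2
  have hc0 := (S.isFull (j + 1) _ (ω (j + 1)).2).1
  refine ⟨ω (j + 1) + y / β ^ S.order (j + 1), ⟨by positivity, lt_of_le_of_lt ?_ hc⟩, ?_⟩
  · rw [div_eq_mul_inv]
    gcongr
    exact mul_le_of_le_one_left (by positivity) hy1
  · simp only [hy, leftEnd_succ, depth_succ, pow_add]
    field_simp
    ring

theorem limitSet_spec (hβ : 1 < β) {x : ℝ} (hx : x ∈ S.limitSet) : x ∈ Set.Ico (0 : ℝ) 1 ∧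
    ∀ j, ∃ b ∈ S.words j, ∃ z ∈ Set.Ico (0 : ℝ) 1,
      (betaT β)^[S.depth j] x = b + z / β ^ S.order j := by
  obtain ⟨ω, rfl⟩ := hx
  constructor
  · obtain ⟨z, hz, e⟩ := S.exists_tail hβ ω 0
    rw [e]
    exact (S.isFullBranch_leftEnd hβ ω 0).point_mem hβ ((S.isFull 0 _ (ω 0).2).point_mem hβ hz)
  · intro j
    obtain ⟨z, hz, e⟩ := S.exists_tail hβ ω j
    refine ⟨_, (ω j).2, z, hz, ?_⟩
    rw [e, (S.isFullBranch_leftEnd hβ ω j).iterate_point ((S.isFull j _ (ω j).2).point_mem hβ hz)]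

open MeasureTheory ProbabilityTheory

instance (j : ℕ) : Nonempty (S.words j) := (S.nonempty j).to_subtype

/-- Independent uniform choices of the cylinders. -/
noncomputable def codeMeasure : Measure (∀ j, S.words j) :=
  Measure.infinitePi fun _ => uniformOn Set.univ

instance : IsProbabilityMeasure S.codeMeasure := by
  unfold codeMeasure; infer_instance

theorem measurable_leftEnd (j : ℕ) : Measurable fun ω => S.leftEnd ω j := by
  unfold leftEnd
  refine Finset.measurable_sum _ fun i _ => ?_
  exact (measurable_subtype_coe.comp (measurable_pi_apply i)).div_const _

theorem measurable_point : Measurable S.point := Measurable.iSup S.measurable_leftEnd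

theorem codeMeasure_leftEnd_eq_le (hβ : 1 < β) (j : ℕ) (c : ℝ) :
    S.codeMeasure {ω | S.leftEnd ω j = c} ≤
      ENNReal.ofReal (∏ i ∈ Finset.range j, ((S.words i).card : ℝ)⁻¹) := by
  by_cases hne : ∃ ω₀, S.leftEnd ω₀ j = c
  · obtain ⟨ω₀, rfl⟩ := hne
    have hsub : {ω | S.leftEnd ω j = S.leftEnd ω₀ j} ⊆
        (↑(Finset.range j) : Set ℕ).pi fun i => {ω₀ i} := by
      intro ω hω i hi
      exact S.eq_of_leftEnd_eq hβ hω i (Finset.mem_range.1 hi)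
    refine (measure_mono hsub).trans ?_
    rw [codeMeasure, Measure.infinitePi_pi _ fun i _ => measurableSet_singleton _,
      ENNReal.ofReal_prod_of_nonneg fun i _ => by positivity]
    refine (Finset.prod_congr rfl fun i _ => ?_).le
    have hpos : (0 : ℝ) < (S.words i).card := by exact_mod_cast (S.nonempty i).card_pos
    rw [uniformOn_univ, Measure.count_singleton, ENNReal.ofReal_inv_of_pos hpos,
      ENNReal.ofReal_natCast, Fintype.card_coe, one_div]
  · push Not at hne
    have : {ω | S.leftEnd ω j = c} = ∅ := by
      ext ω; simpa using hne ω
    simp [this]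

/-- The law of the coded point. -/
noncomputable def law : Measure ℝ := S.codeMeasure.map S.point

instance : IsProbabilityMeasure S.law :=
  Measure.isProbabilityMeasure_map S.measurable_point.aemeasurable

theorem one_le_law_limitSet : 1 ≤ S.law S.limitSet := by
  refine le_trans (le_of_eq ?_) (Measure.le_map_apply S.measurable_point.aemeasurable S.limitSet)
  have : S.point ⁻¹' S.limitSet = Set.univ := by
    ext ω; simp [limitSet]
  rw [this, measure_univ]

/-- An interval of length `r` meets at most `3` cylinders of depth `j`. In each, after rescaling,
the relevant words lie in an interval of length `R + β^{-order} ≤ 2R` with `R = r β^{depth}`, hence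
there are at most `2Q`; this gives the `6Q`. -/
theorem law_Icc_le (hβ : 1 < β) {j : ℕ} {r : ℝ} (hr1 : (β ^ S.depth (j + 1))⁻¹ ≤ r)
    (hr2 : r ≤ (β ^ S.depth j)⁻¹) {Q : ℕ} (hQ : CountLE (S.words j) (r * β ^ S.depth j) Q)
    (a : ℝ) :
    S.law (Set.Icc a (a + r)) ≤
      ENNReal.ofReal (6 * Q * ∏ i ∈ Finset.range (j + 1), ((S.words i).card : ℝ)⁻¹) := by
  classical
  have hb : 0 < β := by linarith
  set p := β ^ S.depth j with hp
  have hp0 : 0 < p := by positivity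
  set w := ∏ i ∈ Finset.range (j + 1), ((S.words i).card : ℝ)⁻¹ with hw
  have hw0 : 0 ≤ w := Finset.prod_nonneg fun i _ => by positivity
  set C := (fullPoints hβ (S.depth j)).filter fun c => c ∈ Set.Icc (a - p⁻¹) (a - p⁻¹ + 2 * p⁻¹)
    with hC
  have hCcard : (C.card : ℝ) ≤ 3 := by
    have := card_le_of_separated C (a := a - p⁻¹) (r := 2 * p⁻¹) (ρ := p⁻¹) (by positivity)
      (by positivity) (fun x hx => (Finset.mem_filter.1 hx).2) (fun x hx y hy hxy =>
        ((mem_fullPoints hβ).1 (Finset.mem_filter.1 hx).1).add_inv_le_of_lt hβ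
          ((mem_fullPoints hβ).1 (Finset.mem_filter.1 hy).1).2.2.1 hxy)
    have e : 2 * p⁻¹ / p⁻¹ + 1 = 3 := by field_simp; norm_num
    linarith
  set D : ℝ → Finset ℝ := fun c => (S.words j).filter fun b =>
    (a - c) * p - (β ^ S.order j)⁻¹ ≤ b ∧ b ≤ (a + r - c) * p with hD
  have hrp : (β ^ S.order j)⁻¹ ≤ r * p := by
    rw [depth_succ, pow_add, ← hp, mul_inv] at hr1
    have := mul_le_mul_of_nonneg_right hr1 hp0.le
    rwa [mul_right_comm, inv_mul_cancel₀ hp0.ne', one_mul] at this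
  have hDcard : ∀ c, (D c).card ≤ 2 * Q := by
    intro c
    set a' := (a - c) * p - (β ^ S.order j)⁻¹ with ha'
    have hsub : D c ⊆ ((S.words j).filter fun b => a' ≤ b ∧ b ≤ a' + r * p) ∪
        ((S.words j).filter fun b => a' + r * p ≤ b ∧ b ≤ a' + r * p + r * p) := by
      intro b hb'
      rw [hD, Finset.mem_filter] at hb'
      rw [Finset.mem_union, Finset.mem_filter, Finset.mem_filter]
      rcases le_total b (a' + r * p) with h | h
      · exact Or.inl ⟨hb'.1, hb'.2.1, h⟩
      · refine Or.inr ⟨hb'.1, h, hb'.2.2.trans ?_⟩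
        rw [ha']
        nlinarith
    have h1 := hQ a'
    have h2 := hQ (a' + r * p)
    have := (Finset.card_le_card hsub).trans (Finset.card_union_le _ _)
    omega
  have hcover : S.point ⁻¹' Set.Icc a (a + r) ⊆
      ⋃ c ∈ C, ⋃ b ∈ D c, {ω | S.leftEnd ω (j + 1) = c + b / p} := by
    intro ω hω
    have h1 := S.leftEnd_le_point hβ ω (j + 1)
    have h2 := S.point_le_rightEnd hβ ω (j + 1)
    have h3 := S.leftEnd_le_point hβ ω j
    have h4 := S.point_le_rightEnd hβ ω j
    have h5 := hω.1
    have h6 := hω.2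
    rw [Set.mem_iUnion₂]
    refine ⟨S.leftEnd ω j, ?_, ?_⟩
    · rw [hC, Finset.mem_filter, mem_fullPoints]
      refine ⟨S.isFullBranch_leftEnd hβ ω j, ?_, ?_⟩ <;> linarith
    · rw [Set.mem_iUnion₂]
      refine ⟨ω j, ?_, S.leftEnd_succ ω j⟩
      rw [leftEnd_succ, ← hp] at h1 h2
      rw [depth_succ, pow_add, ← hp, mul_inv] at h2
      rw [hD, Finset.mem_filter]
      refine ⟨(ω j).2, ?_, ?_⟩
      · have h7 : a - S.leftEnd ω j ≤ (ω j : ℝ) / p + p⁻¹ * (β ^ S.order j)⁻¹ := by linarith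
        have h8 := mul_le_mul_of_nonneg_right h7 hp0.le
        rw [add_mul, div_mul_cancel₀ _ hp0.ne', mul_right_comm, inv_mul_cancel₀ hp0.ne',
          one_mul] at h8
        linarith
      · have h7 : (ω j : ℝ) / p ≤ a + r - S.leftEnd ω j := by linarith
        rwa [div_le_iff₀ hp0] at h7
  clear_value w C D p
  rw [law, Measure.map_apply S.measurable_point measurableSet_Icc]
  calc S.codeMeasure (S.point ⁻¹' Set.Icc a (a + r))
      ≤ ∑ c ∈ C, ∑ b ∈ D c, S.codeMeasure {ω | S.leftEnd ω (j + 1) = c + b / p} :=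
        (measure_mono hcover).trans ((measure_biUnion_finset_le _ _).trans
          (Finset.sum_le_sum fun c _ => measure_biUnion_finset_le _ _))
    _ ≤ ∑ c ∈ C, ∑ b ∈ D c, ENNReal.ofReal w :=
        Finset.sum_le_sum fun c _ => Finset.sum_le_sum fun b _ =>
          (S.codeMeasure_leftEnd_eq_le hβ (j + 1) _).trans_eq (by rw [hw])
    _ ≤ ∑ c ∈ C, ENNReal.ofReal (2 * Q * w) := by
        refine Finset.sum_le_sum fun c _ => ?_
        rw [Finset.sum_const, nsmul_eq_mul, ← ENNReal.ofReal_natCast,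
          ← ENNReal.ofReal_mul (by positivity)]
        refine ENNReal.ofReal_le_ofReal ?_
        gcongr
        exact_mod_cast hDcard c
    _ ≤ ENNReal.ofReal (6 * Q * w) := by
        rw [Finset.sum_const, nsmul_eq_mul, ← ENNReal.ofReal_natCast,
          ← ENNReal.ofReal_mul (by positivity)]
        refine ENNReal.ofReal_le_ofReal ?_
        calc (C.card : ℝ) * (2 * Q * w) ≤ 3 * (2 * Q * w) :=
              mul_le_mul_of_nonneg_right hCcard (by positivity)
          _ = 6 * Q * w := by ring

theorem exists_depth_bracket (hβ : 1 < β) {r : ℝ} (hr0 : 0 < r) (hr1 : r ≤ 1) :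
    ∃ j, (β ^ S.depth (j + 1))⁻¹ ≤ r ∧ r ≤ (β ^ S.depth j)⁻¹ := by
  have hex : ∃ j, (β ^ S.depth (j + 1))⁻¹ ≤ r := by
    obtain ⟨n, hn⟩ := pow_unbounded_of_one_lt r⁻¹ hβ
    refine ⟨n, inv_le_of_inv_le₀ hr0 (hn.le.trans ?_)⟩
    exact pow_le_pow_right₀ hβ.le ((Nat.le_succ n).trans (S.le_depth (n + 1)))
  classical
  refine ⟨Nat.find hex, Nat.find_spec hex, ?_⟩
  rcases Nat.eq_zero_or_pos (Nat.find hex) with h | h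
  · rw [h]; simpa [depth] using hr1
  · have := Nat.find_min hex (Nat.sub_one_lt_of_lt h)
    rw [Nat.sub_add_cancel (show 1 ≤ Nat.find hex from h)] at this
    exact (not_le.1 this).le

end FullBranchSystem

/-! ### Mass distribution principle for products of two coded measures. -/

section MassDistribution

open MeasureTheory

/-- The counting hypothesis under which the product of the laws of two systems of full cylinders
has local dimension at least `s`. -/
structure PairCount (S S' : FullBranchSystem β) (s s' C : ℝ) : Prop where
  order_eq : ∀ j, S'.order j = S.order j
  -- The constant `C` is lost once at every level; long orders let the gap `s' - s` absorb it.
  le_rpow : ∀ j, C ≤ β ^ ((s' - s) * S.order j)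
  count : ∀ j R, (β ^ S.order j)⁻¹ ≤ R → R ≤ 1 → ∃ Q Q' : ℕ, CountLE (S.words j) R Q ∧
    CountLE (S'.words j) R Q' ∧ (Q * Q' : ℝ) ≤ C * R ^ s' * ((S.words j).card * (S'.words j).card)

theorem one_le_of_countLE {A : Finset ℝ} (hA : A.Nonempty) {R : ℝ} (hR : 0 ≤ R) {Q : ℕ}
    (h : CountLE A R Q) : 1 ≤ Q := by
  obtain ⟨b, hb⟩ := hA
  refine le_trans (Finset.card_pos.2 ⟨b, ?_⟩) (h b)
  rw [Finset.mem_filter]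
  exact ⟨hb, le_rfl, by linarith⟩

theorem law_mul_law_le (hβ : 1 < β) {S S' : FullBranchSystem β} {s s' C : ℝ} (hs : s ≤ s')
    (hC : 0 ≤ C) (h : PairCount S S' s s' C) {r : ℝ} (hr0 : 0 < r) (hr1 : r ≤ 1) (a a' : ℝ) :
    S.law (Set.Icc a (a + r)) * S'.law (Set.Icc a' (a' + r)) ≤
      ENNReal.ofReal (36 * C * r ^ s) := by
  have hb : 0 < β := by linarith
  have hdepth : ∀ j, S'.depth j = S.depth j := fun j =>
    Finset.sum_congr rfl fun i _ => h.order_eq i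
  obtain ⟨j, hj1, hj2⟩ := S.exists_depth_bracket hβ hr0 hr1
  set R := r * β ^ S.depth j with hR
  have hp0 : 0 < β ^ S.depth j := by positivity
  have hR0 : 0 < R := by positivity
  have hR1 : R ≤ 1 := by
    rw [hR, ← le_div_iff₀ hp0, one_div]; exact hj2
  have hRo : (β ^ S.order j)⁻¹ ≤ R := by
    rw [S.depth_succ, pow_add, mul_inv] at hj1
    have := mul_le_mul_of_nonneg_right hj1 hp0.le
    rwa [mul_right_comm, inv_mul_cancel₀ hp0.ne', one_mul] at this
  obtain ⟨Q, Q', hQ, hQ', hQQ⟩ := h.count j R hRo hR1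
  refine (mul_le_mul' (S.law_Icc_le hβ hj1 hj2 hQ a) (S'.law_Icc_le hβ (j := j) (Q := Q')
    (by rwa [hdepth]) (by rwa [hdepth]) (by rwa [hdepth]) a')).trans ?_
  rw [← ENNReal.ofReal_mul (mul_nonneg (by positivity)
    (Finset.prod_nonneg fun i _ => by positivity))]
  refine ENNReal.ofReal_le_ofReal ?_
  set N : ℕ → ℝ := fun i => (S.words i).card * (S'.words i).card with hN
  have hN0 : ∀ i, 0 < N i := fun i => mul_pos (by exact_mod_cast (S.nonempty i).card_pos)
    (by exact_mod_cast (S'.nonempty i).card_pos)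
  -- At the finest scale `R = β^{-order}` both counts are at least `1`, so the counting hypothesis
  -- bounds the number of pairs of words from below.
  have hbound : ∀ i, (N i)⁻¹ ≤ β ^ (-(s * S.order i)) := by
    intro i
    have hq0 : 0 < (β ^ S.order i)⁻¹ := by positivity
    obtain ⟨q, q', hq, hq', hqq⟩ := h.count i _ le_rfl
      (inv_le_one_of_one_le₀ (one_le_pow₀ hβ.le))
    have h1 : (1 : ℝ) ≤ q * q' := by
      exact_mod_cast Nat.mul_pos (one_le_of_countLE (S.nonempty i) hq0.le hq)
        (one_le_of_countLE (S'.nonempty i) hq0.le hq')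
    have h2 := h1.trans hqq
    rw [inv_le_iff_one_le_mul₀ (hN0 i)]
    refine h2.trans (mul_le_mul_of_nonneg_right ?_ (hN0 i).le)
    rw [← Real.rpow_natCast, ← Real.rpow_neg hb.le, ← Real.rpow_mul hb.le]
    calc _ ≤ β ^ ((s' - s) * S.order i) * β ^ (-(S.order i : ℝ) * s') := by
          gcongr
          exact h.le_rpow i
      _ = _ := by rw [← Real.rpow_add hb]; congr 1; ring
  have hprod : ∏ i ∈ Finset.range j, (N i)⁻¹ ≤ β ^ (-(s * S.depth j)) := by
    refine (Finset.prod_le_prod (fun i _ => (inv_pos.2 (hN0 i)).le) fun i _ => hbound i).trans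
      (le_of_eq ?_)
    rw [← Real.rpow_sum_of_pos hb]
    congr 1
    rw [Finset.sum_neg_distrib, ← Finset.mul_sum, FullBranchSystem.depth]
    push_cast
    rfl
  have e : (∏ i ∈ Finset.range (j + 1), ((S.words i).card : ℝ)⁻¹) *
      ∏ i ∈ Finset.range (j + 1), ((S'.words i).card : ℝ)⁻¹ =
      (∏ i ∈ Finset.range j, (N i)⁻¹) * (N j)⁻¹ := by
    rw [← Finset.prod_mul_distrib, ← Finset.prod_range_succ]
    simp only [hN, mul_inv]
  rw [mul_mul_mul_comm, e]
  have hprod0 : 0 ≤ ∏ i ∈ Finset.range j, (N i)⁻¹ :=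
    Finset.prod_nonneg fun i _ => (inv_pos.2 (hN0 i)).le
  have hNj := hN0 j
  have hNcard : ((S.words j).card * (S'.words j).card : ℝ) = N j := rfl
  rw [hNcard] at hQQ
  generalize (∏ i ∈ Finset.range j, (N i)⁻¹) = w₀ at hprod hprod0 ⊢
  generalize N j = n₀ at hQQ hNj ⊢
  clear_value R
  calc 6 * (Q : ℝ) * (6 * Q') * (w₀ * n₀⁻¹) = 36 * (Q * Q' * n₀⁻¹ * w₀) := by ring
    _ ≤ 36 * (C * R ^ s * β ^ (-(s * S.depth j))) := by
        have h3 : (Q * Q' : ℝ) * n₀⁻¹ ≤ C * R ^ s := by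
          rw [← div_eq_mul_inv, div_le_iff₀ hNj]
          exact hQQ.trans (mul_le_mul_of_nonneg_right (mul_le_mul_of_nonneg_left
            (Real.rpow_le_rpow_of_exponent_ge hR0 hR1 hs) hC) hNj.le)
        gcongr
    _ = 36 * C * r ^ s := by
        rw [hR, Real.mul_rpow hr0.le hp0.le, ← Real.rpow_natCast β (S.depth j),
          ← Real.rpow_mul hb.le]
        have : β ^ ((S.depth j : ℝ) * s) * β ^ (-(s * S.depth j)) = 1 := by
          rw [← Real.rpow_add hb, mul_comm, add_neg_cancel, Real.rpow_zero]
        linear_combination 36 * C * r ^ s * this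

theorem le_dimH_of_pairCount (hβ : 1 < β) {S S' : FullBranchSystem β} {s s' C : ℝ} (hs0 : 0 < s)
    (hs : s ≤ s') (hC : 0 < C) (h : PairCount S S' s s' C) {E : Set (ℝ × ℝ)}
    (hE : S.limitSet ×ˢ S'.limitSet ⊆ E) : ENNReal.ofReal s ≤ dimH E := by
  set μ : Measure (ℝ × ℝ) := S.law.prod S'.law with hμ
  set d : NNReal := ⟨s, hs0.le⟩ with hd
  have hds : (d : ℝ) = s := rfl
  rw [show ENNReal.ofReal s = (d : ENNReal) from by rw [← hds, ENNReal.ofReal_coe_nnreal]]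
  set L : ℝ := 36 * C * 2 ^ s with hL
  have hL0 : 0 < L := by positivity
  have hball : ∀ (p : ℝ × ℝ) (r : ℝ), 0 < r → r ≤ 1 / 2 →
      μ (Metric.closedBall p r) ≤ ENNReal.ofReal (L * r ^ s) := by
    intro p r hr0 hr1
    have e : Metric.closedBall p r =
        Set.Icc (p.1 - r) (p.1 - r + 2 * r) ×ˢ Set.Icc (p.2 - r) (p.2 - r + 2 * r) := by
      rw [← closedBall_prod_same, Real.closedBall_eq_Icc, Real.closedBall_eq_Icc]
      congr 2 <;> ring
    rw [e, hμ, Measure.prod_prod]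
    refine (law_mul_law_le hβ hs hC.le h (by linarith) (by linarith) _ _).trans (le_of_eq ?_)
    rw [Real.mul_rpow zero_le_two hr0.le, hL]
    congr 1
    ring
  have hdiam : ∀ U : Set (ℝ × ℝ), Metric.ediam U ≤ ENNReal.ofReal (1 / 2) →
      (ENNReal.ofReal L)⁻¹ * μ U ≤ Metric.ediam U ^ s := by
    intro U hU
    rw [ENNReal.inv_mul_le_iff (by simpa using hL0) ENNReal.ofReal_ne_top]
    rcases U.eq_empty_or_nonempty with rfl | ⟨p, hp⟩
    · simp
    have hfin : Metric.ediam U ≠ ⊤ := ne_top_of_le_ne_top ENNReal.ofReal_ne_top hU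
    set t := (Metric.ediam U).toReal with ht
    have ht0 : 0 ≤ t := ENNReal.toReal_nonneg
    have hte : Metric.ediam U = ENNReal.ofReal t := (ENNReal.ofReal_toReal hfin).symm
    have hsub : ∀ r, t ≤ r → U ⊆ Metric.closedBall p r := by
      intro r hr q hq
      rw [Metric.mem_closedBall]
      have h1 := Metric.edist_le_ediam_of_mem hq hp
      rw [hte, edist_dist, ENNReal.ofReal_le_ofReal_iff ht0] at h1
      exact h1.trans hr
    have ht1 : t ≤ 1 / 2 := by
      rw [hte] at hU
      exact (ENNReal.ofReal_le_ofReal_iff (by norm_num)).1 hU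
    rw [hte, ENNReal.ofReal_rpow_of_nonneg ht0 hs0.le, ← ENNReal.ofReal_mul hL0.le]
    -- Sets of diameter zero lie in no ball of positive radius comparable to their diameter; they
    -- are handled by letting the radius tend to `0`.
    rcases ht0.eq_or_lt with h0 | h0
    · have hlim : Tendsto (fun r : ℝ => ENNReal.ofReal (L * r ^ s)) (𝓝[>] 0)
          (𝓝 (ENNReal.ofReal (L * 0 ^ s))) :=
        ENNReal.tendsto_ofReal ((((Real.continuousAt_rpow_const 0 s (Or.inr hs0.le)).tendsto).mono_left
          nhdsWithin_le_nhds).const_mul L)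
      rw [← h0]
      refine ge_of_tendsto hlim ?_
      filter_upwards [Ioc_mem_nhdsGT (show (0 : ℝ) < 1 / 2 by norm_num)] with r hr
      exact (measure_mono (hsub r (by rw [← h0]; exact hr.1.le))).trans (hball p r hr.1 hr.2)
    · exact (measure_mono (hsub t le_rfl)).trans (hball p t h0 ht1)
  have hle : (ENNReal.ofReal L)⁻¹ • μ ≤ μH[s] :=
    Measure.le_hausdorffMeasure s _ (ENNReal.ofReal (1 / 2)) (by simp) hdiam
  refine le_dimH_of_hausdorffMeasure_ne_zero ?_
  rw [hds]
  have hpos : 0 < ((ENNReal.ofReal L)⁻¹ • μ) E := by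
    rw [Measure.smul_apply, smul_eq_mul]
    refine ENNReal.mul_pos (ENNReal.inv_ne_zero.2 ENNReal.ofReal_ne_top) ?_
    refine (lt_of_lt_of_le one_pos ?_).ne'
    refine le_trans ?_ (measure_mono hE)
    rw [hμ, Measure.prod_prod]
    exact le_trans (by simp) (mul_le_mul' S.one_le_law_limitSet S'.one_le_law_limitSet)
  exact (hpos.trans_le (hle E)).ne'

end MassDistribution

/-! ### Concatenation of blocks of full cylinders. -/

/-- Left endpoints of the cylinders obtained by concatenating a word of order `n` from `S` with a
word from `S'`. -/
noncomputable def concatPoints (β : ℝ) (n : ℕ) (S S' : Finset ℝ) : Finset ℝ :=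
  Finset.image₂ (fun c b => c + b / β ^ n) S S'

theorem mem_concatPoints {n : ℕ} {S S' : Finset ℝ} {x : ℝ} :
    x ∈ concatPoints β n S S' ↔ ∃ c ∈ S, ∃ b ∈ S', c + b / β ^ n = x := Finset.mem_image₂

theorem card_concatPoints (hβ : 1 < β) {n : ℕ} {S S' : Finset ℝ}
    (hS : ∀ c ∈ S, IsFullBranch β n c) (hS' : ∀ b ∈ S', b ∈ Set.Ico (0 : ℝ) 1) :
    (concatPoints β n S S').card = S.card * S'.card := by
  have hb : 0 < β ^ n := by have : 0 < β := by linarith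
                            positivity
  refine Finset.card_image₂_iff.2 ?_
  rintro ⟨c, b⟩ ⟨hc, hbm⟩ ⟨c', b'⟩ ⟨hc', hbm'⟩ h
  simp only [Finset.mem_coe] at hc hbm hc' hbm' h
  have h1 := congrArg (betaT β)^[n] h
  rw [(hS c hc).iterate_point (hS' b hbm), (hS c' hc').iterate_point (hS' b' hbm')] at h1
  rw [h1] at h
  simp only [Prod.mk.injEq]
  exact ⟨by linarith, h1⟩

theorem countLE_concatPoints (hβ : 1 < β) {n : ℕ} {S S' : Finset ℝ}
    (hS : ∀ c ∈ S, IsFullBranch β n c) (hS' : ∀ b ∈ S', b ∈ Set.Ico (0 : ℝ) 1) {R : ℝ}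
    (hR : R ≤ (β ^ n)⁻¹) :
    CountLE (concatPoints β n S S') R (3 * S'.card) := by
  have hb : 0 < β := by linarith
  intro a
  set ρ := (β ^ n)⁻¹ with hρ
  have hρ0 : 0 < ρ := by positivity
  set C := S.filter fun c => c ∈ Set.Icc (a - ρ) (a - ρ + 2 * ρ) with hC
  have hCcard : (C.card : ℝ) ≤ 3 := by
    have := card_le_of_separated C (a := a - ρ) (r := 2 * ρ) (ρ := ρ) hρ0
      (by positivity) (fun x hx => (Finset.mem_filter.1 hx).2) (fun x hx y hy hxy =>
        (hS x (Finset.mem_filter.1 hx).1).add_inv_le_of_lt hβ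
          (hS y (Finset.mem_filter.1 hy).1).2.2.1 hxy)
    have e : 2 * ρ / ρ + 1 = 3 := by field_simp; norm_num
    linarith
  have hsub : ((concatPoints β n S S').filter fun b => a ≤ b ∧ b ≤ a + R) ⊆
      concatPoints β n C S' := by
    intro x hx
    rw [Finset.mem_filter, mem_concatPoints] at hx
    obtain ⟨⟨c, hc, b, hb', rfl⟩, h1, h2⟩ := hx
    have h3 := hS' b hb'
    have h4 : 0 ≤ b / β ^ n := div_nonneg h3.1 (by positivity)
    have h5 : b / β ^ n ≤ ρ := by
      rw [div_eq_mul_inv]; exact mul_le_of_le_one_left hρ0.le h3.2.le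
    refine mem_concatPoints.2 ⟨c, ?_, b, hb', rfl⟩
    rw [hC, Finset.mem_filter]
    refine ⟨hc, ?_, ?_⟩ <;> linarith
  refine (Finset.card_le_card hsub).trans ((Finset.card_image₂_le _ _ _).trans ?_)
  gcongr
  exact_mod_cast hCcard

/-- The left endpoints of the cylinders coded by a list of blocks. -/
noncomputable def blockPoints (β : ℝ) : List (ℕ × Finset ℝ) → Finset ℝ
  | [] => {0}
  | b :: L => concatPoints β b.1 b.2 (blockPoints β L)

def blockOrder (L : List (ℕ × Finset ℝ)) : ℕ := (L.map Prod.fst).sum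

def blockCard (L : List (ℕ × Finset ℝ)) : ℕ := (L.map fun b => b.2.card).prod

/-- All blocks in the list consist of full cylinders of the indicated order. -/
def BlocksFull (β : ℝ) (L : List (ℕ × Finset ℝ)) : Prop :=
  ∀ b ∈ L, ∀ c ∈ b.2, IsFullBranch β b.1 c

theorem isFullBranch_of_mem_blockPoints (hβ : 1 < β) {L : List (ℕ × Finset ℝ)}
    (hL : BlocksFull β L) {c : ℝ} (hc : c ∈ blockPoints β L) :
    IsFullBranch β (blockOrder L) c := by
  induction L generalizing c with
  | nil =>
    rw [blockPoints, Finset.mem_singleton] at hc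
    rw [hc]
    exact IsFullBranch.zero_order β
  | cons b L ih =>
    rw [blockPoints, mem_concatPoints] at hc
    obtain ⟨d, hd, e, he, rfl⟩ := hc
    exact (hL b (by simp) d hd).comp hβ (ih (fun b' hb' => hL b' (by simp [hb'])) he)

theorem card_blockPoints (hβ : 1 < β) {L : List (ℕ × Finset ℝ)} (hL : BlocksFull β L) :
    (blockPoints β L).card = blockCard L := by
  induction L with
  | nil => simp [blockPoints, blockCard]
  | cons b L ih =>
    have hL' : BlocksFull β L := fun b' hb' => hL b' (by simp [hb'])
    rw [blockPoints, card_concatPoints hβ (hL b (by simp))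
      (fun c hc => (isFullBranch_of_mem_blockPoints hβ hL' hc).mem_Ico hβ), ih hL']
    simp [blockCard]

theorem blockOrder_append (L₁ L₂ : List (ℕ × Finset ℝ)) :
    blockOrder (L₁ ++ L₂) = blockOrder L₁ + blockOrder L₂ := by simp [blockOrder]

theorem blockCard_append (L₁ L₂ : List (ℕ × Finset ℝ)) :
    blockCard (L₁ ++ L₂) = blockCard L₁ * blockCard L₂ := by simp [blockCard]

theorem blockPoints_append (hβ : 1 < β) (L₁ L₂ : List (ℕ × Finset ℝ)) :
    blockPoints β (L₁ ++ L₂) =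
      concatPoints β (blockOrder L₁) (blockPoints β L₁) (blockPoints β L₂) := by
  have hb : 0 < β := by linarith
  induction L₁ with
  | nil =>
    ext x
    simp [blockPoints, mem_concatPoints, blockOrder]
  | cons b L ih =>
    ext x
    have ho : blockOrder (b :: L) = b.1 + blockOrder L := by simp [blockOrder]
    have key : ∀ c d e : ℝ, c + d / β ^ b.1 + e / β ^ (b.1 + blockOrder L) =
        c + (d + e / β ^ blockOrder L) / β ^ b.1 := by
      intro c d e
      rw [pow_add]; field_simp; ring
    rw [List.cons_append, blockPoints, ih, mem_concatPoints, mem_concatPoints, blockPoints, ho]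
    constructor
    · rintro ⟨c, hc, y, hy, rfl⟩
      obtain ⟨d, hd, e, he, rfl⟩ := mem_concatPoints.1 hy
      exact ⟨_, mem_concatPoints.2 ⟨c, hc, d, hd, rfl⟩, e, he, key c d e⟩
    · rintro ⟨y, hy, e, he, rfl⟩
      obtain ⟨c, hc, d, hd, rfl⟩ := mem_concatPoints.1 hy
      exact ⟨c, hc, _, mem_concatPoints.2 ⟨d, hd, e, he, rfl⟩, (key c d e).symm⟩

theorem BlocksFull.append {L₁ L₂ : List (ℕ × Finset ℝ)} (h₁ : BlocksFull β L₁)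
    (h₂ : BlocksFull β L₂) : BlocksFull β (L₁ ++ L₂) := fun b hb =>
  (List.mem_append.1 hb).elim (h₁ b) (h₂ b)

theorem BlocksFull.replicate {n : ℕ} {A : Finset ℝ} (hA : ∀ c ∈ A, IsFullBranch β n c) (k : ℕ) :
    BlocksFull β (List.replicate k (n, A)) := fun b hb => by
  rw [List.eq_of_mem_replicate hb]; exact hA

theorem BlocksFull.singleton {n : ℕ} {c : ℝ} (hc : IsFullBranch β n c) :
    BlocksFull β [(n, {c})] := fun b hb d hd => by
  rw [List.mem_singleton] at hb
  subst hb
  rw [Finset.mem_singleton.1 hd]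
  exact hc

theorem blockOrder_replicate (k n : ℕ) (A : Finset ℝ) :
    blockOrder (List.replicate k (n, A)) = k * n := by simp [blockOrder]

theorem blockCard_replicate (k n : ℕ) (A : Finset ℝ) :
    blockCard (List.replicate k (n, A)) = A.card ^ k := by simp [blockCard]

theorem blockOrder_singleton (n : ℕ) (c : ℝ) : blockOrder [(n, {c})] = n := by simp [blockOrder]

theorem blockCard_singleton (n : ℕ) (c : ℝ) : blockCard [(n, {c})] = 1 := by simp [blockCard]

theorem countLE_blockPoints_append (hβ : 1 < β) {L₁ L₂ : List (ℕ × Finset ℝ)}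
    (h₁ : BlocksFull β L₁) (h₂ : BlocksFull β L₂) {R : ℝ}
    (hR : R ≤ (β ^ blockOrder L₁)⁻¹) :
    CountLE (blockPoints β (L₁ ++ L₂)) R (3 * blockCard L₂) := by
  rw [blockPoints_append hβ, ← card_blockPoints hβ h₂]
  exact countLE_concatPoints hβ (fun c hc => isFullBranch_of_mem_blockPoints hβ h₁ hc)
    (fun c hc => (isFullBranch_of_mem_blockPoints hβ h₂ hc).mem_Ico hβ) hR

/-- Only the factors `L₂`, `L₂'` are left to count below the scale of `L₁`, `L₁'`; the `9` is a
factor `3` per coordinate. The order `p` of the scale may exceed the orders of `L₁`, `L₁'`, which is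
what happens while a target word is being read. `β^(s * m)` pays for `R` falling between consecutive
block scales. -/
theorem exists_countLE_of_split (hβ : 1 < β) {L₁ L₂ L₁' L₂' : List (ℕ × Finset ℝ)}
    (h₁ : BlocksFull β L₁) (h₂ : BlocksFull β L₂) (h₁' : BlocksFull β L₁')
    (h₂' : BlocksFull β L₂') {R s : ℝ} {p m : ℕ} (hs : 0 ≤ s) (hR0 : 0 < R)
    (hR : R ≤ (β ^ blockOrder L₁)⁻¹) (hR' : R ≤ (β ^ blockOrder L₁')⁻¹)
    (hpR : (β ^ (p + m))⁻¹ ≤ R) (hcard : β ^ (s * p) ≤ (blockCard L₁ * blockCard L₁' : ℝ)) :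
    ∃ Q Q' : ℕ, CountLE (blockPoints β (L₁ ++ L₂)) R Q ∧
      CountLE (blockPoints β (L₁' ++ L₂')) R Q' ∧
      (Q * Q' : ℝ) ≤ 9 * β ^ (s * m) * R ^ s *
        ((blockPoints β (L₁ ++ L₂)).card * (blockPoints β (L₁' ++ L₂')).card) := by
  have hb : 0 < β := by linarith
  refine ⟨_, _, countLE_blockPoints_append hβ h₁ h₂ hR,
    countLE_blockPoints_append hβ h₁' h₂' hR', ?_⟩
  rw [card_blockPoints hβ (h₁.append h₂), card_blockPoints hβ (h₁'.append h₂'), blockCard_append,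
    blockCard_append]
  push_cast
  have h1 : 1 ≤ β ^ (s * m) * R ^ s * (blockCard L₁ * blockCard L₁') := by
    have h2 : (β ^ (-((p : ℝ) + m))) ^ s ≤ R ^ s := by
      refine Real.rpow_le_rpow (by positivity) ?_ hs
      rw [Real.rpow_neg hb.le]
      exact_mod_cast hpR
    calc (1 : ℝ) = β ^ (s * m) * (β ^ (-((p : ℝ) + m))) ^ s * β ^ (s * p) := by
          rw [← Real.rpow_mul hb.le, ← Real.rpow_add hb, ← Real.rpow_add hb]
          rw [show s * (m : ℝ) + -((p : ℝ) + m) * s + s * p = 0 by ring, Real.rpow_zero]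
      _ ≤ _ := by gcongr
  have h3 : (0 : ℝ) ≤ 9 * (blockCard L₂ * blockCard L₂') := by positivity
  nlinarith [mul_le_mul_of_nonneg_left h1 h3]

/-! ### One phase: free blocks, target words, filling blocks. -/

theorem birkhoffSum_replicate_le (hβ : 1 < β) {f : ℝ → ℝ} {m : ℕ} {A : Finset ℝ} {α : ℝ}
    (hA : ∀ c ∈ A, IsFullBranch β m c)
    (hα : ∀ c ∈ A, ∀ x ∈ Set.Ico (0 : ℝ) 1, birkhoffSum (betaT β) f m (c + x / β ^ m) ≤ m * α)
    (k : ℕ) : ∀ c ∈ blockPoints β (List.replicate k (m, A)), ∀ x ∈ Set.Ico (0 : ℝ) 1,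
      birkhoffSum (betaT β) f (k * m) (c + x / β ^ (k * m)) ≤ k * m * α := by
  have hb : 0 < β := by linarith
  induction k with
  | zero => intro c _ x _; simp
  | succ k ih =>
    intro c hc x hx
    rw [List.replicate_succ, blockPoints, mem_concatPoints] at hc
    obtain ⟨d, hd, e, he, rfl⟩ := hc
    have hfe := isFullBranch_of_mem_blockPoints hβ (BlocksFull.replicate hA k) he
    rw [blockOrder_replicate] at hfe
    have hy := hfe.point_mem hβ hx
    have eq : d + e / β ^ m + x / β ^ ((k + 1) * m) = d + (e + x / β ^ (k * m)) / β ^ m := by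
      rw [add_mul, one_mul, pow_add]; field_simp; ring
    rw [eq, add_mul, one_mul, add_comm (k * m) m, birkhoffSum_add, (hA d hd).iterate_point hy]
    have h1 := hα d hd _ hy
    have h2 := ih e he x hx
    push_cast
    linarith

theorem exists_isFullBranch_near_target (hβ : 1 < β) {x₀ : ℝ} (hx₀ : x₀ ∈ Set.Icc (0 : ℝ) 1)
    {ρ : ℝ} (hρ0 : 0 < ρ) (hρ1 : ρ ≤ 1) {l : ℕ} (hl : (l + 1) / β ^ l ≤ ρ / 2) :
    ∃ v, IsFullBranch β l v ∧ ∀ y ∈ Set.Ico (0 : ℝ) 1, |v + y / β ^ l - x₀| < ρ := by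
  have hb : 0 < β := by linarith
  -- An interval of length `ρ/2` with an end at `x₀`, on the side where `[0,1]` has room.
  obtain ⟨a, ha0, ha1, ha2, ha3⟩ : ∃ a : ℝ, 0 ≤ a ∧ a + ρ / 2 ≤ 1 ∧ x₀ - ρ / 2 ≤ a ∧ a ≤ x₀ := by
    rcases le_total x₀ (1 / 2) with h | h
    · exact ⟨x₀, hx₀.1, by linarith, by linarith, le_rfl⟩
    · exact ⟨x₀ - ρ / 2, by linarith, by linarith [hx₀.2], le_rfl, by linarith⟩
  obtain ⟨v, hv, hv1, hv2⟩ := exists_isFullBranch_subset hβ l ha0 ha1 (by linarith)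
  refine ⟨v, hv, fun y hy => ?_⟩
  have h1 : 0 ≤ y / β ^ l := div_nonneg hy.1 (by positivity)
  have h2 : y / β ^ l ≤ (β ^ l)⁻¹ := by
    rw [div_eq_mul_inv]; exact mul_le_of_le_one_left (by positivity) hy.2.le
  rw [abs_lt]
  constructor <;> linarith

theorem hits_target_of_blocks (hβ : 1 < β) {f : ℝ → ℝ} {m k l : ℕ} {A : Finset ℝ} {α x₀ ρ N v : ℝ}
    (hA : ∀ c ∈ A, IsFullBranch β m c)
    (hα : ∀ c ∈ A, ∀ x ∈ Set.Ico (0 : ℝ) 1, birkhoffSum (betaT β) f m (c + x / β ^ m) ≤ m * α)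
    (hv : IsFullBranch β l v) (hvρ : ∀ y ∈ Set.Ico (0 : ℝ) 1, |v + y / β ^ l - x₀| < ρ)
    (hρ : ρ ≤ Real.exp (-N - k * m * α)) {L : List (ℕ × Finset ℝ)} (hL : BlocksFull β L)
    {c : ℝ} (hc : c ∈ blockPoints β (List.replicate k (m, A) ++ ([(l, {v})] ++ L)))
    {x : ℝ} (hx : x ∈ Set.Ico (0 : ℝ) 1) :
    |(betaT β)^[k * m] (c + x / β ^ (k * m + (l + blockOrder L))) - x₀| <
      Real.exp (-N - birkhoffSum (betaT β) f (k * m)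
        (c + x / β ^ (k * m + (l + blockOrder L)))) := by
  have hb : 0 < β := by linarith
  rw [blockPoints_append hβ, blockPoints_append hβ, blockOrder_replicate, blockOrder_singleton,
    mem_concatPoints] at hc
  obtain ⟨d, hd, e, he, rfl⟩ := hc
  obtain ⟨v', hv', w, hw, rfl⟩ := mem_concatPoints.1 he
  have hv'' : v' = v := by
    simpa [blockPoints, mem_concatPoints, eq_comm] using hv'
  subst hv''
  have hy := (isFullBranch_of_mem_blockPoints hβ hL hw).point_mem hβ hx
  have eq : d + (v' + w / β ^ l) / β ^ (k * m) + x / β ^ (k * m + (l + blockOrder L)) =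
      d + (v' + (w + x / β ^ blockOrder L) / β ^ l) / β ^ (k * m) := by
    rw [pow_add, pow_add]; field_simp; ring
  have hfd := isFullBranch_of_mem_blockPoints hβ (BlocksFull.replicate hA k) hd
  rw [blockOrder_replicate] at hfd
  rw [eq, hfd.iterate_point (hv.point_mem hβ hy)]
  refine (hvρ _ hy).trans_le (hρ.trans (Real.exp_le_exp.2 ?_))
  linarith [birkhoffSum_replicate_le hβ hA hα k d hd _ (hv.point_mem hβ hy)]

theorem exists_geometric_bracket {R : ℝ} (m t : ℕ) (hR1 : R ≤ 1)
    (hR : (β ^ ((t + 1) * m))⁻¹ ≤ R) :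
    ∃ i ≤ t, (β ^ ((i + 1) * m))⁻¹ ≤ R ∧ R ≤ (β ^ (i * m))⁻¹ := by
  induction t with
  | zero => exact ⟨0, le_rfl, hR, by simpa using hR1⟩
  | succ t ih =>
    by_cases h : (β ^ ((t + 1) * m))⁻¹ ≤ R
    · obtain ⟨i, hi, h1, h2⟩ := ih h
      exact ⟨i, by omega, h1, h2⟩
    · exact ⟨t + 1, le_rfl, hR, (not_le.1 h).le⟩

theorem lt_one_of_mem_blockPoints_append_zero (hβ : 1 < β) {L : List (ℕ × Finset ℝ)}
    (hL : BlocksFull β L) {c : ℝ} (hc : c ∈ blockPoints β (L ++ [(1, {0})])) :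
    c + (β ^ blockOrder (L ++ [(1, {0})]))⁻¹ < 1 := by
  have hb : 0 < β := by linarith
  rw [blockPoints_append hβ, mem_concatPoints] at hc
  obtain ⟨d, hd, e, he, rfl⟩ := hc
  have he0 : e = 0 := by simpa [blockPoints, mem_concatPoints, eq_comm] using he
  rw [he0, zero_div, add_zero, blockOrder_append, blockOrder_singleton]
  have h1 := (isFullBranch_of_mem_blockPoints hβ hL hd).2.1
  have h2 : (β ^ (blockOrder L + 1))⁻¹ < (β ^ blockOrder L)⁻¹ := by
    gcongr ?_⁻¹
    exact pow_lt_pow_right₀ hβ (Nat.lt_succ_self _)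
  linarith

theorem pow_eq_exp_mul_log (hβ : 1 < β) (n : ℕ) : β ^ n = Real.exp (n * Real.log β) := by
  rw [mul_comm, Real.exp_mul, Real.exp_log (by linarith), Real.rpow_natCast]

theorem succ_div_pow_le (hβ : 1 < β) {N n δ κ K : ℝ} {l : ℕ} (hK : 0 < K) (hn : 0 ≤ n)
    (h1 : n * (δ + κ) ≤ l * Real.log β) (h2 : (l : ℝ) + 1 ≤ K * (n + 1))
    (h3 : Real.log K + N + Real.log 2 + Real.log (n + 1) ≤ n * κ) :
    ((l : ℝ) + 1) / β ^ l ≤ Real.exp (-N - n * δ) / 2 := by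
  have hn1 : 0 < n + 1 := by linarith
  rw [pow_eq_exp_mul_log hβ, div_le_div_iff₀ (Real.exp_pos _) two_pos]
  calc ((l : ℝ) + 1) * 2 ≤ K * (n + 1) * 2 := by gcongr
    _ = Real.exp (Real.log K + Real.log (n + 1) + Real.log 2) := by
        rw [Real.exp_add, Real.exp_add, Real.exp_log hK, Real.exp_log hn1, Real.exp_log two_pos]
    _ ≤ Real.exp (-N - n * δ + l * Real.log β) := Real.exp_le_exp.2 (by linarith)
    _ = _ := Real.exp_add _ _

/-- The target words have lengths `l' ≈ kmγ / log β` and `l' + tm ≈ kmα / log β`; their difference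
is a whole number of blocks, so that the second coordinate can be filled. The margin `κ` pays for
the factors `l + 1`, for `exp (-N)` and for rounding. -/
theorem eventually_exists_phase_lengths (hβ : 1 < β) {m : ℕ} (hm : 0 < m) {α γ κ : ℝ} (hγ : 0 ≤ γ)
    (hγα : γ ≤ α) (hκ : 0 < κ) (N : ℝ) : ∀ᶠ k : ℕ in atTop, ∃ l' t : ℕ,
      ((l' : ℝ) + 1) / β ^ l' ≤ Real.exp (-N - k * m * γ) / 2 ∧
      (((l' + t * m : ℕ) : ℝ) + 1) / β ^ (l' + t * m) ≤ Real.exp (-N - k * m * α) / 2 ∧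
      l' * Real.log β ≤ k * m * (γ + κ) + Real.log β ∧
      k * m * (α - γ) ≤ t * m * Real.log β ∧
      t * m * Real.log β ≤ k * m * (α - γ) + m * Real.log β ∧
      (m + 1) * Real.log β ≤ k * m * κ := by
  have hb : 0 < Real.log β := Real.log_pos hβ
  set b := Real.log β with hbdef
  set K := (α + κ) / b + m + 2 with hK
  have hm' : (0 : ℝ) < m := by exact_mod_cast hm
  have hακ : 0 ≤ (α + κ) / b := div_nonneg (by linarith) hb.le
  have hK0 : 0 < K := by linarith
  have htend : Tendsto (fun k : ℕ => k * m) atTop atTop :=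
    tendsto_atTop_mono (fun k => Nat.le_mul_of_pos_right k hm) tendsto_id
  have hlin : ∀ᶠ n : ℕ in atTop, (m + 1) * b ≤ (n : ℝ) * κ :=
    (tendsto_natCast_atTop_atTop.atTop_mul_const hκ).eventually_ge_atTop _
  filter_upwards [htend.eventually (eventually_add_log_le (Real.log K + N + Real.log 2) hκ),
    htend.eventually hlin] with k h1 h2
  push_cast at h1 h2
  set n : ℝ := k * m with hn
  have hn0 : 0 ≤ n := by positivity
  set l' := ⌈n * (γ + κ) / b⌉₊ with hl'
  set t := ⌈k * (α - γ) / b⌉₊ with ht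
  have hl1 : n * (γ + κ) ≤ l' * b := by
    rw [← div_le_iff₀ hb]; exact Nat.le_ceil _
  have hl2 : l' * b ≤ n * (γ + κ) + b := by
    have := (Nat.ceil_lt_add_one (div_nonneg (mul_nonneg hn0 (by linarith)) hb.le :
      0 ≤ n * (γ + κ) / b)).le
    rw [div_add_one hb.ne', le_div_iff₀ hb] at this
    exact this
  have ht1 : n * (α - γ) ≤ t * m * b := by
    have : k * (α - γ) / b ≤ (t : ℝ) := Nat.le_ceil _
    rw [div_le_iff₀ hb] at this
    have := mul_le_mul_of_nonneg_right this hm'.le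
    rw [hn]
    linarith
  have ht2 : t * m * b ≤ n * (α - γ) + m * b := by
    have := (Nat.ceil_lt_add_one (div_nonneg (mul_nonneg (Nat.cast_nonneg k) (by linarith)) hb.le :
      0 ≤ (k : ℝ) * (α - γ) / b)).le
    rw [div_add_one hb.ne', le_div_iff₀ hb] at this
    have := mul_le_mul_of_nonneg_right this hm'.le
    rw [hn]
    linarith
  have hcast : ((l' + t * m : ℕ) : ℝ) = l' + t * m := by push_cast; ring
  have hKb : K * (n + 1) * b = (n + 1) * (α + κ) + (n + 1) * (m + 2) * b := by
    rw [hK]; field_simp; ring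
  have hnm : 0 ≤ n * (m + 2) * b := by positivity
  have hlen : (l' : ℝ) + t * m + 1 ≤ K * (n + 1) := by
    refine le_of_mul_le_mul_right ?_ hb
    nlinarith
  refine ⟨l', t, ?_, ?_, hl2, ht1, ht2, h2⟩
  · refine succ_div_pow_le hβ hK0 hn0 hl1 (le_trans ?_ hlen) h1
    have : (0 : ℝ) ≤ t * m := by positivity
    linarith
  · refine succ_div_pow_le hβ hK0 hn0 ?_ (by rw [hcast]; exact hlen) h1
    rw [hcast, add_mul]
    nlinarith

/-- Both sides are log-affine in `i`, so the two ends control everything between. -/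
theorem mul_pow_le_mul_pow_of_endpoints {E W u φ : ℝ} (hW : 0 ≤ W) (hu : 0 < u)
    (hφ : 0 < φ) {i t : ℕ} (hi : i ≤ t) (h0 : E ≤ W) (ht : E * u ^ t ≤ W * φ ^ t) :
    E * u ^ i ≤ W * φ ^ i := by
  rcases le_total u φ with h | h
  · gcongr
  · refine le_of_mul_le_mul_right ?_ (pow_pos hu (t - i))
    calc E * u ^ i * u ^ (t - i) = E * u ^ t := by
          rw [mul_assoc, ← pow_add, Nat.add_sub_cancel' hi]
      _ ≤ W * φ ^ t := ht
      _ = W * φ ^ i * φ ^ (t - i) := by rw [mul_assoc, ← pow_add, Nat.add_sub_cancel' hi]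
      _ ≤ W * φ ^ i * u ^ (t - i) := by gcongr

/-- One phase of the construction: families of full cylinders of the same order on which the
targets are hit, with good simultaneous counting bounds at all intermediate scales. -/
theorem exists_phase (hβ : 1 < β) {f g : ℝ → ℝ} {x₀ y₀ : ℝ} (hx₀ : x₀ ∈ Set.Icc (0 : ℝ) 1)
    (hy₀ : y₀ ∈ Set.Icc (0 : ℝ) 1) {m : ℕ} (hm : 0 < m) {A A' F : Finset ℝ}
    (hA : ∀ c ∈ A, IsFullBranch β m c) (hA' : ∀ c ∈ A', IsFullBranch β m c)
    (hF : ∀ c ∈ F, IsFullBranch β m c) {α γ ε κ s : ℝ} (hγ : 0 ≤ γ) (hγα : γ ≤ α)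
    (hε : ε ≤ Real.log β) (hκ : 0 < κ) (hs : 0 < s)
    (hfA : ∀ c ∈ A, ∀ x ∈ Set.Ico (0 : ℝ) 1, birkhoffSum (betaT β) f m (c + x / β ^ m) ≤ m * α)
    (hgA : ∀ c ∈ A', ∀ x ∈ Set.Ico (0 : ℝ) 1, birkhoffSum (betaT β) g m (c + x / β ^ m) ≤ m * γ)
    (hFcard : Real.exp (m * (Real.log β - ε)) ≤ F.card)
    (h₁ : Real.exp (m * (s * (Real.log β + γ + 2 * κ))) ≤ (A.card * A'.card : ℝ))
    (h₂ : Real.exp (m * (s * (Real.log β + α + 2 * κ) - (α - γ) * (1 - ε / Real.log β))) ≤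
      (A.card * A'.card : ℝ)) (N : ℕ) :
    ∃ (ℓ n : ℕ) (B B' : Finset ℝ), N ≤ ℓ ∧ B.Nonempty ∧ B'.Nonempty ∧
      (∀ c ∈ B, IsFullBranch β ℓ c ∧ c + (β ^ ℓ)⁻¹ < 1) ∧
      (∀ c ∈ B', IsFullBranch β ℓ c ∧ c + (β ^ ℓ)⁻¹ < 1) ∧
      (∀ c ∈ B, ∀ x ∈ Set.Ico (0 : ℝ) 1, |(betaT β)^[n] (c + x / β ^ ℓ) - x₀| <
        Real.exp (-N - birkhoffSum (betaT β) f n (c + x / β ^ ℓ))) ∧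
      (∀ c ∈ B', ∀ x ∈ Set.Ico (0 : ℝ) 1, |(betaT β)^[n] (c + x / β ^ ℓ) - y₀| <
        Real.exp (-N - birkhoffSum (betaT β) g n (c + x / β ^ ℓ))) ∧
      ∀ R, (β ^ ℓ)⁻¹ ≤ R → R ≤ 1 → ∃ Q Q' : ℕ, CountLE B R Q ∧ CountLE B' R Q' ∧
        (Q * Q' : ℝ) ≤ 9 * β ^ (s * m) * R ^ s * (B.card * B'.card) := by
  have hb0 : 0 < β := by linarith
  have hb : 0 < Real.log β := Real.log_pos hβ
  have hm' : (0 : ℝ) < m := by exact_mod_cast hm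
  have hrpow : ∀ x : ℝ, β ^ x = Real.exp (Real.log β * x) := fun x => Real.rpow_def_of_pos hb0 x
  set b := Real.log β with hbdef
  set W : ℝ := A.card * A'.card with hW
  set φ : ℝ := (F.card : ℝ) with hφ
  have hW0 : 0 < W := (Real.exp_pos _).trans_le h₁
  have hφ0 : 0 < φ := (Real.exp_pos _).trans_le hFcard
  have hAcard : 0 < A.card := by
    rw [Nat.pos_iff_ne_zero]; rintro h; rw [hW, h] at hW0; simp at hW0
  have hA'card : 0 < A'.card := by
    rw [Nat.pos_iff_ne_zero]; rintro h; rw [hW, h] at hW0; simp at hW0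
  have hFcard0 : 0 < F.card := Nat.cast_pos.1 (show (0 : ℝ) < (F.card : ℝ) from hφ0)
  obtain ⟨k, ⟨l', t, hl', hl, hl'b, ht1, ht2, hκk⟩, hkN⟩ :=
    ((eventually_exists_phase_lengths hβ hm hγ hγα hκ N).and (eventually_ge_atTop N)).exists
  rw [← hbdef] at hl'b ht1 ht2 hκk
  have hexp1 : ∀ δ : ℝ, 0 ≤ δ → Real.exp (-N - k * m * δ) ≤ 1 := fun δ hδ => by
    rw [Real.exp_le_one_iff]
    have : 0 ≤ (k : ℝ) * m * δ := by positivity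
    have : (0 : ℝ) ≤ N := Nat.cast_nonneg N
    linarith
  obtain ⟨v, hv, hvρ⟩ := exists_isFullBranch_near_target hβ hx₀ (Real.exp_pos _)
    (hexp1 α (hγ.trans hγα)) hl
  obtain ⟨v', hv', hvρ'⟩ := exists_isFullBranch_near_target hβ hy₀ (Real.exp_pos _)
    (hexp1 γ hγ) hl'
  set l := l' + t * m with hldef
  have hZ : BlocksFull β [(1, {0})] := BlocksFull.singleton (IsFullBranch.zero hβ 1)
  have hvB : BlocksFull β [(l, {v})] := BlocksFull.singleton hv
  have hvB' : BlocksFull β [(l', {v'})] := BlocksFull.singleton hv'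
  have hAB : ∀ i, BlocksFull β (List.replicate i (m, A)) := BlocksFull.replicate hA
  have hAB' : ∀ i, BlocksFull β (List.replicate i (m, A')) := BlocksFull.replicate hA'
  have hFB : ∀ i, BlocksFull β (List.replicate i (m, F)) := BlocksFull.replicate hF
  -- The final digit `0` only serves to keep the closed cylinders away from `1`.
  set L := List.replicate k (m, A) ++ ([(l, {v})] ++ [(1, {0})]) with hL
  set L' := List.replicate k (m, A') ++ ([(l', {v'})] ++ (List.replicate t (m, F) ++ [(1, {0})]))
    with hL'
  have hLf : BlocksFull β L := (hAB k).append (hvB.append hZ)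
  have hLf' : BlocksFull β L' := (hAB' k).append (hvB'.append ((hFB t).append hZ))
  set ℓ := k * m + (l' + (t * m + 1)) with hℓ
  have hLo : blockOrder L = ℓ := by
    simp only [hL, blockOrder_append, blockOrder_replicate, blockOrder_singleton]
    omega
  have hLo' : blockOrder L' = ℓ := by
    simp only [hL', blockOrder_append, blockOrder_replicate, blockOrder_singleton]
    omega
  have hLne : (blockPoints β L).Nonempty := by
    rw [← Finset.card_pos, card_blockPoints hβ hLf]
    simp only [hL, blockCard_append, blockCard_replicate, blockCard_singleton]
    positivity
  have hLne' : (blockPoints β L').Nonempty := by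
    rw [← Finset.card_pos, card_blockPoints hβ hLf']
    simp only [hL', blockCard_append, blockCard_replicate, blockCard_singleton]
    positivity
  -- Mass estimates at the critical scales: inside the free blocks, at the end of the shorter target
  -- word, and at the end of the longer one after `t` filling blocks. The first two come from `h₁`,
  -- the third from `h₂`.
  have hc₁ : ∀ i : ℕ, β ^ (s * (i * m : ℕ)) ≤ W ^ i := by
    intro i
    refine le_trans (le_of_eq ?_) (pow_le_pow_left₀ (Real.exp_pos (m * (s * b))).le
      (le_trans (Real.exp_le_exp.2 ?_) h₁) i)
    · rw [hrpow, ← Real.exp_nat_mul]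
      push_cast
      congr 1
      ring
    · gcongr
      linarith
  have hc₂ : β ^ (s * (k * m + l' : ℕ)) ≤ W ^ k := by
    refine le_trans ?_ (pow_le_pow_left₀ (Real.exp_pos _).le h₁ k)
    rw [hrpow, ← Real.exp_nat_mul, Real.exp_le_exp]
    push_cast
    have h3 : b * (k * m + l') ≤ k * m * (b + γ + 2 * κ) := by
      have : 0 ≤ (m : ℝ) * b := by positivity
      linarith
    have h4 := mul_le_mul_of_nonneg_left h3 hs.le
    linarith
  have hc₃ : β ^ (s * (k * m + l' : ℕ)) * (β ^ (s * m)) ^ t ≤ W ^ k * φ ^ t := by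
    refine le_trans ?_ (mul_le_mul (pow_le_pow_left₀ (Real.exp_pos _).le h₂ k)
      (pow_le_pow_left₀ (Real.exp_pos _).le hFcard t) (by positivity) (by positivity))
    rw [hrpow, hrpow, ← Real.exp_nat_mul, ← Real.exp_nat_mul, ← Real.exp_nat_mul, ← Real.exp_add,
      ← Real.exp_add, Real.exp_le_exp]
    push_cast
    have h3 : (t : ℝ) * (m * (b - ε)) = t * m * b * (1 - ε / b) := by field_simp
    have h4 : 0 ≤ 1 - ε / b := by rw [sub_nonneg, div_le_one hb]; exact hε
    have h5 := mul_le_mul_of_nonneg_right ht1 h4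
    have h6 : b * (k * m + l') + t * m * b ≤ k * m * (b + α + 2 * κ) := by linarith
    have h7 := mul_le_mul_of_nonneg_left h6 hs.le
    rw [h3]
    linarith
  refine ⟨ℓ, k * m, blockPoints β L, blockPoints β L', ?_, hLne, hLne', ?_, ?_, ?_, ?_, ?_⟩
  · have := Nat.le_mul_of_pos_right k hm
    omega
  · intro c hc
    refine ⟨hLo ▸ isFullBranch_of_mem_blockPoints hβ hLf hc, ?_⟩
    rw [← hLo]
    rw [hL, ← List.append_assoc] at hc ⊢
    exact lt_one_of_mem_blockPoints_append_zero hβ ((hAB k).append hvB) hc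
  · intro c hc
    refine ⟨hLo' ▸ isFullBranch_of_mem_blockPoints hβ hLf' hc, ?_⟩
    rw [← hLo']
    rw [hL', ← List.append_assoc, ← List.append_assoc] at hc ⊢
    exact lt_one_of_mem_blockPoints_append_zero hβ (((hAB' k).append hvB').append (hFB t)) hc
  · intro c hc x hx
    have := hits_target_of_blocks hβ hA hfA hv hvρ le_rfl hZ hc hx
    rwa [show k * m + (l + blockOrder [(1, {0})]) = ℓ by
      rw [blockOrder_singleton]; omega] at this
  · intro c hc x hx
    have := hits_target_of_blocks hβ hA' hgA hv' hvρ' le_rfl ((hFB t).append hZ) hc hx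
    rwa [show k * m + (l' + blockOrder (List.replicate t (m, F) ++ [(1, {0})])) = ℓ by
      rw [blockOrder_append, blockOrder_replicate, blockOrder_singleton]] at this
  · intro R hR hR1
    have hR0 : 0 < R := lt_of_lt_of_le (by positivity) hR
    have hmono : ∀ {i j : ℕ}, i ≤ j → (β ^ j)⁻¹ ≤ (β ^ i)⁻¹ := fun h =>
      inv_anti₀ (by positivity) (pow_le_pow_right₀ hβ.le h)
    -- Three ranges of scales: both coordinates free; both inside target words; the first still
    -- inside its target word while the second runs through the filling blocks.
    rcases le_total (β ^ (k * m))⁻¹ R with h | h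
    · obtain ⟨i, hi, hi1, hi2⟩ := exists_geometric_bracket m k hR1
        ((hmono (by rw [add_mul]; omega)).trans h)
      have e : L = List.replicate i (m, A) ++
          (List.replicate (k - i) (m, A) ++ ([(l, {v})] ++ [(1, {0})])) := by
        rw [← List.append_assoc, List.replicate_append_replicate, Nat.add_sub_cancel' hi]
      have e' : L' = List.replicate i (m, A') ++ (List.replicate (k - i) (m, A') ++
          ([(l', {v'})] ++ (List.replicate t (m, F) ++ [(1, {0})]))) := by
        rw [← List.append_assoc, List.replicate_append_replicate, Nat.add_sub_cancel' hi]
      rw [e, e']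
      refine exists_countLE_of_split hβ (hAB i) ((hAB _).append (hvB.append hZ)) (hAB' i)
        ((hAB' _).append (hvB'.append ((hFB t).append hZ))) hs.le hR0
        (by rwa [blockOrder_replicate]) (by rwa [blockOrder_replicate]) (p := i * m)
        (by rwa [add_mul, one_mul] at hi1) ?_
      rw [blockCard_replicate, blockCard_replicate]
      push_cast [← mul_pow]
      have := hc₁ i
      push_cast at this
      exact this
    · rcases le_total (β ^ (k * m + l'))⁻¹ R with h' | h'
      · refine exists_countLE_of_split hβ (hAB k) (hvB.append hZ) (hAB' k)
          (hvB'.append ((hFB t).append hZ)) hs.le hR0 (by rwa [blockOrder_replicate])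
          (by rwa [blockOrder_replicate]) (p := k * m + l')
          ((hmono (Nat.le_add_right _ _)).trans h') ?_
        rw [blockCard_replicate, blockCard_replicate]
        push_cast [← mul_pow]
        push_cast at hc₂
        exact hc₂
      · set p₀ := k * m + l' with hp₀
        have hp0 : 0 < β ^ p₀ := by positivity
        obtain ⟨i, hi, hi1, hi2⟩ := exists_geometric_bracket (β := β) (R := R * β ^ p₀) m t
          (by rwa [← le_div_iff₀ hp0, one_div]) (by
            rw [inv_le_iff_one_le_mul₀ (by positivity), mul_assoc, ← pow_add, ← div_le_iff₀
              (by positivity), one_div]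
            refine (hmono ?_).trans hR
            rw [add_mul]
            omega)
        have e' : L' = (List.replicate k (m, A') ++ ([(l', {v'})] ++ List.replicate i (m, F))) ++
            (List.replicate (t - i) (m, F) ++ [(1, {0})]) := by
          rw [List.append_assoc, List.append_assoc, ← List.append_assoc (List.replicate i (m, F)),
            List.replicate_append_replicate, Nat.add_sub_cancel' hi]
        rw [e']
        refine exists_countLE_of_split hβ (hAB k) (hvB.append hZ)
          ((hAB' k).append (hvB'.append (hFB i))) ((hFB _).append hZ) hs.le hR0
          (by rwa [blockOrder_replicate]) ?_ (p := p₀ + i * m) ?_ ?_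
        · rw [blockOrder_append, blockOrder_append, blockOrder_replicate, blockOrder_replicate,
            blockOrder_singleton, ← add_assoc, pow_add, mul_inv, mul_comm, ← div_eq_mul_inv,
            le_div_iff₀ hp0]
          exact hi2
        · rw [add_assoc, ← Nat.succ_mul, pow_add, mul_inv, mul_comm, ← div_eq_mul_inv,
            div_le_iff₀ hp0]
          exact hi1
        · have h5 := mul_pow_le_mul_pow_of_endpoints (by positivity)
            (by positivity) hφ0 hi hc₂ hc₃
          rw [blockCard_append, blockCard_append, blockCard_replicate, blockCard_replicate,
            blockCard_replicate, blockCard_singleton]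
          push_cast
          rw [one_mul, ← mul_assoc, ← mul_pow]
          refine le_trans (le_of_eq ?_) h5
          rw [← Real.rpow_natCast (β ^ (s * m)), ← Real.rpow_mul hb0.le, ← Real.rpow_add hb0]
          congr 1
          ring

/-! ### Lower bound: assembling the phases. -/

theorem birkhoffSum_le_of_abs_le {f : ℝ → ℝ} {D : ℝ} (hD : ∀ x ∈ Set.Icc (0 : ℝ) 1, |f x| ≤ D)
    {x : ℝ} (hx : x ∈ Set.Ico (0 : ℝ) 1) (n : ℕ) : birkhoffSum (betaT β) f n x ≤ n * D :=
  (abs_le.1 (birkhoffSum_betaT_bounds β hD hx n)).2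

theorem iterate_add_hits_target {f : ℝ → ℝ} {D : ℝ} (hD : ∀ x ∈ Set.Icc (0 : ℝ) 1, |f x| ≤ D)
    {x x₀ N : ℝ} (hx : x ∈ Set.Ico (0 : ℝ) 1) {M n : ℕ} (hN : M * D ≤ N)
    (h : |(betaT β)^[n] ((betaT β)^[M] x) - x₀| <
      Real.exp (-N - birkhoffSum (betaT β) f n ((betaT β)^[M] x))) :
    |(betaT β)^[M + n] x - x₀| < Real.exp (-birkhoffSum (betaT β) f (M + n) x) := by
  rw [add_comm M n, Function.iterate_add_apply, add_comm n M, birkhoffSum_add]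
  refine h.trans_le (Real.exp_le_exp.2 ?_)
  linarith [birkhoffSum_le_of_abs_le (β := β) hD hx M]

theorem le_dimH_shrinkingTargetSet_of_phases (hβ : 1 < β) {f g : ℝ → ℝ}
    (hf : ContinuousOn f (Set.Icc 0 1)) (hg : ContinuousOn g (Set.Icc 0 1)) {x₀ y₀ s s' C : ℝ}
    (hs0 : 0 < s) (hs : s < s') (hC : 0 < C)
    (phase : ∀ N : ℕ, ∃ (ℓ n : ℕ) (B B' : Finset ℝ), N ≤ ℓ ∧ B.Nonempty ∧ B'.Nonempty ∧
      (∀ c ∈ B, IsFullBranch β ℓ c ∧ c + (β ^ ℓ)⁻¹ < 1) ∧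
      (∀ c ∈ B', IsFullBranch β ℓ c ∧ c + (β ^ ℓ)⁻¹ < 1) ∧
      (∀ c ∈ B, ∀ x ∈ Set.Ico (0 : ℝ) 1, |(betaT β)^[n] (c + x / β ^ ℓ) - x₀| <
        Real.exp (-N - birkhoffSum (betaT β) f n (c + x / β ^ ℓ))) ∧
      (∀ c ∈ B', ∀ x ∈ Set.Ico (0 : ℝ) 1, |(betaT β)^[n] (c + x / β ^ ℓ) - y₀| <
        Real.exp (-N - birkhoffSum (betaT β) g n (c + x / β ^ ℓ))) ∧
      ∀ R, (β ^ ℓ)⁻¹ ≤ R → R ≤ 1 → ∃ Q Q' : ℕ, CountLE B R Q ∧ CountLE B' R Q' ∧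
        (Q * Q' : ℝ) ≤ C * R ^ s' * (B.card * B'.card)) :
    ENNReal.ofReal s ≤ dimH (shrinkingTargetSet β f g x₀ y₀) := by
  have hb0 : 0 < β := by linarith
  have hb : 0 < Real.log β := Real.log_pos hβ
  obtain ⟨D₁, hD₁⟩ := isCompact_Icc.exists_bound_of_continuousOn hf
  obtain ⟨D₂, hD₂⟩ := isCompact_Icc.exists_bound_of_continuousOn hg
  set D := max D₁ D₂
  have hfD : ∀ x ∈ Set.Icc (0 : ℝ) 1, |f x| ≤ D := fun x hx => (hD₁ x hx).trans (le_max_left _ _)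
  have hgD : ∀ x ∈ Set.Icc (0 : ℝ) 1, |g x| ≤ D := fun x hx => (hD₂ x hx).trans (le_max_right _ _)
  choose ℓ n B B' hℓ hne hne' hfull hfull' hhit hhit' hcount using phase
  obtain ⟨N₀, hN₀⟩ := exists_nat_ge (Real.log C / (Real.log β * (s' - s)))
  rw [div_le_iff₀ (mul_pos hb (by linarith))] at hN₀
  -- A phase starting at depth `M` is given the parameter at least `M D`, so its reserve `exp (-N)`
  -- absorbs the Birkhoff sum over the past; adding `N₀` makes the order large enough for `C ≤
  -- β^((s' - s) * order)`.
  set next : ℕ → ℕ := fun M => ⌈M * D⌉₊ + N₀ with hnext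
  set M : ℕ → ℕ := fun j => Nat.rec 0 (fun _ M => M + ℓ (next M)) j with hM
  have hMsucc : ∀ j, M (j + 1) = M j + ℓ (next (M j)) := fun j => rfl
  set S : FullBranchSystem β :=
    { order := fun j => ℓ (next (M j))
      words := fun j => B (next (M j))
      nonempty := fun j => hne _
      isFull := fun j c hc => (hfull _ c hc).1
      lt_one := fun j c hc => (hfull _ c hc).2 } with hS
  set S' : FullBranchSystem β :=
    { order := fun j => ℓ (next (M j))
      words := fun j => B' (next (M j))
      nonempty := fun j => hne' _
      isFull := fun j c hc => (hfull' _ c hc).1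
      lt_one := fun j c hc => (hfull' _ c hc).2 } with hS'
  have hdepth : ∀ j, S.depth j = M j := by
    intro j
    induction j with
    | zero => rfl
    | succ j ih => rw [S.depth_succ, ih, hMsucc]
  have hdepth' : ∀ j, S'.depth j = M j := hdepth
  have hnextD : ∀ j, (M j : ℝ) * D ≤ (next (M j) : ℕ) := by
    intro j
    simp only [hnext]
    push_cast
    have := Nat.le_ceil ((M j : ℝ) * D)
    have : (0 : ℝ) ≤ N₀ := Nat.cast_nonneg _
    linarith
  have hpair : PairCount S S' s s' C := by
    refine ⟨fun j => rfl, fun j => ?_, fun j R h1 h2 => hcount _ R h1 h2⟩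
    have h1 : (N₀ : ℝ) ≤ S.order j := by
      have h2 := hℓ (next (M j))
      have h3 : N₀ ≤ next (M j) := Nat.le_add_left _ _
      exact_mod_cast h3.trans h2
    rw [Real.rpow_def_of_pos hb0, ← Real.log_le_iff_le_exp hC]
    have h2 := mul_le_mul_of_nonneg_right h1 (mul_pos hb (sub_pos.2 hs)).le
    linarith
  refine le_dimH_of_pairCount hβ hs0 hs.le hC hpair ?_
  rintro ⟨x, y⟩ ⟨hx, hy⟩
  obtain ⟨hx1, hx2⟩ := S.limitSet_spec hβ hx
  obtain ⟨hy1, hy2⟩ := S'.limitSet_spec hβ hy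
  refine ⟨Set.Ico_subset_Icc_self hx1, Set.Ico_subset_Icc_self hy1, ?_⟩
  refine frequently_atTop.2 fun j => ⟨M j + n (next (M j)), ?_, ?_, ?_⟩
  · have := S.le_depth j
    rw [hdepth] at this
    omega
  · obtain ⟨c, hc, z, hz, e⟩ := hx2 j
    rw [hdepth] at e
    refine iterate_add_hits_target hfD hx1 (hnextD j) ?_
    have := hhit (next (M j)) c hc z hz
    change _ = c + z / β ^ ℓ (next (M j)) at e
    simp only
    rwa [e]
  · obtain ⟨c, hc, z, hz, e⟩ := hy2 j
    rw [hdepth'] at e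
    refine iterate_add_hits_target hgD hy1 (hnextD j) ?_
    have := hhit' (next (M j)) c hc z hz
    change _ = c + z / β ^ ℓ (next (M j)) at e
    simp only
    rwa [e]

/-- Lower bound for the dimension from a pair of equilibrium weights `exp (q₁ S_n f)` and
`exp (q₂ S_n g)`. -/
theorem le_dimH_shrinkingTargetSet_of_pressure (hβ : 1 < β) {f g : ℝ → ℝ}
    (hf : ContinuousOn f (Set.Icc 0 1)) (hg : ContinuousOn g (Set.Icc 0 1))
    (hg_pos : ∀ y ∈ Set.Icc (0 : ℝ) 1, 0 < g y)
    (hfg : ∀ x ∈ Set.Icc (0 : ℝ) 1, ∀ y ∈ Set.Icc (0 : ℝ) 1, g y ≤ f x)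
    {x₀ y₀ : ℝ} (hx₀ : x₀ ∈ Set.Icc (0 : ℝ) 1) (hy₀ : y₀ ∈ Set.Icc (0 : ℝ) 1)
    {s q₁ q₂ : ℝ} (hs : 0 < s)
    (hP : s * Real.log β < betaPressure β (fun x => q₁ * f x) + betaPressure β (fun x => q₂ * g x))
    (hq : ∀ τ σ, σ ≤ τ → s * σ ≤ -q₁ * τ - q₂ * σ ∧ s * τ - (τ - σ) ≤ -q₁ * τ - q₂ * σ) :
    ENNReal.ofReal s ≤ dimH (shrinkingTargetSet β f g x₀ y₀) := by
  have hb0 : 0 < β := by linarith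
  have hb : 0 < Real.log β := Real.log_pos hβ
  set b := Real.log β with hbdef
  obtain ⟨D, hD⟩ := isCompact_Icc.exists_bound_of_continuousOn hf
  simp only [Real.norm_eq_abs] at hD
  have hD0 : 0 ≤ D := (abs_nonneg _).trans (hD 0 (by simp))
  set P₁ := betaPressure β (fun x => q₁ * f x) with hP₁
  set P₂ := betaPressure β (fun x => q₂ * g x) with hP₂
  set δ := P₁ + P₂ - s * b with hδ
  have hδ0 : 0 < δ := by linarith
  -- Coefficient of `e` in the total loss, using `e ≤ 1` and `τ ≤ D`: `2e` from the two
  -- cardinalities, `3(s + e)e` from shifting `τ`, `σ` and from `κ`, `e(b + τ)` from raising `s` to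
  -- `s + e`, and `e(τ - σ)/b` from the filling blocks.
  set K := 5 + 3 * s + b + D + D / b with hK
  have hDb : 0 ≤ D / b := by positivity
  have hK0 : 0 < K := by linarith
  obtain ⟨e, he0, he1, heb, heK⟩ : ∃ e : ℝ, 0 < e ∧ e ≤ 1 ∧ e ≤ b ∧ e * K ≤ δ := by
    refine ⟨min 1 (min b (δ / K)), by positivity, min_le_left _ _,
      (min_le_right _ _).trans (min_le_left _ _), ?_⟩
    rw [← le_div_iff₀ hK0]
    exact (min_le_right _ _).trans (min_le_right _ _)
  -- The weight `0` provides the filling blocks `F`, nearly `β^m` full cylinders.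
  have hP0 : betaPressure β (fun x => 0 * f x) = b := by
    simp only [zero_mul]
    exact betaPressure_zero hβ
  obtain ⟨m, ⟨⟨⟨⟨τ, A, hA, ⟨cτ, hcτ, hτ⟩, hAτ, hAcard⟩, σ, A', hA', ⟨cσ, hcσ, hσ⟩, hAσ, hAcard'⟩,
    τ', F, hF, -, -, hFcard⟩, hm⟩⟩ :=
    ((((eventually_exists_fullPoints_level hβ hf q₁ he0).and
      (eventually_exists_fullPoints_level hβ hg q₂ he0)).and
      (eventually_exists_fullPoints_level hβ hf 0 he0)).and (eventually_gt_atTop 0)).exists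
  rw [hP0, zero_mul, sub_zero] at hFcard
  have hm' : (0 : ℝ) < m := by exact_mod_cast hm
  have hcτI := (hA cτ hcτ).mem_Ico hβ
  have hcσI := (hA' cσ hcσ).mem_Ico hβ
  have hστ : σ ≤ τ := by
    have := birkhoffSum_le_birkhoffSum (β := β) hfg (Set.Ico_subset_Icc_self hcτI)
      (Set.Ico_subset_Icc_self hcσI) m
    rw [hτ, hσ] at this
    exact le_of_mul_le_mul_left this hm'
  have hσ0 : 0 ≤ σ := by
    have h1 : 0 ≤ birkhoffSum (betaT β) g m cσ := Finset.sum_nonneg fun j _ =>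
      (hg_pos _ (betaT_iterate_mem_Icc β (Set.Ico_subset_Icc_self hcσI) j)).le
    rw [hσ] at h1
    exact nonneg_of_mul_nonneg_right h1 hm'
  have hτD : τ ≤ D := by
    have := birkhoffSum_le_of_abs_le (β := β) hD hcτI m
    rw [hτ] at this
    exact le_of_mul_le_mul_left this hm'
  obtain ⟨hq₁, hq₂⟩ := hq τ σ hστ
  have hcard : Real.exp (m * (P₁ + P₂ - q₁ * τ - q₂ * σ - 2 * e)) ≤ (A.card * A'.card : ℝ) := by
    refine le_trans (le_of_eq ?_) (mul_le_mul hAcard hAcard' (Real.exp_pos _).le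
      (Nat.cast_nonneg _))
    rw [← Real.exp_add]
    congr 1
    ring
  have hee : e * e ≤ e := mul_le_of_le_one_left he0.le he1
  have heK' : 5 * e + 3 * (s * e) + e * b + e * D + e * (D / b) ≤ δ := by
    rw [hK] at heK; linarith
  have heτ : e * τ ≤ e * D := mul_le_mul_of_nonneg_left hτD he0.le
  have heσ : e * σ ≤ e * D := mul_le_mul_of_nonneg_left (hστ.trans hτD) he0.le
  have heDb : (τ - σ) * (e / b) ≤ e * (D / b) := by
    calc (τ - σ) * (e / b) ≤ D * (e / b) :=
          mul_le_mul_of_nonneg_right (by linarith) (by positivity)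
      _ = e * (D / b) := by ring
  have heDb0 : 0 ≤ e * (D / b) := by positivity
  refine le_dimH_shrinkingTargetSet_of_phases hβ hf hg hs (show s < s + e by linarith)
    (C := 9 * β ^ ((s + e) * m)) (by positivity)
    (exists_phase hβ hx₀ hy₀ hm hA hA' hF (α := τ + e) (γ := σ + e) (ε := e) (κ := e)
      (by linarith) (by linarith) heb he0 (by linarith) hAτ hAσ hFcard ?_ ?_)
  · refine le_trans (Real.exp_le_exp.2 (mul_le_mul_of_nonneg_left ?_ hm'.le)) hcard
    linarith
  · refine le_trans (Real.exp_le_exp.2 (mul_le_mul_of_nonneg_left ?_ hm'.le)) hcard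
    rw [← hbdef]
    linarith

/-! ### Conclusion. -/

theorem le_ofReal_of_forall_gt {d : ENNReal} {a : ℝ} (h : ∀ s, a < s → d ≤ ENNReal.ofReal s) :
    d ≤ ENNReal.ofReal a := by
  have hlim : Tendsto ENNReal.ofReal (𝓝[>] a) (𝓝 (ENNReal.ofReal a)) :=
    ENNReal.continuous_ofReal.continuousAt.tendsto.mono_left nhdsWithin_le_nhds
  refine ge_of_tendsto hlim ?_
  filter_upwards [self_mem_nhdsWithin] with s hs using h s hs

/-- Strict decrease in `s` at rate at least `log β`. It makes the set defining the infimum non-empty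
and the rate strictly negative beyond the infimum. -/
theorem betaPressure_fst_add_le (β : ℝ) {f : ℝ → ℝ} (hf : ContinuousOn f (Set.Icc 0 1))
    (hf_pos : ∀ x ∈ Set.Icc (0 : ℝ) 1, 0 < f x) {s' s : ℝ} (h : s' ≤ s) :
    betaPressure β (fun x => f x - s * (Real.log β + f x)) + (s - s') * Real.log β ≤
      betaPressure β (fun x => f x - s' * (Real.log β + f x)) := by
  have hc : ∀ t : ℝ, ContinuousOn (fun x => f x - t * (Real.log β + f x)) (Set.Icc 0 1) :=
    fun t => hf.sub (continuousOn_const.mul (continuousOn_const.add hf))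
  refine betaPressure_add_le β (hc s) (hc s') fun x hx => ?_
  nlinarith [hf_pos x hx]

theorem betaPressure_snd_add_le (β : ℝ) {g : ℝ → ℝ} (hg : ContinuousOn g (Set.Icc 0 1))
    (hg_pos : ∀ x ∈ Set.Icc (0 : ℝ) 1, 0 < g x) {s' s : ℝ} (h : s' ≤ s) :
    betaPressure β (fun x => -s * (Real.log β + g x)) + (s - s') * Real.log β ≤
      betaPressure β (fun x => -s' * (Real.log β + g x)) := by
  have hc : ∀ t : ℝ, ContinuousOn (fun x => -t * (Real.log β + g x)) (Set.Icc 0 1) :=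
    fun t => continuousOn_const.mul (continuousOn_const.add hg)
  refine betaPressure_add_le β (hc s) (hc s') fun x hx => ?_
  nlinarith [hg_pos x hx]

end

theorem theorem1p1 (β : ℝ) (hβ : 1 < β) (f g : ℝ → ℝ)
    (hf : ContinuousOn f (Set.Icc 0 1)) (hg : ContinuousOn g (Set.Icc 0 1))
    (hf_pos : ∀ x ∈ Set.Icc (0 : ℝ) 1, 0 < f x) (hg_pos : ∀ y ∈ Set.Icc (0 : ℝ) 1, 0 < g y)
    (hfg : ∀ x ∈ Set.Icc (0 : ℝ) 1, ∀ y ∈ Set.Icc (0 : ℝ) 1, g y ≤ f x)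
    (x₀ y₀ : ℝ) (hx₀ : x₀ ∈ Set.Icc (0 : ℝ) 1) (hy₀ : y₀ ∈ Set.Icc (0 : ℝ) 1) :
    dimH (shrinkingTargetSet β f g x₀ y₀) =
      ENNReal.ofReal (min
        (sInf {s : ℝ | 0 ≤ s ∧
          betaPressure β (fun x => f x - s * (Real.log β + f x)) +
            betaPressure β (fun x => -g x) ≤ 0})
        (sInf {s : ℝ | 0 ≤ s ∧
          betaPressure β (fun x => -s * (Real.log β + g x)) + Real.log β ≤ 0})) := by
  have hb : 0 < Real.log β := Real.log_pos hβ
  set Z₁ := {s : ℝ | 0 ≤ s ∧ betaPressure β (fun x => f x - s * (Real.log β + f x)) +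
    betaPressure β (fun x => -g x) ≤ 0} with hZ₁
  set Z₂ := {s : ℝ | 0 ≤ s ∧
    betaPressure β (fun x => -s * (Real.log β + g x)) + Real.log β ≤ 0} with hZ₂
  have hne₁ : Z₁.Nonempty := by
    set p := betaPressure β (fun x => f x - 0 * (Real.log β + f x)) +
      betaPressure β (fun x => -g x) with hp
    refine ⟨max 0 (p / Real.log β), le_max_left _ _, ?_⟩
    have h1 := betaPressure_fst_add_le β hf hf_pos (le_max_left 0 (p / Real.log β))
    have h2 : p ≤ max 0 (p / Real.log β) * Real.log β := by
      rw [← div_le_iff₀ hb]; exact le_max_right _ _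
    linarith
  have hne₂ : Z₂.Nonempty := by
    refine ⟨2, zero_le_two, ?_⟩
    have h1 := betaPressure_snd_add_le β hg hg_pos (show (0 : ℝ) ≤ 2 by norm_num)
    simp only [neg_zero, zero_mul] at h1
    rw [betaPressure_zero hβ] at h1
    linarith
  have hbdd₁ : BddBelow Z₁ := ⟨0, fun s hs => hs.1⟩
  have hbdd₂ : BddBelow Z₂ := ⟨0, fun s hs => hs.1⟩
  apply le_antisymm
  · rw [ENNReal.ofReal_min]
    refine le_min (le_ofReal_of_forall_gt fun s hs => ?_) (le_ofReal_of_forall_gt fun s hs => ?_)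
    · obtain ⟨s', hs', hlt⟩ := exists_lt_of_csInf_lt hne₁ hs
      have h1 := betaPressure_fst_add_le β hf hf_pos hlt.le
      have h2 := mul_pos (sub_pos.2 hlt) hb
      exact dimH_shrinkingTargetSet_le hβ hf hg x₀ y₀ fun K hK =>
        dimH_enlargedTargetSet_le_of_fst hβ hf hg hfg x₀ y₀ hK (hs'.1.trans_lt hlt)
          (by linarith [hs'.2])
    · obtain ⟨s', hs', hlt⟩ := exists_lt_of_csInf_lt hne₂ hs
      have h1 := betaPressure_snd_add_le β hg hg_pos hlt.le
      have h2 := mul_pos (sub_pos.2 hlt) hb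
      exact dimH_shrinkingTargetSet_le hβ hf hg x₀ y₀ fun K hK =>
        dimH_enlargedTargetSet_le_of_snd hβ hf hg hfg x₀ y₀ hK (hs'.1.trans_lt hlt)
          (by linarith [hs'.2])
  · refine le_of_forall_lt_imp_le_of_dense fun c hc => ?_
    have hctop : c ≠ ⊤ := ne_top_of_lt hc
    rw [← ENNReal.ofReal_toReal hctop] at hc ⊢
    set s := c.toReal with hs
    rcases (ENNReal.toReal_nonneg : 0 ≤ c.toReal).eq_or_lt with h0 | h0
    · rw [hs, ← h0]; simp
    have hlt := (ENNReal.ofReal_lt_ofReal_iff_of_nonneg h0.le).1 hc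
    have hs₁ : 0 < betaPressure β (fun x => f x - s * (Real.log β + f x)) +
        betaPressure β (fun x => -g x) := by
      by_contra! hcon
      exact absurd (csInf_le hbdd₁ ⟨h0.le, hcon⟩) (not_le.2 (hlt.trans_le (min_le_left _ _)))
    have hs₂ : 0 < betaPressure β (fun x => -s * (Real.log β + g x)) + Real.log β := by
      by_contra! hcon
      exact absurd (csInf_le hbdd₂ ⟨h0.le, hcon⟩) (not_le.2 (hlt.trans_le (min_le_right _ _)))
    -- For `σ ≤ τ` the larger of `sσ` and `sτ - (τ - σ)` is the second when `s ≥ 1` and the first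
    -- when `s ≤ 1`; the weights `q₁`, `q₂` make `-q₁τ - q₂σ` equal to it.
    rcases le_total 1 s with h1 | h1
    · refine le_dimH_shrinkingTargetSet_of_pressure hβ hf hg hg_pos hfg hx₀ hy₀ (q₁ := 1 - s)
        (q₂ := -1) h0 ?_ fun τ σ h => ⟨by nlinarith, by linarith⟩
      have h2 := betaPressure_add_le β
        (h₁ := fun x => f x - s * (Real.log β + f x)) (h₂ := fun x => (1 - s) * f x)
        (hf.sub (continuousOn_const.mul (continuousOn_const.add hf)))
        (continuousOn_const.mul hf)
        (κ := s * Real.log β) fun x _ => by linarith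
      simp only [neg_one_mul]
      linarith
    · refine le_dimH_shrinkingTargetSet_of_pressure hβ hf hg hg_pos hfg hx₀ hy₀ (q₁ := 0)
        (q₂ := -s) h0 ?_ fun τ σ h => ⟨by linarith, by nlinarith⟩
      have h2 := betaPressure_add_le β
        (h₁ := fun x => -s * (Real.log β + g x)) (h₂ := fun x => -s * g x)
        (continuousOn_const.mul (continuousOn_const.add hg)) (continuousOn_const.mul hg)
        (κ := s * Real.log β) fun x _ => by linarith
      simp only [zero_mul]
      rw [betaPressure_zero hβ]
      linarith
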